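/- Let $\mathcal B$ be a unital $C^*$-algebra, $\mathcal B\langle X\rangle$ the algebraic free product of $\mathcal B$ and a self-adjoint symbol $X$, and let $M_n(\mathcal B)$ carry its $C^*$-norm. A distribution ($\mu\in\Sigma_0$) is a linear, unital, $\mathcal B$-bimodular map $\mu:\mathcal B\langle X\rangle\to\mathcal B$ which is completely positive ($[\mu(P_iP_j^*)]_{i,j}\ge 0$ for every finite family $P_i\in\mathcal B\langle X\rangle$) and has an exponential bound, i.e. for some $M$, $$\|\mu(b_1Xb_2\cdots Xb_{n+1})\|\le M^n\|b_1\|\cdots\|b_{n+1}\| \quad\text{for all } n\ge 0,\ b_i\in\mathcal B .$$ For $\epsilon>0$ let $M_n^{+,\epsilon}(\mathcal B)=\{b\in M_n(\mathcal B):\Im b>\epsilon 1_n\}$ (that is, $\Im b-\epsilon 1_n$ is positive and invertible), and $M_n^+(\mathcal B)=\bigcup_{\epsilon>0}M_n^{+,\epsilon}(\mathcal B)$. On $M_n^+(\mathcal B)$ let $G_\mu^{(n)}(b)=(\mu\otimes 1_n)((b-X\otimes 1_n)^{-1})$, i.e. the analytic function on $M_n^+(\mathcal B)$ equal to $\sum_{p\ge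 0}(\mu\otimes 1_n)((b^{-1}X)^pb^{-1})$ for small $\|b^{-1}\|$; let $F_\mu^{(n)}(b)=G_\mu^{(n)}(b)^{-1}$, and $H_\mu^{(n)}(b)=G_\mu^{(n)}(b^{-1})$ whenever $b$ is invertible with $b^{-1}\in M_n^+(\mathcal B)$. Monotone convolution $\rhd$ is defined by $F_{\mu\rhd\nu}=F_\mu\circ F_\nu$. Let $B_r^{nc}(0)=\bigsqcup_{n\ge 1}\{b\in M_n(\mathcal B):\|b\|<r\}$. A noncommutative function on it is a family of maps into the $M_n(\mathcal B)$ that preserves the size $n$ and respects direct sums and similarities by invertible complex matrices (whenever the similar point is in the domain). For every $M$ there is $r>0$, depending only on $M$, such that the following holds. Let $\mu$ be a $\rhd$-infinitely divisible distribution with exponential bound $M$, and for each $k\ge 1$ let $\mu_k\in\Sigma_0$ satisfy $\mu=\mu_k\rhd\cdots\rhd\mu_k$ ($k$ factors). Then: 1. For every $\epsilon>0$, $\|F^{(n)}_{\mu_k}(b)-b\|\to 0$ as $k\to\infty$, uniformly over $b\in M_n^{+,\epsilon}(\mathcal B)$ and over $n\ge 1$. 2. For every $k\ge1$, the functions $b\mapsto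 F^{(n)}_{\mu_k}(b^{-1})-b^{-1}$ and $b\mapsto F^{(n)}_{\mu_k}(b^{-1})^{-1}=H^{(n)}_{\mu_k}(b)$, defined for invertible $b$ with $b^{-1}\in M_n^+(\mathcal B)$, extend from the points of $B_r^{nc}(0)$ where they are defined to analytic noncommutative functions on $B_r^{nc}(0)$. As $k\to\infty$ the first extension converges to $0$ and the second to $b$, in norm, uniformly over $b\in B_r^{nc}(0)$ (in particular uniformly in $n$). -/

import Mathlib

open Filter Topology

noncomputable section

namespace OpVal

/-! ### The algebra `B⟨X⟩` of noncommutative polynomials -/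

section Poly

variable (B : Type*) [CStarAlgebra B]

/-- Relations making `some : B → FreeAlgebra ℂ (Option B)` a homomorphism of unital complex algebras.
The generator `none` is the free symbol `X`. -/
inductive Rel : FreeAlgebra ℂ (Option B) → FreeAlgebra ℂ (Option B) → Prop
  | add (b c : B) : Rel (FreeAlgebra.ι ℂ (some (b + c)))
      (FreeAlgebra.ι ℂ (some b) + FreeAlgebra.ι ℂ (some c))
  | mul (b c : B) : Rel (FreeAlgebra.ι ℂ (some (b * c)))
      (FreeAlgebra.ι ℂ (some b) * FreeAlgebra.ι ℂ (some c))
  | scalar (z : ℂ) : Rel (FreeAlgebra.ι ℂ (some (algebraMap ℂ B z)))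
      (algebraMap ℂ (FreeAlgebra ℂ (Option B)) z)

/-- `B⟨X⟩`: the algebraic free product (over `ℂ`) of `B` and the polynomials in a symbol `X`. -/
abbrev NCPoly : Type _ := RingQuot (Rel B)

variable {B}

namespace NCPoly

/-- The free symbol `X`. -/
def X : NCPoly B := RingQuot.mkAlgHom ℂ (Rel B) (FreeAlgebra.ι ℂ none)

/-- The inclusion `B → B⟨X⟩`. -/
def C : B →ₐ[ℂ] NCPoly B :=
  AlgHom.ofLinearMap
    { toFun := fun b => RingQuot.mkAlgHom ℂ (Rel B) (FreeAlgebra.ι ℂ (some b))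
      map_add' := fun b c => by
        rw [← map_add]; exact RingQuot.mkAlgHom_rel ℂ (Rel.add b c)
      map_smul' := fun z b => by
        rw [Algebra.smul_def, RingQuot.mkAlgHom_rel ℂ (Rel.mul _ b), map_mul,
          RingQuot.mkAlgHom_rel ℂ (Rel.scalar z), AlgHom.commutes, ← Algebra.smul_def]
        rfl }
    (by
      have h := RingQuot.mkAlgHom_rel ℂ (Rel.scalar (B := B) 1)
      simpa using h)
    (fun b c => by
      have h := RingQuot.mkAlgHom_rel ℂ (Rel.mul b c)
      simpa using h)

/-- The universal property of `B⟨X⟩`: evaluation at an element `x` of a `B`-algebra. -/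
def eval {A : Type*} [Ring A] [Algebra ℂ A] (f : B →ₐ[ℂ] A) (x : A) : NCPoly B →ₐ[ℂ] A :=
  RingQuot.liftAlgHom ℂ ⟨FreeAlgebra.lift ℂ (fun o => o.elim x f), by
    intro p q h
    cases h <;> simp⟩

@[simp] theorem eval_X {A : Type*} [Ring A] [Algebra ℂ A] (f : B →ₐ[ℂ] A) (x : A) :
    eval f x X = x := by
  simp [eval, X]

@[simp] theorem eval_C {A : Type*} [Ring A] [Algebra ℂ A] (f : B →ₐ[ℂ] A) (x : A) (b : B) :
    eval f x (C b) = f b := by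
  simp [eval, C]

theorem algHom_ext {A : Type*} [Ring A] [Algebra ℂ A] {f g : NCPoly B →ₐ[ℂ] A}
    (hX : f X = g X) (hC : ∀ b, f (C b) = g (C b)) : f = g := by
  apply RingQuot.ringQuot_ext'
  apply FreeAlgebra.hom_ext
  funext o
  cases o with
  | none => exact hX
  | some b => exact hC b

variable (B) in
/-- The opposite algebra of `B⟨X⟩` with the conjugate action of `ℂ`. -/
def ConjOp : Type _ := (NCPoly B)ᵐᵒᵖ

instance : Ring (ConjOp B) := inferInstanceAs (Ring (NCPoly B)ᵐᵒᵖ)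

instance : Algebra ℂ (ConjOp B) :=
  RingHom.toAlgebra'
    (((algebraMap ℂ (NCPoly B)ᵐᵒᵖ).comp (starRingEnd ℂ) : ℂ →+* (NCPoly B)ᵐᵒᵖ) :
      ℂ →+* ConjOp B)
    (fun z x => Algebra.commutes (A := (NCPoly B)ᵐᵒᵖ) (starRingEnd ℂ z) x)

/-- `b ↦ b^*` as a homomorphism into the conjugate opposite algebra. -/
def conjC : B →ₐ[ℂ] ConjOp B where
  toFun b := (MulOpposite.op (C (star b)) : (NCPoly B)ᵐᵒᵖ)
  map_one' := by simp only [star_one, map_one]; rfl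
  map_mul' b c := by simp only [star_mul, map_mul]; rfl
  map_zero' := by simp only [star_zero, map_zero]; rfl
  map_add' b c := by simp only [star_add, map_add]; rfl
  commutes' z := by
    change (MulOpposite.op (C (star (algebraMap ℂ B z))) : (NCPoly B)ᵐᵒᵖ) =
      algebraMap ℂ (NCPoly B)ᵐᵒᵖ (starRingEnd ℂ z)
    rw [← algebraMap_star_comm, AlgHom.commutes]; rfl

/-- `X` in the conjugate opposite algebra. -/
def conjX : ConjOp B := (MulOpposite.op X : (NCPoly B)ᵐᵒᵖ)

/-- The algebra homomorphism behind the involution. -/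
def starHom : NCPoly B →ₐ[ℂ] ConjOp B := eval conjC conjX

/-- The involution of `B⟨X⟩`: conjugate linear, antimultiplicative, extending that of `B`, with
`X` self-adjoint. -/
instance : Star (NCPoly B) := ⟨fun p => MulOpposite.unop (starHom p : (NCPoly B)ᵐᵒᵖ)⟩

theorem star_def (p : NCPoly B) : star p = MulOpposite.unop (starHom p : (NCPoly B)ᵐᵒᵖ) := rfl

@[simp] theorem star_X : star (X : NCPoly B) = X := by
  rw [star_def, starHom, eval_X]; rfl

@[simp] theorem star_C (b : B) : star (C b) = C (star b) := by
  rw [star_def, starHom, eval_C]; rfl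

theorem star_mul' (p q : NCPoly B) : star (p * q) = star q * star p := by
  rw [star_def, map_mul]; rfl

theorem star_add' (p q : NCPoly B) : star (p + q) = star p + star q := by
  rw [star_def, map_add]; rfl

theorem star_algebraMap (z : ℂ) :
    star (algebraMap ℂ (NCPoly B) z) = algebraMap ℂ (NCPoly B) (star z) := by
  rw [star_def, AlgHom.commutes]; rfl

theorem star_star' (p : NCPoly B) : star (star p) = p := by
  let f : NCPoly B →ₐ[ℂ] NCPoly B :=
    { toFun := fun p => star (star p)
      map_one' := by
        have h := star_algebraMap (B := B) 1
        simp only [map_one, star_one] at h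
        rw [h, h]
      map_mul' := fun p q => by rw [star_mul', star_mul']
      map_zero' := by
        have h := star_algebraMap (B := B) 0
        simp only [map_zero, star_zero] at h
        rw [h, h]
      map_add' := fun p q => by rw [star_add', star_add']
      commutes' := fun z => by rw [star_algebraMap, star_algebraMap, star_star] }
  have h : f = AlgHom.id ℂ _ := algHom_ext
    (by change star (star X) = X; rw [star_X, star_X])
    (fun b => by change star (star (C b)) = C b; rw [star_C, star_C, star_star])
  exact DFunLike.congr_fun h p

instance : StarRing (NCPoly B) where
  star_involutive := star_star'
  star_mul := star_mul'
  star_add := star_add'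

end NCPoly

end Poly

/-! ### Distributions -/

section Distr

variable {B : Type*} [CStarAlgebra B] [PartialOrder B] [StarOrderedRing B]

/-- `M_n(B)` with its `C*`-norm and its order. (The size `n = 0` is allowed; it is trivial.) -/
abbrev Mat (B : Type*) (n : ℕ) : Type _ := CStarMatrix (Fin n) (Fin n) B

/-- `‖μ(b₁ X b₂ X ⋯ X b_{n+1})‖ ≤ M ^ n ‖b₁‖ ⋯ ‖b_{n+1}‖`. -/
def IsExpBounded (μ : NCPoly B →ₗ[ℂ] B) (M : ℝ) : Prop :=
  ∀ (n : ℕ) (b : Fin (n + 1) → B),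
    ‖μ (NCPoly.C (b 0) * (List.ofFn fun i : Fin n => NCPoly.X * NCPoly.C (b i.succ)).prod)‖
      ≤ M ^ n * ∏ i, ‖b i‖

/-- The class `Σ₀` of `B`-valued distributions: unital, `B`-bimodular, completely positive,
exponentially bounded linear maps `B⟨X⟩ → B`. -/
structure IsDistribution (μ : NCPoly B →ₗ[ℂ] B) : Prop where
  map_one : μ 1 = 1
  bimodular : ∀ (a b : B) (P : NCPoly B), μ (NCPoly.C a * P * NCPoly.C b) = a * μ P * b
  completelyPositive : ∀ (n : ℕ) (P : Fin n → NCPoly B),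
    0 ≤ (CStarMatrix.ofMatrix (Matrix.of fun i j => μ (P i * star (P j))) : Mat B n)
  expBounded : ∃ M : ℝ, IsExpBounded μ M

/-! ### Noncommutative half plane, balls, functions -/

/-- `M_n^{+,ε}(B)`: the elements `b` of `M_n(B)` with `Im b > ε 1`. -/
def halfPlane (B : Type*) [CStarAlgebra B] [PartialOrder B] [StarOrderedRing B]
    (ε : ℝ) (n : ℕ) : Set (Mat B n) :=
  {b | IsStrictlyPositive ((imaginaryPart b : Mat B n) - algebraMap ℂ (Mat B n) (ε : ℂ))}

/-- `M_n^+(B)`, the `n`-th level of the noncommutative upper half plane `H^+(B)`. -/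
def upperHalfPlane (B : Type*) [CStarAlgebra B] [PartialOrder B] [StarOrderedRing B]
    (n : ℕ) : Set (Mat B n) :=
  ⋃ (ε : ℝ) (_ : 0 < ε), halfPlane B ε n

/-- The `n`-th level of the noncommutative ball `B_r^{nc}(0)`. -/
def ncBall (B : Type*) [CStarAlgebra B] [PartialOrder B] [StarOrderedRing B]
    (r : ℝ) (n : ℕ) : Set (Mat B n) :=
  Metric.ball 0 r

/-- The direct sum `a ⊕ b` of two square matrices. -/
def directSum {n p : ℕ} (a : Mat B n) (b : Mat B p) : Mat B (n + p) :=
  CStarMatrix.ofMatrix (Matrix.reindex finSumFinEquiv finSumFinEquiv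
    (Matrix.fromBlocks (CStarMatrix.ofMatrix.symm a) 0 0 (CStarMatrix.ofMatrix.symm b)))

/-- A complex matrix seen as a matrix over `B`. -/
def scalarMat (B : Type*) [CStarAlgebra B] {n : ℕ} (S : Matrix (Fin n) (Fin n) ℂ) : Mat B n :=
  CStarMatrix.ofMatrix (S.map (algebraMap ℂ B))

/-- `f` is an analytic noncommutative function on the noncommutative set `Ω`. -/
structure IsAnalyticNC (Ω : ∀ n, Set (Mat B n)) (f : ∀ n, Mat B n → Mat B n) : Prop where
  analytic : ∀ n, AnalyticOnNhd ℂ (f n) (Ω n)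
  map_directSum : ∀ (n p : ℕ), ∀ a ∈ Ω n, ∀ b ∈ Ω p,
    f (n + p) (directSum a b) = directSum (f n a) (f p b)
  map_similar : ∀ (n : ℕ) (S T : Matrix (Fin n) (Fin n) ℂ), S * T = 1 → T * S = 1 →
    ∀ a ∈ Ω n, scalarMat B S * a * scalarMat B T ∈ Ω n →
      f n (scalarMat B S * a * scalarMat B T) = scalarMat B S * f n a * scalarMat B T

/-! ### Cauchy transform, `F`-transform, monotone convolution powers -/

/-- `(μ ⊗ 1_n)((b X)^p b)` for `b ∈ M_n(B)`, where `X` stands for `X ⊗ 1_n`. -/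
def momentTerm (μ : NCPoly B →ₗ[ℂ] B) {n : ℕ} (p : ℕ) (b : Mat B n) : Mat B n :=
  let b' : Matrix (Fin n) (Fin n) (NCPoly B) := (CStarMatrix.ofMatrix.symm b).map NCPoly.C
  let X' : Matrix (Fin n) (Fin n) (NCPoly B) := Matrix.diagonal fun _ => NCPoly.X
  CStarMatrix.ofMatrix (((b' * X') ^ p * b').map μ)

/-- `g` is the function `b ↦ (μ ⊗ 1_n)((b - X ⊗ 1_n)⁻¹)` on `M_n^+(B)`: it is analytic there, and for
small `‖b⁻¹‖` it is given by the Neumann series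
`(b - X)⁻¹ = ∑ p, (b⁻¹ X)^p b⁻¹`. Since `M_n^+(B)` is convex, such a `g` is unique on
`M_n^+(B)`. -/
def IsCauchyTransform (μ : NCPoly B →ₗ[ℂ] B) (n : ℕ) (g : Mat B n → Mat B n) : Prop :=
  AnalyticOnNhd ℂ g (upperHalfPlane B n) ∧
    ∃ R : ℝ, 0 < R ∧ ∀ b ∈ upperHalfPlane B n, ‖Ring.inverse b‖ < R →
      HasSum (fun p : ℕ => momentTerm μ p (Ring.inverse b)) (g b)

open Classical in
/-- The Cauchy transform `G_μ^{(n)}` on `M_n^+(B)`. -/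
def cauchyTransform (μ : NCPoly B →ₗ[ℂ] B) (n : ℕ) : Mat B n → Mat B n :=
  if h : ∃ g, IsCauchyTransform μ n g then h.choose else 0

/-- The `F`-transform `F_μ^{(n)}(b) = G_μ^{(n)}(b)⁻¹` on `M_n^+(B)`. -/
def fTransform (μ : NCPoly B →ₗ[ℂ] B) (n : ℕ) (b : Mat B n) : Mat B n :=
  Ring.inverse (cauchyTransform μ n b)

/-- `μ = ν ▷ ⋯ ▷ ν` (`k` factors). Monotone convolution is defined implicitly by
`F_{μ ▷ ν} = F_μ ∘ F_ν` on the noncommutative upper half plane, so this says that `F_μ` is the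
`k`-fold composition power of `F_ν`. -/
def IsMonotonePower (ν : NCPoly B →ₗ[ℂ] B) (k : ℕ) (μ : NCPoly B →ₗ[ℂ] B) : Prop :=
  ∀ n, ∀ b ∈ upperHalfPlane B n, fTransform μ n b = (fTransform ν n)^[k] b

end Distr

end OpVal

end

set_option linter.unusedSectionVars false

noncomputable section

namespace OpVal

/-! ### Completion of a `C*`-seminormed algebra -/

section Completion

open UniformSpace UniformSpace.Completion

variable {P : Type*} [SeminormedRing P] [NormedAlgebra ℂ P] [StarRing P] [StarModule ℂ P]
  [NormedStarGroup P]

/-! The theorem rests on a Nevanlinna representation in the noncommutative upper half plane, F_μ(b)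
= b - μ(X) - G_ρ(b), where ρ = `booleanMap μ` is completely positive and its moments are boolean
cumulants of μ. Its value ρ(1) is the variance of μ. A Stinespring-type dilation (`exists_dilation`)
writes ρ = φ ∘ π, with π a *-homomorphism into a C*-algebra and φ completely positive, so G_ρ(b) =
φ((b - x)⁻¹) is a genuine resolvent with x self-adjoint. Consequently Im G_ρ ≤ 0, and ‖G_ρ(b)‖ ≤ 6
‖ρ(1)‖ / ε when Im b ≥ ε, with no dependence on n (`norm_matCLM_le`). The representation itself
comes from summing the moment-cumulant recursion (`hasSum_momentTerm`).

Let μ be the k-th monotone power of ν. Iterating the representation of ν gives F_μ(b) = b - k ν(X) -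
Σ_{i<k} G_{ρ_ν}(F_ν^i(b)). Evaluating at b = iy and letting y → ∞ yields μ(X) = k ν(X) and ρ_μ(1) =
k ρ_ν(1) (`IsIterate.mean_eq`, `IsIterate.variance_eq`). Both terms of F_ν(b) - b are therefore
O(1/k) on each Im b > ε, which is the first assertion.

Near b⁻¹ = 0 a bound for x in the dilation of ρ_ν is needed as well, depending only on the
exponential bound of μ and not on ν or k. Imaginary parts increase along an orbit of F_ν, so Im F_ν
≤ Im F_μ, that is, Im G_{ρ_μ} ≤ Im G_{ρ_ν}. Approaching self-adjoint points b⁻¹ turns this into an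
inequality of quadratic forms (`Ψ_le`). Small path matrices isolate single words in those forms,
giving ρ_ν(w w*) ≤ ρ_μ(w w*) for products w of factors bX (`map_prod_mul_star_le`). Growth along
powers of X then bounds ‖x‖ (`isOpBound_X_of_growth`). With ‖x‖ ≤ R the Neumann series for
G_{ρ_ν}(b⁻¹) converges on a ball of radius 1/(16R), and the size of its sum is again controlled by
‖ρ_ν(1)‖ = O(1/k). This gives both extensions and both limits. -/

instance completionStar : Star (Completion P) := ⟨Completion.map star⟩

theorem coe_star_completion (a : P) : ((star a : P) : Completion P) = star (a : Completion P) :=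
  (Completion.map_coe (star_isometry (E := P)).uniformContinuous a).symm

theorem continuous_star_completion : Continuous (star : Completion P → Completion P) :=
  Completion.continuous_map

instance completionStarRing : StarRing (Completion P) where
  star_involutive x := by
    induction x using Completion.induction_on with
    | hp => exact isClosed_eq (continuous_star_completion.comp continuous_star_completion)
              continuous_id
    | ih a => rw [← coe_star_completion, ← coe_star_completion, star_star]
  star_mul x y := by
    induction x, y using Completion.induction_on₂ with
    | hp => exact isClosed_eq (continuous_star_completion.comp continuous_mul)
              ((continuous_star_completion.comp continuous_snd).mul
                (continuous_star_completion.comp continuous_fst))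
    | ih a b =>
      simp only [← coe_star_completion, ← Completion.coe_mul, star_mul]
  star_add x y := by
    induction x, y using Completion.induction_on₂ with
    | hp => exact isClosed_eq (continuous_star_completion.comp continuous_add)
              ((continuous_star_completion.comp continuous_fst).add
                (continuous_star_completion.comp continuous_snd))
    | ih a b =>
      simp only [← coe_star_completion, ← Completion.coe_add, star_add]

instance completionStarModule : StarModule ℂ (Completion P) where
  star_smul z x := by
    induction x using Completion.induction_on with
    | hp => exact isClosed_eq (continuous_star_completion.comp (continuous_const_smul z))
              (continuous_star_completion.const_smul (star z))
    | ih a => simp only [← coe_star_completion, ← Completion.coe_smul, star_smul]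

instance completionNormedAlgebra : NormedAlgebra ℂ (Completion P) where
  norm_smul_le := norm_smul_le

/-- The completion of a `C*`-seminormed algebra is a `C*`-algebra. -/
@[reducible] def completionCStarAlgebra (h : ∀ a : P, ‖a‖ * ‖a‖ ≤ ‖star a * a‖) :
    CStarAlgebra (Completion P) where
  norm_mul_self_le x := by
    induction x using Completion.induction_on with
    | hp => exact isClosed_le (by fun_prop) ((continuous_star_completion.mul continuous_id).norm)
    | ih a =>
      rw [← coe_star_completion, ← Completion.coe_mul, Completion.norm_coe, Completion.norm_coe]
      exact h a

/-- The canonical map to the completion as a `*`-homomorphism. -/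
def coeStarAlgHom : P →⋆ₐ[ℂ] Completion P where
  toFun := (↑)
  map_one' := rfl
  map_mul' a b := Completion.coe_mul a b
  map_zero' := rfl
  map_add' a b := Completion.coe_add a b
  commutes' z := by
    rw [Algebra.algebraMap_eq_smul_one, Completion.coe_smul, Algebra.algebraMap_eq_smul_one]; rfl
  map_star' := coe_star_completion

end Completion

/-! ### The `C*`-seminorm of a positive map -/

section OrderSeminorm

variable {B : Type*} [CStarAlgebra B] [PartialOrder B] [StarOrderedRing B]
variable {P : Type*} [Ring P] [Algebra ℂ P] [StarRing P] [StarModule ℂ P]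

/-- `C` bounds the operator norm of right multiplication by `a` in the pre-Hilbert module
of `ρ`. -/
def IsOpBound (ρ : P →ₗ[ℂ] B) (a : P) (C : ℝ) : Prop :=
  0 ≤ C ∧ ∀ q : P, ρ (q * (a * star a) * star q) ≤ C ^ 2 • ρ (q * star q)

variable {ρ : P →ₗ[ℂ] B} (hρ : ∀ q : P, 0 ≤ ρ (q * star q))

include hρ in
theorem IsOpBound.mono {a : P} {C D : ℝ} (h : IsOpBound ρ a C) (hCD : C ≤ D) :
    IsOpBound ρ a D :=
  ⟨h.1.trans hCD, fun q => (h.2 q).trans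
    (smul_le_smul_of_nonneg_right (pow_le_pow_left₀ h.1 hCD 2) (hρ q))⟩

theorem IsOpBound.zero : IsOpBound ρ 0 0 := ⟨le_rfl, fun q => by simp⟩

theorem IsOpBound.one : IsOpBound ρ 1 1 := ⟨zero_le_one, fun q => by simp⟩

theorem real_smul_eq_complex {E : Type*} [AddCommGroup E] [Module ℂ E] (r : ℝ) (x : E) :
    r • x = (r : ℂ) • x := (Complex.coe_smul r x).symm

theorem IsOpBound.smul {a : P} {C : ℝ} (h : IsOpBound ρ a C) (z : ℂ) :
    IsOpBound ρ (z • a) (‖z‖ * C) := by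
  refine ⟨mul_nonneg (norm_nonneg z) h.1, fun q => ?_⟩
  have e : q * (z • a * star (z • a)) * star q
      = ((‖z‖ ^ 2 : ℝ) : ℂ) • (q * (a * star a) * star q) := by
    have : z * star z = ((‖z‖ ^ 2 : ℝ) : ℂ) := by
      rw [Complex.star_def, Complex.mul_conj, Complex.normSq_eq_norm_sq]
    rw [star_smul, smul_mul_smul_comm, this, mul_smul_comm, smul_mul_assoc]
  rw [e, map_smul, ← real_smul_eq_complex, mul_pow, mul_smul]
  exact smul_le_smul_of_nonneg_left (h.2 q) (by positivity)

theorem IsOpBound.mul {a b : P} {C D : ℝ} (ha : IsOpBound ρ a C) (hb : IsOpBound ρ b D) :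
    IsOpBound ρ (a * b) (C * D) := by
  refine ⟨mul_nonneg ha.1 hb.1, fun q => ?_⟩
  have e : q * (a * b * star (a * b)) * star q = (q * a) * (b * star b) * star (q * a) := by
    simp only [star_mul, mul_assoc]
  have e' : q * a * star (q * a) = q * (a * star a) * star q := by
    simp only [star_mul, mul_assoc]
  rw [e]
  refine (hb.2 (q * a)).trans ?_
  rw [e', mul_comm C D, mul_pow, mul_smul]
  exact smul_le_smul_of_nonneg_left (ha.2 q) (by positivity)

include hρ in
-- Expand the positive element ρ((√t x - y/√t)(√t x - y/√t)*). This replaces the triangle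
-- inequality, since a B-valued form has no convenient square root.
theorem map_add_mul_star_le (x y : P) (t : ℝ) (ht : 0 < t) :
    ρ ((x + y) * star (x + y)) ≤ (1 + t) • ρ (x * star x) + (1 + t⁻¹) • ρ (y * star y) := by
  have h := hρ (((√t : ℝ) : ℂ) • x - (((√t)⁻¹ : ℝ) : ℂ) • y)
  have ht' : √t * √t = t := Real.mul_self_sqrt ht.le
  have hne : √t ≠ 0 := (Real.sqrt_pos.2 ht).ne'
  have e : (((√t : ℝ) : ℂ) • x - (((√t)⁻¹ : ℝ) : ℂ) • y) *
      star (((√t : ℝ) : ℂ) • x - (((√t)⁻¹ : ℝ) : ℂ) • y)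
      = (t : ℂ) • (x * star x) - (x * star y + y * star x) + ((t⁻¹ : ℝ) : ℂ) • (y * star y) := by
    simp only [star_sub, star_smul, sub_mul, mul_sub, smul_mul_smul_comm, Complex.star_def,
      Complex.conj_ofReal, ← Complex.ofReal_mul, ht', mul_inv_cancel₀ hne, inv_mul_cancel₀ hne,
      ← mul_inv]
    simp only [Complex.ofReal_one, one_smul]
    abel
  rw [e, map_add, map_sub, map_smul, map_smul, map_add] at h
  rw [← sub_nonneg]
  have e2 : (x + y) * star (x + y) = x * star x + (x * star y + y * star x) + y * star y := by
    simp only [star_add, add_mul, mul_add]; abel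
  rw [e2, map_add, map_add, map_add, add_smul, add_smul, one_smul, one_smul,
    real_smul_eq_complex, real_smul_eq_complex]
  convert h using 1
  abel

include hρ in
theorem IsOpBound.add_of_pos {a b : P} {C D : ℝ} (ha : IsOpBound ρ a C) (hb : IsOpBound ρ b D)
    (hC : 0 < C) (hD : 0 < D) : IsOpBound ρ (a + b) (C + D) := by
  refine ⟨by positivity, fun q => ?_⟩
  have e : ∀ c : P, q * (c * star c) * star q = (q * c) * star (q * c) := fun c => by
    simp only [star_mul, mul_assoc]
  -- The weight D / C is the one for which (1 + t) C² + (1 + 1/t) D² equals (C + D)².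
  have h := map_add_mul_star_le hρ (q * a) (q * b) (D / C) (by positivity)
  rw [e, mul_add]
  refine h.trans ?_
  rw [← e a, ← e b]
  refine (add_le_add (smul_le_smul_of_nonneg_left (ha.2 q) (by positivity))
    (smul_le_smul_of_nonneg_left (hb.2 q) (by positivity))).trans (le_of_eq ?_)
  rw [smul_smul, smul_smul, ← add_smul]
  congr 1
  field_simp
  ring

/-- The operator seminorm of right multiplication in the pre-Hilbert module of `ρ`. -/
def opSeminorm (ρ : P →ₗ[ℂ] B) (a : P) : ℝ := sInf {C | IsOpBound ρ a C}

theorem opSeminorm_nonneg (a : P) : 0 ≤ opSeminorm ρ a :=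
  Real.sInf_nonneg fun _ h => h.1

theorem opSeminorm_le {a : P} {C : ℝ} (h : IsOpBound ρ a C) : opSeminorm ρ a ≤ C :=
  csInf_le ⟨0, fun _ h => h.1⟩ h

/-- The admissible bounds form a closed set, so the infimum is attained. -/
theorem isOpBound_opSeminorm {a : P} (h : ∃ C, IsOpBound ρ a C) :
    IsOpBound ρ a (opSeminorm ρ a) := by
  have hc : IsClosed {C | IsOpBound ρ a C} := by
    have : {C | IsOpBound ρ a C} = {C | 0 ≤ C} ∩
        ⋂ q : P, {C | ρ (q * (a * star a) * star q) ≤ C ^ 2 • ρ (q * star q)} := by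
      ext C; simp [IsOpBound]
    rw [this]
    refine (isClosed_le continuous_const continuous_id).inter (isClosed_iInter fun q => ?_)
    exact isClosed_le continuous_const (by fun_prop)
  exact hc.csInf_mem h ⟨0, fun _ h => h.1⟩

include hρ in
-- Put T = a a* and let C' exceed its seminorm. Positivity of (C' - T)² gives 2C'T ≤ C'² + T², and
-- T² ≤ C'² in the form sense, so T ≤ C' and √C' bounds a. This is the C*-inequality that lets the
-- completion be a C*-algebra.
theorem opSeminorm_sq_le {a : P} (hb : ∀ a : P, ∃ C, IsOpBound ρ a C) :
    opSeminorm ρ a * opSeminorm ρ a ≤ opSeminorm ρ (a * star a) := by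
  refine le_of_forall_gt fun C hC => ?_
  obtain ⟨C', h1, h2⟩ := exists_between hC
  refine lt_of_le_of_lt ?_ h2
  have hC0 : 0 < C' := (opSeminorm_nonneg _).trans_lt h1
  have hT := (isOpBound_opSeminorm (hb (a * star a))).mono hρ h1.le
  have key : IsOpBound ρ a √C' := by
    refine ⟨Real.sqrt_nonneg _, fun q => ?_⟩
    rw [Real.sq_sqrt hC0.le]
    have h := hρ (q * ((C' : ℂ) • 1 - a * star a))
    have e : q * ((C' : ℂ) • 1 - a * star a) * star (q * ((C' : ℂ) • 1 - a * star a))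
        = ((C' ^ 2 : ℝ) : ℂ) • (q * star q) - ((2 * C' : ℝ) : ℂ) • (q * (a * star a) * star q)
          + q * (a * star a * star (a * star a)) * star q := by
      have hs : star ((C' : ℂ) • (1 : P) - a * star a) = (C' : ℂ) • 1 - a * star a := by
        simp [star_sub, star_smul]
      rw [star_mul, hs, star_mul, star_star]
      simp only [mul_sub, sub_mul, mul_smul_comm, smul_mul_assoc, mul_one, smul_sub, one_mul,
        smul_smul, mul_assoc]
      push_cast
      rw [two_mul, add_smul, pow_two]
      abel
    rw [e, map_add, map_sub, map_smul, map_smul, ← real_smul_eq_complex,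
      ← real_smul_eq_complex] at h
    have h3 := add_le_add_right (hT.2 q) (C' ^ 2 • ρ (q * star q) - (2 * C') • ρ (q * (a * star a) * star q))
    have h4 := h.trans h3
    have h5 : (2 * C') • ρ (q * (a * star a) * star q) ≤ (2 * C') • (C' • ρ (q * star q)) := by
      rw [← sub_nonneg]
      convert h4 using 1
      rw [smul_smul, show 2 * C' * C' = C' ^ 2 + C' ^ 2 by ring, add_smul]
      abel
    have := smul_le_smul_of_nonneg_left h5 (show 0 ≤ (2 * C')⁻¹ by positivity)
    rwa [smul_smul, smul_smul, inv_mul_cancel₀ (by positivity), one_smul, one_smul] at this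
  have := mul_self_le_mul_self (opSeminorm_nonneg _) (opSeminorm_le key)
  rwa [Real.mul_self_sqrt hC0.le] at this

include hρ in
-- Combine ‖a‖² ≤ ‖a a*‖ with ‖a a*‖ ≤ ‖a‖ ‖a*‖ and cancel ‖a‖.
theorem opSeminorm_star_le {a : P} (hb : ∀ a : P, ∃ C, IsOpBound ρ a C) :
    opSeminorm ρ a ≤ opSeminorm ρ (star a) := by
  have h1 := opSeminorm_sq_le hρ (a := a) hb
  have h2 := opSeminorm_le ((isOpBound_opSeminorm (hb a)).mul (isOpBound_opSeminorm (hb (star a))))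
  rcases (opSeminorm_nonneg (ρ := ρ) a).eq_or_lt with h | h
  · rw [← h]; exact opSeminorm_nonneg _
  · exact le_of_mul_le_mul_left (h1.trans h2) h

include hρ in
theorem opSeminorm_add_le (hb : ∀ a : P, ∃ C, IsOpBound ρ a C) (a b : P) :
    opSeminorm ρ (a + b) ≤ opSeminorm ρ a + opSeminorm ρ b := by
  refine le_of_forall_pos_le_add fun ε hε => ?_
  have h1 := (isOpBound_opSeminorm (hb a)).mono hρ
    (show opSeminorm ρ a ≤ opSeminorm ρ a + ε / 2 by linarith)
  have h2 := (isOpBound_opSeminorm (hb b)).mono hρ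
    (show opSeminorm ρ b ≤ opSeminorm ρ b + ε / 2 by linarith)
  have := opSeminorm_le (h1.add_of_pos hρ h2 (by linarith [opSeminorm_nonneg (ρ := ρ) a])
    (by linarith [opSeminorm_nonneg (ρ := ρ) b]))
  linarith

theorem opSeminorm_smul_le (hb : ∀ a : P, ∃ C, IsOpBound ρ a C) (z : ℂ) (a : P) :
    opSeminorm ρ (z • a) ≤ ‖z‖ * opSeminorm ρ a :=
  opSeminorm_le ((isOpBound_opSeminorm (hb a)).smul z)

/-- `P` with the seminorm `opSeminorm ρ`. -/
@[reducible] def opSeminormedRing (hb : ∀ a : P, ∃ C, IsOpBound ρ a C) : SeminormedRing P :=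
  let S : AddGroupSeminorm P :=
    { toFun := opSeminorm ρ
      map_zero' := le_antisymm (opSeminorm_le IsOpBound.zero) (opSeminorm_nonneg _)
      add_le' := opSeminorm_add_le hρ hb
      neg' := fun a => by
        have h : ∀ a : P, opSeminorm ρ (-a) ≤ opSeminorm ρ a := fun a => by
          simpa using opSeminorm_smul_le hb (-1) a
        exact le_antisymm (h a) (by simpa using h (-a)) }
  { S.toSeminormedAddCommGroup, (inferInstance : Ring P) with
    norm_mul_le := fun a b => opSeminorm_le
      ((isOpBound_opSeminorm (hb a)).mul (isOpBound_opSeminorm (hb b))) }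

end OrderSeminorm

/-! ### Dilation of completely positive maps -/

section Dilation

universe u v w

variable {B : Type u} [CStarAlgebra B] [PartialOrder B] [StarOrderedRing B]
variable {P : Type v} [Ring P] [Algebra ℂ P] [StarRing P] [StarModule ℂ P]

/-- Complete positivity of a linear map from a `*`-algebra to a `C*`-algebra. -/
def IsCP (ρ : P →ₗ[ℂ] B) : Prop :=
  ∀ (n : ℕ) (a : Fin n → P),
    0 ≤ (CStarMatrix.ofMatrix (Matrix.of fun i j => ρ (a i * star (a j))) : Mat B n)

theorem exists_eq_star_mul_self {D : Type*} [CStarAlgebra D] [PartialOrder D] [StarOrderedRing D]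
    {a : D} (h : 0 ≤ a) : ∃ b, a = star b * b :=
  CStarAlgebra.nonneg_iff_eq_star_mul_self.1 h

theorem diag_nonneg {n : ℕ} {W : Mat B n} (h : 0 ≤ W) (i : Fin n) : 0 ≤ W i i := by
  obtain ⟨V, rfl⟩ := exists_eq_star_mul_self h
  rw [CStarMatrix.mul_apply]
  exact Finset.sum_nonneg fun k _ => star_mul_self_nonneg (V k i)

theorem IsCP.pos {ρ : P →ₗ[ℂ] B} (h : IsCP ρ) (q : P) : 0 ≤ ρ (q * star q) :=
  diag_nonneg (h 1 fun _ => q) 0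

/-- The positive 2 × 2 matrix attached to (q, 1) is self-adjoint; compare its off-diagonal entries.
-/
theorem IsCP.map_star {ρ : P →ₗ[ℂ] B} (h : IsCP ρ) (q : P) : ρ (star q) = star (ρ q) := by
  have h2 := (h 2 ![q, 1]).star_eq
  have h3 := congrFun (congrFun h2 1) 0
  rw [CStarMatrix.star_apply] at h3
  simpa using h3.symm

theorem norm_le_of_neg_le_of_le {a b : B} (h1 : -b ≤ a) (h2 : a ≤ b) : ‖a‖ ≤ 3 * ‖b‖ := by
  have h3 : 0 ≤ a + b := by rw [← sub_neg_eq_add]; exact sub_nonneg.2 h1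
  have h4 : ‖a + b‖ ≤ ‖b + b‖ :=
    CStarAlgebra.norm_le_norm_of_nonneg_of_le h3 (add_le_add_left h2 b)
  have h5 : ‖a‖ ≤ ‖a + b‖ + ‖b‖ := by simpa using norm_sub_le (a + b) b
  linarith [norm_add_le b b]

/-- A crude form of the Cauchy-Schwarz inequality for positive maps. -/
theorem norm_map_le_of_map_mul_star_le {ρ : P →ₗ[ℂ] B} (hρ : ∀ q : P, 0 ≤ ρ (q * star q))
    {a : P} {C : ℝ} (hC : 0 < C) (h : ρ (a * star a) ≤ C ^ 2 • ρ 1) :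
    ‖ρ a‖ ≤ 6 * C * ‖ρ 1‖ := by
  have key : ∀ b : P, ρ (b * star b) ≤ C ^ 2 • ρ 1 →
      -((2 * C) • ρ 1) ≤ ρ (b + star b) := fun b hb => by
    have h1 := hρ ((C : ℂ) • 1 + b)
    have e : ((C : ℂ) • 1 + b) * star ((C : ℂ) • 1 + b)
        = ((C ^ 2 : ℝ) : ℂ) • 1 + (C : ℂ) • (b + star b) + b * star b := by
      simp only [star_add, star_smul, star_one, Complex.star_def, Complex.conj_ofReal, mul_add,
        add_mul, smul_mul_assoc, mul_smul_comm, one_mul, mul_one, smul_smul, smul_add]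
      push_cast
      rw [pow_two]
      abel
    rw [e, map_add, map_add, map_smul, map_smul, ← real_smul_eq_complex,
      ← real_smul_eq_complex] at h1
    have h2 : 0 ≤ C • (ρ (b + star b) + (2 * C) • ρ 1) := by
      refine h1.trans ((add_le_add_right hb _).trans (le_of_eq ?_))
      rw [smul_add, smul_smul, show C * (2 * C) = C ^ 2 + C ^ 2 by ring, add_smul]
      abel
    have h3 := smul_nonneg (inv_nonneg.2 hC.le) h2
    rw [smul_smul, inv_mul_cancel₀ hC.ne', one_smul] at h3
    rw [← sub_nonneg, sub_neg_eq_add]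
    exact h3
  have key2 : ∀ b : P, ρ (b * star b) ≤ C ^ 2 • ρ 1 → ‖ρ (b + star b)‖ ≤ 6 * C * ‖ρ 1‖ :=
      fun b hb => by
    have h1 := key b hb
    have h2 := key (-b) (by simpa using hb)
    rw [star_neg, ← neg_add, map_neg, neg_le_neg_iff] at h2
    refine (norm_le_of_neg_le_of_le h1 h2).trans (le_of_eq ?_)
    rw [norm_smul, Real.norm_of_nonneg (by positivity)]
    ring
  have h1 := key2 a h
  have h2 := key2 (Complex.I • a) (by
    rw [star_smul, smul_mul_smul_comm]
    simpa using h)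
  -- Decomposition into real and imaginary parts: the order bounds only control images of
  -- self-adjoint elements, so they are applied to a and to i a.
  have e : ρ a = (1 / 2 : ℂ) • (ρ (a + star a) - Complex.I • ρ (Complex.I • a + star (Complex.I • a))) := by
    rw [← map_smul, ← map_sub, ← map_smul]
    congr 1
    simp only [star_smul, Complex.star_def, Complex.conj_I, smul_add, smul_smul, neg_smul, smul_sub, smul_neg,
      Complex.I_mul_I]
    module
  rw [e, norm_smul]
  have h3 := norm_sub_le (ρ (a + star a)) (Complex.I • ρ (Complex.I • a + star (Complex.I • a)))
  rw [norm_smul, Complex.norm_I, one_mul] at h3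
  have : ‖(1 / 2 : ℂ)‖ = 1 / 2 := by norm_num
  rw [this]
  linarith

/-- A Stinespring-type dilation of a completely positive map `ρ`: a `*`-homomorphism `π` into a
`C*`-algebra and a continuous completely positive map `φ` with `φ ∘ π = ρ`. -/
structure Dilation (ρ : P →ₗ[ℂ] B) where
  /-- The algebra of the dilation. -/
  A : Type v
  [cstarAlgebra : CStarAlgebra A]
  /-- The homomorphism of the dilation. -/
  π : P →⋆ₐ[ℂ] A
  /-- The completely positive map of the dilation. -/
  φ : A →L[ℂ] B
  φ_π : ∀ a, φ (π a) = ρ a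
  isCP : IsCP (φ : A →ₗ[ℂ] B)

attribute [instance] Dilation.cstarAlgebra

/-- The dilation algebra is the completion of P for `opSeminorm ρ`. No Hilbert module is
constructed: ρ is continuous for this seminorm and extends to the completion. -/
theorem exists_dilation {ρ : P →ₗ[ℂ] B} (hρ : IsCP ρ) (hb : ∀ a : P, ∃ C, IsOpBound ρ a C) :
    ∃ D : Dilation ρ, ∀ a, ‖D.π a‖ = opSeminorm ρ a := by
  let _ : SeminormedRing P := opSeminormedRing hρ.pos hb
  have hn : ∀ a : P, ‖a‖ = opSeminorm ρ a := fun _ => rfl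
  let _ : NormedAlgebra ℂ P :=
    { (inferInstance : Algebra ℂ P) with norm_smul_le := fun z a => opSeminorm_smul_le hb z a }
  have : NormedStarGroup P := ⟨fun a => by
    have h := opSeminorm_star_le hρ.pos (a := star a) hb
    rw [star_star] at h
    exact h⟩
  let _ := completionCStarAlgebra (P := P) (fun a => by
    have h := opSeminorm_sq_le hρ.pos (a := star a) hb
    rw [← hn, ← hn, norm_star, star_star] at h
    exact h)
  have hbd : ∀ a : P, ‖ρ a‖ ≤ (6 * ‖ρ 1‖) * ‖a‖ := fun a => by
    -- The seminorm of a may vanish while the Cauchy-Schwarz bound needs a positive constant, so it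
    -- is enlarged slightly.
    refine le_of_forall_pos_le_add fun ε hε => ?_
    have hpos : 0 < 6 * ‖ρ 1‖ + 1 := by positivity
    have h1 := (isOpBound_opSeminorm (hb a)).mono hρ.pos
      (show opSeminorm ρ a ≤ opSeminorm ρ a + ε / (6 * ‖ρ 1‖ + 1) by
        have : 0 < ε / (6 * ‖ρ 1‖ + 1) := by positivity
        linarith)
    have h2 := h1.2 1
    simp only [one_mul, star_one, mul_one] at h2
    have h3 : 0 < opSeminorm ρ a + ε / (6 * ‖ρ 1‖ + 1) :=
      add_pos_of_nonneg_of_pos (opSeminorm_nonneg _) (by positivity)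
    have h4 := norm_map_le_of_map_mul_star_le hρ.pos h3 h2
    have h5 : 6 * ‖ρ 1‖ * (ε / (6 * ‖ρ 1‖ + 1)) ≤ ε := by
      rw [mul_div_assoc', div_le_iff₀ hpos]
      nlinarith [norm_nonneg (ρ 1)]
    rw [hn]
    linarith
  let φ₀ : P →L[ℂ] B := ρ.mkContinuous _ hbd
  let φ : UniformSpace.Completion P →L[ℂ] B := φ₀.fromCompletion
  have hφ : ∀ a : P, φ (a : UniformSpace.Completion P) = ρ a := fun a =>
    ContinuousLinearMap.fromCompletion_apply_coe φ₀ a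
  refine ⟨{ A := UniformSpace.Completion P, π := coeStarAlgHom, φ := φ, φ_π := hφ, isCP := ?_ },
    fun a => UniformSpace.Completion.norm_coe a⟩
  intro n a
  -- Complete positivity is a closed condition, so it suffices to test it on families coming from P.
  have hd : DenseRange (fun (q : Fin n → P) (i : Fin n) => (q i : UniformSpace.Completion P)) :=
    DenseRange.piMap fun _ => UniformSpace.Completion.denseRange_coe
  refine hd.induction_on (p := fun a : Fin n → UniformSpace.Completion P =>
    0 ≤ (CStarMatrix.ofMatrix (Matrix.of fun i j => φ (a i * star (a j))) : Mat B n)) a ?_ ?_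
  · refine isClosed_le continuous_const
      ((CStarMatrix.ofMatrixL (A := B)).continuous.comp (continuous_matrix fun i j => ?_))
    exact φ.continuous.comp ((continuous_apply i).mul
      (continuous_star_completion.comp (continuous_apply j)))
  · intro q
    convert hρ n q using 4 with i
    funext j
    simp only [← coe_star_completion, ← UniformSpace.Completion.coe_mul, hφ]

end Dilation

/-! ### Monomials in `B⟨X⟩` and boundedness of X -/

section Poly

variable {B : Type*} [CStarAlgebra B]

instance : StarModule ℂ (NCPoly B) where
  star_smul z p := by
    rw [Algebra.smul_def, star_mul, NCPoly.star_algebraMap, Algebra.smul_def, Algebra.commutes]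

namespace NCPoly

/-- A subalgebra containing `X` and `B` is everything. -/
theorem mem_of_subalgebra (S : Subalgebra ℂ (NCPoly B)) (hX : X ∈ S) (hC : ∀ b, C b ∈ S)
    (p : NCPoly B) : p ∈ S := by
  let g : NCPoly B →ₐ[ℂ] S := eval (C.codRestrict S hC) (⟨X, hX⟩ : S)
  have h : S.val.comp g = AlgHom.id ℂ _ := algHom_ext (by simp [g]) (fun b => by simp [g])
  have h2 := DFunLike.congr_fun h p
  rw [AlgHom.id_apply] at h2
  rw [← h2]
  exact (g p).2

/-- The monomial `b X b₁ X b₂ ⋯ X b_n` attached to `b` and `l = [b₁, …, b_n]`. -/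
def word (b : B) (l : List B) : NCPoly B := C b * (l.map fun c => X * C c).prod

theorem C_mul_word (a b : B) (l : List B) : C a * word b l = word (a * b) l := by
  rw [word, word, map_mul, mul_assoc]

theorem X_mul_word (b : B) (l : List B) : X * word b l = word 1 (b :: l) := by
  rw [word, word, map_one, one_mul, List.map_cons, List.prod_cons, mul_assoc]

theorem word_cons (a b : B) (l : List B) : word a (b :: l) = C a * X * word b l := by
  rw [mul_assoc, X_mul_word, C_mul_word, mul_one]

/-- Every polynomial is a sum of monomials. -/
theorem mem_closure_word (p : NCPoly B) :
    p ∈ AddSubmonoid.closure {q : NCPoly B | ∃ b l, q = word b l} := by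
  set V := AddSubmonoid.closure {q : NCPoly B | ∃ b l, q = word b l} with hV
  have hC : ∀ a : B, ∀ q ∈ V, C a * q ∈ V := fun a q hq => by
    induction hq using AddSubmonoid.closure_induction with
    | mem q h =>
      obtain ⟨b, l, rfl⟩ := h
      exact AddSubmonoid.subset_closure ⟨a * b, l, C_mul_word a b l⟩
    | zero => rw [mul_zero]; exact zero_mem V
    | add x y _ _ hx hy => rw [mul_add]; exact add_mem hx hy
  have hX : ∀ q ∈ V, X * q ∈ V := fun q hq => by
    induction hq using AddSubmonoid.closure_induction with
    | mem q h =>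
      obtain ⟨b, l, rfl⟩ := h
      exact AddSubmonoid.subset_closure ⟨1, b :: l, X_mul_word b l⟩
    | zero => rw [mul_zero]; exact zero_mem V
    | add x y _ _ hx hy => rw [mul_add]; exact add_mem hx hy
  let S : Subalgebra ℂ (NCPoly B) :=
    { carrier := {r | ∀ q ∈ V, r * q ∈ V}
      mul_mem' := fun {r s} hr hs q hq => by rw [mul_assoc]; exact hr _ (hs q hq)
      add_mem' := fun {r s} hr hs q hq => by rw [add_mul]; exact add_mem (hr q hq) (hs q hq)
      algebraMap_mem' := fun z q hq => by
        rw [← AlgHom.commutes (C (B := B))]; exact hC _ q hq }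
  have h1 : (1 : NCPoly B) ∈ V :=
    AddSubmonoid.subset_closure ⟨1, [], by simp [word]⟩
  have := mem_of_subalgebra S hX hC p 1 h1
  rwa [mul_one] at this

theorem word_mul_X_mul_word (b b' : B) (l l' : List B) :
    word b l * X * word b' l' = word b (l ++ b' :: l') := by
  induction l generalizing b with
  | nil => simp [word, mul_assoc]
  | cons c l ih =>
    rw [List.cons_append, word_cons, word_cons, ← ih]
    simp only [mul_assoc]

/-- The adjoint of a monomial is a monomial of the same size. -/
theorem exists_star_word (b : B) (l : List B) : ∃ b' l', star (word b l) = word b' l' ∧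
    l'.length = l.length ∧ ‖b'‖ * (l'.map norm).prod = ‖b‖ * (l.map norm).prod := by
  induction l generalizing b with
  | nil => exact ⟨star b, [], by simp [word], rfl, by simp⟩
  | cons c l ih =>
    obtain ⟨b', l', h1, h2, h3⟩ := ih c
    refine ⟨b', l' ++ [star b], ?_, by simp [h2], ?_⟩
    · rw [word_cons, star_mul, star_mul, star_X, star_C, h1, ← word_mul_X_mul_word]
      simp [word, mul_assoc]
    · simp only [List.map_append, List.map_cons, List.map_nil, List.prod_append, List.prod_cons,
        List.prod_nil, mul_one, norm_star]
      rw [← mul_assoc, h3]; ring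

theorem X_pow_succ_eq_word (j : ℕ) :
    (X : NCPoly B) ^ j = word 1 (List.replicate j 1) := by
  induction j with
  | zero => simp [word]
  | succ j ih => rw [pow_succ', ih, X_mul_word, List.replicate_succ]

end NCPoly

variable [PartialOrder B] [StarOrderedRing B]

theorem IsExpBounded.norm_word_le {μ : NCPoly B →ₗ[ℂ] B} {M : ℝ} (h : IsExpBounded μ M) (b : B)
    (l : List B) : ‖μ (NCPoly.word b l)‖ ≤ M ^ l.length * (‖b‖ * (l.map norm).prod) := by
  have h1 := h l.length (Fin.cons b l.get)
  have e1 : (List.ofFn fun i : Fin l.length =>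
      NCPoly.X * NCPoly.C ((Fin.cons b l.get : Fin (l.length + 1) → B) i.succ))
      = l.map fun c => NCPoly.X * NCPoly.C c := by
    simp only [Fin.cons_succ]
    exact (List.map_ofFn (f := l.get) (g := fun c => NCPoly.X * NCPoly.C c)).symm.trans
      (by rw [List.ofFn_get])
  have e2 : ∏ i, ‖(Fin.cons b l.get : Fin (l.length + 1) → B) i‖ = ‖b‖ * (l.map norm).prod := by
    rw [Fin.prod_univ_succ]
    simp only [Fin.cons_zero, Fin.cons_succ]
    congr 1
    rw [← List.prod_ofFn]
    exact congrArg List.prod ((List.map_ofFn (f := l.get) (g := norm)).symm.trans (by rw [List.ofFn_get]))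
  rw [e1, e2] at h1
  exact h1

/-- A growth condition along the powers of `X` on monomials bounds the norm of `X`. -/
theorem isOpBound_X_of_growth {ρ : NCPoly B →ₗ[ℂ] B}
    (hρ : ∀ q : NCPoly B, 0 ≤ ρ (q * star q)) {M : ℝ} (hM : 0 < M)
    (h : ∀ b l, ∃ K : ℝ, ∀ p : ℕ, 1 ≤ p →
      ‖ρ (NCPoly.word b l * NCPoly.X ^ p * star (NCPoly.word b l * NCPoly.X ^ p))‖
        ≤ K * (M ^ 2) ^ p) :
    IsOpBound ρ NCPoly.X M := by
  have hall : ∀ q : NCPoly B, ∃ K : ℝ, ∀ p : ℕ, 1 ≤ p →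
      ‖ρ (q * NCPoly.X ^ p * star (q * NCPoly.X ^ p))‖ ≤ K * (M ^ 2) ^ p := fun q => by
    induction NCPoly.mem_closure_word q using AddSubmonoid.closure_induction with
    | mem q hq => obtain ⟨b, l, rfl⟩ := hq; exact h b l
    | zero => exact ⟨0, fun p _ => by simp⟩
    | add x y _ _ hx hy =>
      obtain ⟨K, hK⟩ := hx
      obtain ⟨L, hL⟩ := hy
      refine ⟨2 * K + 2 * L, fun p hp => ?_⟩
      have h1 := map_add_mul_star_le hρ (x * NCPoly.X ^ p) (y * NCPoly.X ^ p) 1 one_pos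
      rw [← add_mul] at h1
      have h2 := CStarAlgebra.norm_le_norm_of_nonneg_of_le (hρ _) h1
      refine h2.trans ((norm_add_le _ _).trans ?_)
      rw [norm_smul, norm_smul]
      have e1 : ‖(1 + 1 : ℝ)‖ = 2 := by norm_num
      have e2 : ‖(1 + 1⁻¹ : ℝ)‖ = 2 := by norm_num
      rw [e1, e2]
      linarith [hK p hp, hL p hp]
  refine ⟨hM.le, fun q => ?_⟩
  set c := M ^ 2 with hc
  have hc0 : 0 < c := by positivity
  set t : ℕ → B := fun p => ρ (q * NCPoly.X ^ p * star (q * NCPoly.X ^ p)) with ht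
  -- A linearised Cauchy-Schwarz inequality, from the square of M^p q - M^{-p} q X^{2p}.
  have hstep : ∀ p, (2 : ℝ) • t p ≤ c ^ p • t 0 + (c ^ p)⁻¹ • t (2 * p) := fun p => by
    have h1 := hρ ((((M ^ p : ℝ)) : ℂ) • q - (((M ^ p)⁻¹ : ℝ) : ℂ) • (q * NCPoly.X ^ (2 * p)))
    have hMp : M ^ p ≠ 0 := (pow_pos hM p).ne'
    have e : ((((M ^ p : ℝ)) : ℂ) • q - (((M ^ p)⁻¹ : ℝ) : ℂ) • (q * NCPoly.X ^ (2 * p))) *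
        star ((((M ^ p : ℝ)) : ℂ) • q - (((M ^ p)⁻¹ : ℝ) : ℂ) • (q * NCPoly.X ^ (2 * p)))
        = ((c ^ p : ℝ) : ℂ) • (q * star q) - (2 : ℂ) • (q * NCPoly.X ^ p * star (q * NCPoly.X ^ p))
          + (((c ^ p)⁻¹ : ℝ) : ℂ) • (q * NCPoly.X ^ (2 * p) * star (q * NCPoly.X ^ (2 * p))) := by
      have e3 : q * NCPoly.X ^ p * star (q * NCPoly.X ^ p) = q * NCPoly.X ^ (2 * p) * star q := by
        rw [star_mul, star_pow, NCPoly.star_X, two_mul, pow_add]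
        simp only [mul_assoc]
      have e4 : q * star (q * NCPoly.X ^ (2 * p)) = q * NCPoly.X ^ (2 * p) * star q := by
        rw [star_mul, star_pow, NCPoly.star_X, mul_assoc]
      have e5 : M ^ p * M ^ p = c ^ p := by rw [← pow_add, ← two_mul, pow_mul]
      rw [e3]
      simp only [star_sub, star_smul, sub_mul, mul_sub, smul_mul_smul_comm, Complex.star_def,
        Complex.conj_ofReal, ← Complex.ofReal_mul, e5, mul_inv_cancel₀ hMp, inv_mul_cancel₀ hMp,
        ← mul_inv, e4]
      simp only [Complex.ofReal_one, one_smul, two_smul]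
      abel
    rw [e, map_add, map_sub, map_smul, map_smul, map_smul, ← real_smul_eq_complex,
      ← real_smul_eq_complex] at h1
    rw [← sub_nonneg]
    convert h1 using 1
    simp only [ht, pow_zero, mul_one, two_smul]
    abel
  -- Doubling the exponent halves the weight of the remainder. As t (2 ^ m) is at most K c^(2^m) in
  -- norm, the remainder tends to 0 and t 1 ≤ c t 0 is left, without the constant K.
  have hiter : ∀ m : ℕ, t 1 ≤ (c * (1 - (2 ^ m)⁻¹)) • t 0 +
      ((2 ^ m)⁻¹ * c * (c ^ (2 ^ m))⁻¹) • t (2 ^ m) := fun m => by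
    induction m with
    | zero => simp [hc0.ne']
    | succ m ih =>
      have h1 := smul_le_smul_of_nonneg_left (hstep (2 ^ m))
        (show 0 ≤ (2 ^ m)⁻¹ * c * (c ^ (2 ^ m))⁻¹ * 2⁻¹ by positivity)
      rw [smul_smul, mul_assoc _ (2⁻¹ : ℝ) 2, inv_mul_cancel₀ two_ne_zero, mul_one, smul_add,
        smul_smul, smul_smul, ← pow_succ'] at h1
      refine ih.trans ((add_le_add_right h1 _).trans (le_of_eq ?_))
      rw [← add_assoc, ← add_smul]
      congr 2
      · have : c ^ 2 ^ m ≠ 0 := by positivity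
        field_simp
        ring
      · rw [pow_succ (2 : ℝ) m, pow_succ (2 : ℕ) m, pow_mul c]
        have : c ^ 2 ^ m ≠ 0 := by positivity
        field_simp
  obtain ⟨K, hK⟩ := hall q
  have hlim : Tendsto (fun m : ℕ => (c * (1 - (2 ^ m)⁻¹)) • t 0 +
      ((2 ^ m)⁻¹ * c * (c ^ (2 ^ m))⁻¹) • t (2 ^ m)) atTop (𝓝 ((c * (1 - 0)) • t 0 + 0)) := by
    have h2 : Tendsto (fun m : ℕ => ((2 : ℝ) ^ m)⁻¹) atTop (𝓝 0) :=
      tendsto_inv_atTop_zero.comp (tendsto_pow_atTop_atTop_of_one_lt one_lt_two)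
    refine ((tendsto_const_nhds.mul (tendsto_const_nhds.sub h2)).smul_const _).add ?_
    refine squeeze_zero_norm (a := fun m : ℕ => ((2 : ℝ) ^ m)⁻¹ * (c * K)) (fun m => ?_)
      (by simpa using h2.mul_const (c * K))
    rw [norm_smul, Real.norm_of_nonneg (by positivity)]
    refine (mul_le_mul_of_nonneg_left (hK (2 ^ m) Nat.one_le_two_pow) (by positivity)).trans
      (le_of_eq ?_)
    have : c ^ 2 ^ m ≠ 0 := by positivity
    field_simp
  have hfin := ge_of_tendsto' hlim hiter
  rw [sub_zero, mul_one, add_zero] at hfin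
  have e1 : q * (NCPoly.X * star NCPoly.X) * star q
      = q * NCPoly.X ^ 1 * star (q * NCPoly.X ^ 1) := by
    rw [pow_one, star_mul]; simp only [mul_assoc]
  have e0 : q * star q = q * NCPoly.X ^ 0 * star (q * NCPoly.X ^ 0) := by simp
  rw [e1, e0]
  exact hfin

/-- Write ‖b‖² - b b* = d* d in B and apply positivity to q d*. -/
theorem isOpBound_C {ρ : NCPoly B →ₗ[ℂ] B} (hρ : ∀ q : NCPoly B, 0 ≤ ρ (q * star q)) (b : B) :
    IsOpBound ρ (NCPoly.C b) ‖b‖ := by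
  refine ⟨norm_nonneg b, fun q => ?_⟩
  have h0 : 0 ≤ algebraMap ℝ B (‖b‖ ^ 2) - b * star b :=
    sub_nonneg.2 CStarAlgebra.mul_star_le_algebraMap_norm_sq
  obtain ⟨d, hd⟩ := exists_eq_star_mul_self h0
  have h1 := hρ (q * NCPoly.C (star d))
  have e : q * NCPoly.C (star d) * star (q * NCPoly.C (star d))
      = ((‖b‖ ^ 2 : ℝ) : ℂ) • (q * star q) - q * (NCPoly.C b * star (NCPoly.C b)) * star q := by
    have e1 : NCPoly.C (star d) * star (NCPoly.C (star d)) =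
        ((‖b‖ ^ 2 : ℝ) : ℂ) • 1 - NCPoly.C b * star (NCPoly.C b) := by
      rw [NCPoly.star_C, star_star, ← map_mul, ← hd, map_sub, map_mul, NCPoly.star_C,
        Algebra.algebraMap_eq_smul_one, real_smul_eq_complex, map_smul, map_one]
    rw [star_mul, ← mul_assoc, mul_assoc q, e1, mul_sub, sub_mul, mul_smul_comm, mul_one,
      smul_mul_assoc]
  rw [e, map_sub, map_smul, sub_nonneg, ← real_smul_eq_complex] at h1
  exact h1

/-- All elements act boundedly as soon as `X` does. -/
theorem exists_isOpBound {ρ : NCPoly B →ₗ[ℂ] B} (hρ : ∀ q : NCPoly B, 0 ≤ ρ (q * star q)) {R : ℝ}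
    (hX : IsOpBound ρ NCPoly.X R) (a : NCPoly B) : ∃ C, IsOpBound ρ a C := by
  have hadd : ∀ a b : NCPoly B, (∃ C, IsOpBound ρ a C) → (∃ C, IsOpBound ρ b C) →
      ∃ C, IsOpBound ρ (a + b) C := fun a b ⟨C, hC⟩ ⟨D, hD⟩ =>
    ⟨_, (hC.mono hρ (show C ≤ C + 1 by linarith)).add_of_pos hρ
      (hD.mono hρ (show D ≤ D + 1 by linarith)) (by linarith [hC.1]) (by linarith [hD.1])⟩
  let S : Subalgebra ℂ (NCPoly B) :=
    { carrier := {a | ∃ C, IsOpBound ρ a C}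
      mul_mem' := fun {a b} ⟨C, hC⟩ ⟨D, hD⟩ => ⟨_, hC.mul hD⟩
      add_mem' := fun {a b} ha hb => hadd a b ha hb
      algebraMap_mem' := fun z => ⟨_, by
        rw [Algebra.algebraMap_eq_smul_one]; exact IsOpBound.one.smul z⟩ }
  exact NCPoly.mem_of_subalgebra S ⟨R, hX⟩ (fun b => ⟨_, isOpBound_C hρ b⟩) a

theorem exists_dilation_of_isOpBound {ρ : NCPoly B →ₗ[ℂ] B} (hρ : IsCP ρ) {R : ℝ}
    (hX : IsOpBound ρ NCPoly.X R) : ∃ D : Dilation ρ, ‖D.π NCPoly.X‖ ≤ R := by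
  obtain ⟨D, hD⟩ := exists_dilation hρ (exists_isOpBound hρ.pos hX)
  exact ⟨D, (hD _).trans_le (opSeminorm_le hX)⟩

theorem IsDistribution.isCP {μ : NCPoly B →ₗ[ℂ] B} (h : IsDistribution μ) : IsCP μ :=
  h.completelyPositive

/-- For a monomial w, the element w X^p X^p w* is again a monomial when p ≥ 1: its inner letters are
1 and its degree is 2 deg w + 2p. The exponential bound is thus exactly the growth condition of
`isOpBound_X_of_growth`. -/
theorem IsExpBounded.isOpBound_X {μ : NCPoly B →ₗ[ℂ] B} {M : ℝ} (h : IsExpBounded μ M)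
    (hM : 0 < M) (hμ : ∀ q : NCPoly B, 0 ≤ μ (q * star q)) : IsOpBound μ NCPoly.X M := by
  refine isOpBound_X_of_growth hμ hM fun b l => ?_
  obtain ⟨b', l', h1, h2, h3⟩ := NCPoly.exists_star_word b l
  refine ⟨M ^ (2 * l.length) * (‖b‖ * (l.map norm).prod) ^ 2, fun p hp => ?_⟩
  obtain ⟨j, rfl⟩ : ∃ j, p = j + 1 := ⟨p - 1, by omega⟩
  have e : NCPoly.word b l * NCPoly.X ^ (j + 1) * star (NCPoly.word b l * NCPoly.X ^ (j + 1))
      = NCPoly.word b (l ++ 1 :: (List.replicate (2 * j) 1 ++ b' :: l')) := by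
    rw [← NCPoly.word_mul_X_mul_word, ← NCPoly.word_mul_X_mul_word, ← NCPoly.X_pow_succ_eq_word,
      star_mul, h1, star_pow, NCPoly.star_X]
    have : (NCPoly.X : NCPoly B) ^ (j + 1) * NCPoly.X ^ (j + 1)
        = NCPoly.X * (NCPoly.X ^ (2 * j) * NCPoly.X) := by
      rw [← pow_add, ← pow_succ, ← pow_succ']; congr 1; ring
    calc _ = NCPoly.word b l * (NCPoly.X ^ (j + 1) * NCPoly.X ^ (j + 1)) * NCPoly.word b' l' := by
          simp only [mul_assoc]
      _ = _ := by rw [this]; simp only [mul_assoc]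
  rw [e]
  refine (h.norm_word_le _ _).trans ?_
  have hone : ‖(1 : B)‖ ≤ 1 := by
    rcases subsingleton_or_nontrivial B with hB | hB
    · rw [Subsingleton.elim (1 : B) 0, norm_zero]; exact zero_le_one
    · exact CStarRing.norm_one.le
  have hl0 : ∀ l : List B, 0 ≤ (l.map norm).prod := fun l =>
    List.prod_nonneg fun x hx => by
      obtain ⟨y, _, rfl⟩ := List.mem_map.1 hx
      exact norm_nonneg y
  have hlen : (l ++ 1 :: (List.replicate (2 * j) 1 ++ b' :: l')).length
      = 2 * l.length + 2 * (j + 1) := by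
    simp [h2]; ring
  rw [hlen, pow_add, ← pow_mul M 2 (j + 1), mul_assoc, mul_assoc, mul_comm (_ ^ 2)]
  refine mul_le_mul_of_nonneg_left (mul_le_mul_of_nonneg_left ?_ (by positivity)) (by positivity)
  simp only [List.map_append, List.map_cons, List.prod_append, List.prod_cons, List.map_replicate,
    List.prod_replicate]
  rw [h3]
  have h5 : ‖(1 : B)‖ * ‖(1 : B)‖ ^ (2 * j) ≤ 1 := by
    rw [← pow_succ']; exact pow_le_one₀ (norm_nonneg _) hone
  have h6 : 0 ≤ (‖b‖ * (l.map norm).prod) ^ 2 := by positivity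
  calc ‖b‖ * ((l.map norm).prod * (‖(1 : B)‖ * (‖(1 : B)‖ ^ (2 * j) * (‖b‖ * (l.map norm).prod))))
      = (‖(1 : B)‖ * ‖(1 : B)‖ ^ (2 * j)) * (‖b‖ * (l.map norm).prod) ^ 2 := by ring
    _ ≤ 1 * (‖b‖ * (l.map norm).prod) ^ 2 := mul_le_mul_of_nonneg_right h5 h6
    _ = _ := one_mul _

end Poly

/-! ### The boolean cumulant map of a distribution -/

section Boolean

variable {B : Type*} [CStarAlgebra B]

/-- The compression of left multiplication by `X` to the kernel of `μ`. -/
def compressedX (μ : NCPoly B →ₗ[ℂ] B) : Module.End ℂ (NCPoly B) :=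
  (LinearMap.id - NCPoly.C.toLinearMap ∘ₗ μ) ∘ₗ LinearMap.mulLeft ℂ NCPoly.X

/-- The action of `B⟨X⟩` in which `X` acts by its compression to the kernel of `μ`. -/
def compressedAction (μ : NCPoly B →ₗ[ℂ] B) : NCPoly B →ₐ[ℂ] Module.End ℂ (NCPoly B) :=
  NCPoly.eval ((Algebra.lmul ℂ (NCPoly B)).comp NCPoly.C) (compressedX μ)

/-- The linear map `ρ` with `F_μ(b) = b - μ(X) - G_ρ(b)`; its moments are the boolean cumulants
of `μ`. -/
def booleanMap (μ : NCPoly B →ₗ[ℂ] B) : NCPoly B →ₗ[ℂ] B :=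
  μ ∘ₗ LinearMap.mulLeft ℂ NCPoly.X ∘ₗ
    LinearMap.applyₗ (NCPoly.X - NCPoly.C (μ NCPoly.X)) ∘ₗ (compressedAction μ).toLinearMap

theorem compressedAction_X (μ : NCPoly B →ₗ[ℂ] B) (q : NCPoly B) :
    compressedAction μ NCPoly.X q = NCPoly.X * q - NCPoly.C (μ (NCPoly.X * q)) := by
  rw [compressedAction, NCPoly.eval_X]; rfl

theorem compressedAction_C (μ : NCPoly B →ₗ[ℂ] B) (b : B) (q : NCPoly B) :
    compressedAction μ (NCPoly.C b) q = NCPoly.C b * q := by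
  rw [compressedAction, NCPoly.eval_C]; rfl

theorem booleanMap_apply (μ : NCPoly B →ₗ[ℂ] B) (p : NCPoly B) :
    booleanMap μ p
      = μ (NCPoly.X * compressedAction μ p (NCPoly.X - NCPoly.C (μ NCPoly.X))) := rfl

variable [PartialOrder B] [StarOrderedRing B] {μ : NCPoly B →ₗ[ℂ] B}

namespace IsDistribution

theorem C_mul (h : IsDistribution μ) (b : B) (p : NCPoly B) : μ (NCPoly.C b * p) = b * μ p := by
  simpa using h.bimodular b 1 p

theorem mul_C (h : IsDistribution μ) (b : B) (p : NCPoly B) : μ (p * NCPoly.C b) = μ p * b := by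
  simpa using h.bimodular 1 b p

theorem map_C (h : IsDistribution μ) (b : B) : μ (NCPoly.C b) = b := by
  simpa [h.map_one] using h.C_mul b 1

theorem map_sub_mean (h : IsDistribution μ) : μ (NCPoly.X - NCPoly.C (μ NCPoly.X)) = 0 := by
  rw [map_sub, h.map_C, sub_self]

theorem isSelfAdjoint_mean (h : IsDistribution μ) : IsSelfAdjoint (μ NCPoly.X) := by
  have := h.isCP.map_star NCPoly.X
  rw [NCPoly.star_X] at this
  exact this.symm

/-- The compressed X maps into ker μ by construction, and B preserves ker μ by bimodularity. -/
theorem compressedAction_mem_ker (h : IsDistribution μ) (p q : NCPoly B) (hq : μ q = 0) :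
    μ (compressedAction μ p q) = 0 := by
  let S : Subalgebra ℂ (NCPoly B) :=
    { carrier := {p | ∀ q, μ q = 0 → μ (compressedAction μ p q) = 0}
      mul_mem' := fun {a b} ha hb q hq => by
        rw [map_mul]; exact ha _ (hb q hq)
      add_mem' := fun {a b} ha hb q hq => by
        rw [map_add, LinearMap.add_apply, map_add, ha q hq, hb q hq, add_zero]
      algebraMap_mem' := fun z q hq => by
        rw [AlgHom.commutes, Module.algebraMap_end_apply, map_smul, hq, smul_zero] }
  refine NCPoly.mem_of_subalgebra S (fun q _ => ?_) (fun b q hq => ?_) p q hq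
  · rw [compressedAction_X, map_sub, h.map_C, sub_self]
  · rw [compressedAction_C, h.C_mul, hq, mul_zero]

theorem compressedAction_mul_C (h : IsDistribution μ) (p q : NCPoly B) (b : B) :
    compressedAction μ p (q * NCPoly.C b) = compressedAction μ p q * NCPoly.C b := by
  let S : Subalgebra ℂ (NCPoly B) :=
    { carrier := {p | ∀ q, compressedAction μ p (q * NCPoly.C b)
        = compressedAction μ p q * NCPoly.C b}
      mul_mem' := fun {a c} ha hc q => by
        rw [map_mul (compressedAction μ), Module.End.mul_apply, hc, ha]; rfl
      add_mem' := fun {a c} ha hc q => by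
        rw [map_add, LinearMap.add_apply, ha q, hc q, ← add_mul]; rfl
      algebraMap_mem' := fun z q => by
        rw [AlgHom.commutes, Module.algebraMap_end_apply, Module.algebraMap_end_apply,
          smul_mul_assoc] }
  refine NCPoly.mem_of_subalgebra S (fun q => ?_) (fun c q => ?_) p q
  · rw [compressedAction_X, compressedAction_X, ← mul_assoc, h.mul_C, sub_mul, map_mul]
  · rw [compressedAction_C, compressedAction_C, mul_assoc]

/-- On ker μ the compressed action is a *-representation for the form μ(x* y): the terms subtracted
by the compression are paired with elements of ker μ and vanish. -/
theorem compressedAction_adjoint (h : IsDistribution μ) (p : NCPoly B) :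
    ∀ x y : NCPoly B, μ x = 0 → μ y = 0 →
      μ (star x * compressedAction μ p y) = μ (star (compressedAction μ (star p) x) * y) := by
  let S : Subalgebra ℂ (NCPoly B) :=
    { carrier := {p | ∀ x y : NCPoly B, μ x = 0 → μ y = 0 →
        μ (star x * compressedAction μ p y) = μ (star (compressedAction μ (star p) x) * y)}
      mul_mem' := fun {a b} ha hb x y hx hy => by
        rw [map_mul (compressedAction μ), Module.End.mul_apply, ha _ _ hx (h.compressedAction_mem_ker _ _ hy),
          hb _ _ (h.compressedAction_mem_ker _ _ hx) hy, star_mul, map_mul (compressedAction μ), Module.End.mul_apply]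
      add_mem' := fun {a b} ha hb x y hx hy => by
        rw [map_add, LinearMap.add_apply, mul_add, map_add, ha _ _ hx hy, hb _ _ hx hy, star_add,
          map_add, LinearMap.add_apply, star_add, add_mul, map_add]
      algebraMap_mem' := fun z x y hx hy => by
        rw [NCPoly.star_algebraMap, AlgHom.commutes, AlgHom.commutes,
          Module.algebraMap_end_apply, Module.algebraMap_end_apply, star_smul, star_star,
          mul_smul_comm, smul_mul_assoc] }
  refine NCPoly.mem_of_subalgebra S (fun x y hx hy => ?_) (fun b x y hx hy => ?_) p
  · have hx' : μ (star x) = 0 := by rw [h.isCP.map_star, hx, star_zero]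
    rw [NCPoly.star_X, compressedAction_X, compressedAction_X, mul_sub, map_sub, h.mul_C, hx',
      zero_mul, sub_zero, star_sub, NCPoly.star_C, sub_mul, map_sub, h.C_mul, hy, mul_zero,
      sub_zero, star_mul, NCPoly.star_X, mul_assoc]
  · rw [NCPoly.star_C, compressedAction_C, compressedAction_C, star_mul, NCPoly.star_C, star_star,
      mul_assoc]

/-- With ξ = X - μ(X) in ker μ, ρ(p q*) is the inner product of p* ξ and q* ξ for the compressed
action. Complete positivity of ρ is then inherited from μ. -/
theorem booleanMap_mul_star (h : IsDistribution μ) (p q : NCPoly B) :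
    booleanMap μ (p * star q) =
      μ (star (compressedAction μ (star p) (NCPoly.X - NCPoly.C (μ NCPoly.X))) *
        compressedAction μ (star q) (NCPoly.X - NCPoly.C (μ NCPoly.X))) := by
  have h1 := h.compressedAction_mem_ker (star q) _ h.map_sub_mean
  have h2 := h.compressedAction_mem_ker p _ h1
  rw [← h.compressedAction_adjoint p _ _ h.map_sub_mean h1, booleanMap_apply, map_mul (compressedAction μ),
    Module.End.mul_apply, star_sub, NCPoly.star_X, NCPoly.star_C, sub_mul, map_sub μ, h.C_mul, h2,
    mul_zero, sub_zero]

theorem isCP_booleanMap (h : IsDistribution μ) : IsCP (booleanMap μ) := by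
  intro n a
  have := h.isCP n fun i =>
    star (compressedAction μ (star (a i)) (NCPoly.X - NCPoly.C (μ NCPoly.X)))
  simp only [star_star] at this
  simpa only [h.booleanMap_mul_star] using this

/-- A compression does not increase the norm: the two forms differ by μ(Xξ)* μ(Xξ) ≥ 0. -/
theorem isOpBound_booleanMap (h : IsDistribution μ) {M : ℝ} (hM : IsOpBound μ NCPoly.X M) :
    IsOpBound (booleanMap μ) NCPoly.X M := by
  refine ⟨hM.1, fun q => ?_⟩
  have e : q * (NCPoly.X * star NCPoly.X) * star q = (q * NCPoly.X) * star (q * NCPoly.X) := by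
    simp only [star_mul, mul_assoc]
  rw [e, h.booleanMap_mul_star, h.booleanMap_mul_star, star_mul, NCPoly.star_X, map_mul (compressedAction μ),
    Module.End.mul_apply]
  set ξ := compressedAction μ (star q) (NCPoly.X - NCPoly.C (μ NCPoly.X)) with hξ
  have h1 := hM.2 (star ξ)
  rw [star_star] at h1
  refine le_trans ?_ h1
  rw [compressedAction_X, ← sub_nonneg]
  have h2 : μ (star ξ * (NCPoly.X * star NCPoly.X) * ξ) -
      μ (star (NCPoly.X * ξ - NCPoly.C (μ (NCPoly.X * ξ))) *
        (NCPoly.X * ξ - NCPoly.C (μ (NCPoly.X * ξ)))) = star (μ (NCPoly.X * ξ)) * μ (NCPoly.X * ξ) := by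
    rw [star_sub, sub_mul, mul_sub, mul_sub, map_sub, map_sub, map_sub, h.mul_C, h.mul_C,
      NCPoly.star_C, h.C_mul, h.map_C, h.isCP.map_star, star_mul, NCPoly.star_X]
    simp only [mul_assoc]
    abel
  rw [h2]
  exact star_mul_self_nonneg _

theorem booleanMap_one (h : IsDistribution μ) :
    booleanMap μ 1 = μ (NCPoly.X * NCPoly.X) - star (μ NCPoly.X) * μ NCPoly.X := by
  rw [booleanMap_apply, _root_.map_one (compressedAction μ), Module.End.one_apply, mul_sub, map_sub, h.mul_C,
    h.isSelfAdjoint_mean.star_eq]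

theorem map_X_mul_X_le (h : IsDistribution μ) {M : ℝ} (hM : IsOpBound μ NCPoly.X M) :
    μ (NCPoly.X * NCPoly.X) ≤ M ^ 2 • 1 := by
  have := hM.2 1
  simpa [h.map_one] using this

theorem norm_one_le_one (B : Type*) [CStarAlgebra B] : ‖(1 : B)‖ ≤ 1 := by
  rcases subsingleton_or_nontrivial B with hB | hB
  · rw [Subsingleton.elim (1 : B) 0, norm_zero]; exact zero_le_one
  · exact CStarRing.norm_one.le

theorem norm_booleanMap_one_le (h : IsDistribution μ) {M : ℝ} (hM : IsOpBound μ NCPoly.X M) :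
    ‖booleanMap μ 1‖ ≤ M ^ 2 := by
  have h0 : 0 ≤ booleanMap μ 1 := by simpa using h.isCP_booleanMap.pos 1
  have h1 : booleanMap μ 1 ≤ M ^ 2 • 1 := by
    rw [h.booleanMap_one]
    exact (sub_le_self _ (star_mul_self_nonneg _)).trans (h.map_X_mul_X_le hM)
  refine (CStarAlgebra.norm_le_norm_of_nonneg_of_le h0 h1).trans ?_
  rw [norm_smul, Real.norm_of_nonneg (by positivity)]
  exact mul_le_of_le_one_right (by positivity) (norm_one_le_one B)

/-- The variance is nonnegative, so μ(X)* μ(X) ≤ μ(X²) ≤ M². -/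
theorem norm_mean_le (h : IsDistribution μ) {M : ℝ} (hM : IsOpBound μ NCPoly.X M) :
    ‖μ NCPoly.X‖ ≤ M := by
  have h0 : 0 ≤ booleanMap μ 1 := by simpa using h.isCP_booleanMap.pos 1
  rw [h.booleanMap_one, sub_nonneg] at h0
  have h1 := CStarAlgebra.norm_le_norm_of_nonneg_of_le (star_mul_self_nonneg _)
    (h0.trans (h.map_X_mul_X_le hM))
  rw [CStarRing.norm_star_mul_self, norm_smul, Real.norm_of_nonneg (by positivity)] at h1
  refine le_of_sq_le_sq ?_ hM.1
  rw [pow_two]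
  exact h1.trans (mul_le_of_le_one_right (by positivity) (norm_one_le_one B))

end IsDistribution

/-! ### The recursion between moments and boolean cumulants -/

section Recursion

variable {n : ℕ}

/-- The action of `compressedAction` on square matrices. -/
def matAction (μ : NCPoly B →ₗ[ℂ] B) (W : Matrix (Fin n) (Fin n) (NCPoly B)) :
    Matrix (Fin n) (Fin n) (NCPoly B) →+ Matrix (Fin n) (Fin n) (NCPoly B) where
  toFun Z := Matrix.of fun i j => ∑ l, compressedAction μ (W i l) (Z l j)
  map_zero' := by ext i j; simp
  map_add' Z Z' := by ext i j; simp [Finset.sum_add_distrib]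

theorem matAction_apply (W Z : Matrix (Fin n) (Fin n) (NCPoly B)) (i j : Fin n) :
    matAction μ W Z i j = ∑ l, compressedAction μ (W i l) (Z l j) := rfl

theorem matAction_mul (W W' Z : Matrix (Fin n) (Fin n) (NCPoly B)) :
    matAction μ (W * W') Z = matAction μ W (matAction μ W' Z) := by
  ext i j
  simp only [matAction_apply, Matrix.mul_apply, map_sum, map_mul, LinearMap.sum_apply,
    Module.End.mul_apply]
  exact Finset.sum_comm

theorem matAction_C (c : Matrix (Fin n) (Fin n) B) (Z : Matrix (Fin n) (Fin n) (NCPoly B)) :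
    matAction μ (c.map NCPoly.C) Z = c.map NCPoly.C * Z := by
  ext i j
  simp only [matAction_apply, Matrix.mul_apply, Matrix.map_apply, compressedAction_C]

theorem matAction_X (Z : Matrix (Fin n) (Fin n) (NCPoly B)) :
    matAction μ (Matrix.diagonal fun _ => NCPoly.X) Z = Matrix.diagonal (fun _ => NCPoly.X) * Z
      - ((Matrix.diagonal (fun _ => NCPoly.X) * Z).map μ).map NCPoly.C := by
  ext i j
  rw [matAction_apply, Finset.sum_eq_single i (fun l _ hl => by
    rw [Matrix.diagonal_apply_ne' _ hl, map_zero, LinearMap.zero_apply]) (by simp)]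
  simp [compressedAction_X]

theorem matAction_mul_C (h : IsDistribution μ) (W Z : Matrix (Fin n) (Fin n) (NCPoly B))
    (c : Matrix (Fin n) (Fin n) B) :
    matAction μ W (Z * c.map NCPoly.C) = matAction μ W Z * c.map NCPoly.C := by
  ext i j
  simp only [matAction_apply, Matrix.mul_apply, Matrix.map_apply, map_sum,
    h.compressedAction_mul_C, Finset.sum_mul]
  exact Finset.sum_comm

theorem IsDistribution.map_C_mul_matrix (h : IsDistribution μ) (c : Matrix (Fin n) (Fin n) B)
    (Z : Matrix (Fin n) (Fin n) (NCPoly B)) : (c.map NCPoly.C * Z).map μ = c * Z.map μ := by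
  ext i j
  simp [Matrix.mul_apply, h.C_mul]

theorem IsDistribution.map_mul_C_matrix (h : IsDistribution μ) (c : Matrix (Fin n) (Fin n) B)
    (Z : Matrix (Fin n) (Fin n) (NCPoly B)) : (Z * c.map NCPoly.C).map μ = Z.map μ * c := by
  ext i j
  simp [Matrix.mul_apply, h.mul_C]

theorem map_mul_matrix_C (c d : Matrix (Fin n) (Fin n) B) :
    (c * d).map NCPoly.C = c.map (NCPoly.C (B := B)) * d.map NCPoly.C := by
  ext i j
  simp [Matrix.mul_apply]

theorem IsDistribution.booleanMap_matrix (W : Matrix (Fin n) (Fin n) (NCPoly B)) :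
    (Matrix.diagonal (fun _ => NCPoly.X) * matAction μ W
      (Matrix.diagonal fun _ => NCPoly.X - NCPoly.C (μ NCPoly.X))).map μ
      = W.map (booleanMap μ) := by
  ext i j
  rw [Matrix.map_apply, Matrix.diagonal_mul, matAction_apply, Finset.sum_eq_single j
    (fun l _ hl => by rw [Matrix.diagonal_apply_ne _ hl, map_zero]) (by simp)]
  rw [Matrix.diagonal_apply_eq, Matrix.map_apply, booleanMap_apply]

/-- Moments in terms of boolean cumulants. -/
theorem IsDistribution.moment_recursion (h : IsDistribution μ) (c : Matrix (Fin n) (Fin n) B)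
    (q : ℕ) :
    (((Matrix.diagonal fun _ => NCPoly.X) * c.map NCPoly.C) ^ (q + 1)).map μ =
      ∑ p ∈ Finset.HasAntidiagonal.antidiagonal q,
        (match p.1 with
          | 0 => Matrix.diagonal fun _ => μ NCPoly.X
          | i + 1 => ((c.map NCPoly.C * Matrix.diagonal fun _ => NCPoly.X) ^ i *
              c.map NCPoly.C).map (booleanMap μ)) * c *
        (((Matrix.diagonal fun _ => NCPoly.X) * c.map NCPoly.C) ^ p.2).map μ := by
  set x : Matrix (Fin n) (Fin n) (NCPoly B) := Matrix.diagonal fun _ => NCPoly.X with hx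
  set c' : Matrix (Fin n) (Fin n) (NCPoly B) := c.map NCPoly.C with hc'
  set y : Matrix (Fin n) (Fin n) (NCPoly B) :=
    Matrix.diagonal fun _ => NCPoly.X - NCPoly.C (μ NCPoly.X) with hy
  set U : ℕ → Matrix (Fin n) (Fin n) B := fun q => ((x * c') ^ q).map μ with hU
  set ξ : ℕ → Matrix (Fin n) (Fin n) (NCPoly B) := fun q => (x * c') ^ q - (U q).map NCPoly.C with hξ
  have h0 : ξ 0 = 0 := by
    ext i j
    by_cases hij : i = j <;> simp [hξ, hU, hij, h.map_one]
  have hxm : (x.map μ) = Matrix.diagonal fun _ => μ NCPoly.X := by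
    rw [hx, Matrix.diagonal_map (map_zero μ)]
  have hone : matAction μ (x * c') 1 = y * c' := by
    rw [matAction_mul, matAction_C, mul_one, matAction_X, ← hx, h.map_mul_C_matrix,
      map_mul_matrix_C, ← sub_mul, hxm]
    congr 1
    rw [hx, hy, Matrix.diagonal_map (map_zero NCPoly.C), Matrix.diagonal_sub]
  -- The vectors ξ q are the centred powers. The compressed action sends (x c')^q to ξ (q + 1);
  -- splitting (x c')^q into ξ q and its mean U q gives a recursion which, once unrolled, is the
  -- convolution sum.
  have hstep : ∀ q, ξ (q + 1) = matAction μ (x * c') (ξ q) + y * c' * (U q).map NCPoly.C :=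
      fun q => by
    have e : matAction μ (x * c') ((x * c') ^ q) = ξ (q + 1) := by
      rw [matAction_mul, matAction_C, matAction_X, ← hx, ← hc']
      simp only [hξ, hU, pow_succ', mul_assoc]
    rw [← e, ← hone, ← matAction_mul_C h, one_mul, ← map_add]
    congr 1
    simp [hξ]
  have hsum : ∀ q, ξ (q + 1) = ∑ p ∈ Finset.HasAntidiagonal.antidiagonal q,
      matAction μ ((x * c') ^ p.1) y * c' * (U p.2).map NCPoly.C := fun q => by
    induction q with
    | zero =>
      rw [hstep, h0, map_zero, zero_add, Finset.Nat.antidiagonal_zero, Finset.sum_singleton, pow_zero]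
      congr 2
      ext i j
      rw [matAction_apply, Finset.sum_eq_single i
        (fun l _ hl => by rw [Matrix.one_apply_ne' hl, map_zero, LinearMap.zero_apply]) (by simp)]
      simp
    | succ q ih =>
      rw [hstep, ih, map_sum, Finset.Nat.sum_antidiagonal_succ, add_comm]
      congr 1
      · congr 2
        ext i j
        rw [pow_zero, matAction_apply, Finset.sum_eq_single i
          (fun l _ hl => by rw [Matrix.one_apply_ne' hl, map_zero, LinearMap.zero_apply]) (by simp)]
        simp
      · refine Finset.sum_congr rfl fun p _ => ?_
        rw [matAction_mul_C h, matAction_mul_C h, ← matAction_mul, ← pow_succ']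
  have hUs : ∀ q, U (q + 1) = (Matrix.diagonal fun _ => μ NCPoly.X) * c * U q +
      (x * c' * ξ q).map μ := fun q => by
    have e : (x * c') ^ q = ξ q + (U q).map NCPoly.C := by simp [hξ]
    rw [← hxm, ← h.map_mul_C_matrix, ← h.map_mul_C_matrix, ← hc', ← Matrix.map_add μ (map_add μ)]
    change ((x * c') ^ (q + 1)).map μ = _
    rw [pow_succ', e, mul_add, add_comm]
  change U (q + 1) = _
  rw [hUs]
  cases q with
  | zero =>
    rw [h0, mul_zero, Matrix.map_zero μ (map_zero μ), add_zero, Finset.Nat.antidiagonal_zero,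
      Finset.sum_singleton]
  | succ q =>
    rw [Finset.Nat.sum_antidiagonal_succ]
    congr 1
    rw [hsum, Finset.mul_sum]
    have hs : ∀ (s : Finset (ℕ × ℕ)) (f : ℕ × ℕ → Matrix (Fin n) (Fin n) (NCPoly B)),
        (∑ p ∈ s, f p).map μ = ∑ p ∈ s, (f p).map μ := fun s f => by
      ext i j
      simp [Matrix.sum_apply]
    rw [hs]
    refine Finset.sum_congr rfl fun p _ => ?_
    dsimp only
    have e2 : ∀ i : ℕ, (c' * x) ^ i * c' = c' * (x * c') ^ i := fun i => by
      induction i with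
      | zero => simp
      | succ i ih => rw [pow_succ', mul_assoc, ih, pow_succ']; simp only [mul_assoc]
    rw [e2, ← IsDistribution.booleanMap_matrix, matAction_mul, matAction_C, ← hc',
      ← h.map_mul_C_matrix, ← h.map_mul_C_matrix, ← hx, ← hy, ← hc']
    simp only [mul_assoc, hU]

end Recursion

end Boolean

/-! ### Imaginary parts in a `C*`-algebra -/

section Im

variable {D : Type*} [CStarAlgebra D]

/-- The imaginary part as an element of the algebra. -/
def im (a : D) : D := (imaginaryPart a : D)

theorem im_eq (a : D) : im a = (-Complex.I / 2) • (a - star a) := by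
  rw [im, imaginaryPart_apply_coe, real_smul_eq_complex, smul_smul]
  congr 1
  simp
  ring

theorem im_add (a b : D) : im (a + b) = im a + im b := by
  simp [im]

theorem im_sub (a b : D) : im (a - b) = im a - im b := by
  simp [im]

theorem im_neg (a : D) : im (-a) = -im a := by
  simp [im]

theorem im_of_isSelfAdjoint {a : D} (h : IsSelfAdjoint a) : im a = 0 := by
  rw [im_eq, h.star_eq, sub_self, smul_zero]

theorem im_I_smul {a : D} (h : IsSelfAdjoint a) : im (Complex.I • a) = a := by
  rw [im_eq, star_smul, h.star_eq, Complex.star_def, Complex.conj_I, neg_smul, sub_neg_eq_add,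
    ← add_smul, smul_smul]
  convert one_smul ℂ a using 2
  linear_combination (-1 : ℂ) * Complex.I_mul_I

theorem isSelfAdjoint_im (a : D) : IsSelfAdjoint (im a) := (imaginaryPart a).2

theorem sub_star_eq (a : D) : a - star a = (2 * Complex.I) • im a := by
  rw [im_eq, smul_smul]
  have : 2 * Complex.I * (-Complex.I / 2) = 1 := by linear_combination (-1 : ℂ) * Complex.I_mul_I
  rw [this, one_smul]

theorem map_im {D' : Type*} [CStarAlgebra D'] (f : D →ₗ[ℂ] D') (hf : ∀ a, f (star a) = star (f a))
    (a : D) : im (f a) = f (im a) := by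
  rw [im_eq, im_eq, map_smul, map_sub, hf]

/-- This is v (u - u*) v* = v* - v. -/
theorem im_inv {u v : D} (h2 : v * u = 1) : im v = -(v * im u * star v) := by
  have h3 : star u * star v = 1 := by rw [← star_mul, h2, star_one]
  have e : v * (u - star u) * star v = star v - v := by
    rw [mul_sub, sub_mul, h2, one_mul, mul_assoc, h3, mul_one]
  rw [sub_star_eq, mul_smul_comm, smul_mul_assoc] at e
  rw [im_eq v, ← neg_sub (star v) v, ← e, smul_neg, smul_smul]
  have : -Complex.I / 2 * (2 * Complex.I) = 1 := by linear_combination (-1 : ℂ) * Complex.I_mul_I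
  rw [this, one_smul]

variable [PartialOrder D] [StarOrderedRing D]

/-- Expanding |a - iε|² in either order gives |a|² - 2ε Im a + ε² ≥ 0, and Im a ≥ ε. -/
theorem sq_le_mul_star_of_le_im {a : D} {ε : ℝ} (hε : 0 < ε) (h : ε • 1 ≤ im a) :
    (ε ^ 2) • (1 : D) ≤ a * star a ∧ (ε ^ 2) • (1 : D) ≤ star a * a := by
  set z : D := (Complex.I * (ε : ℂ)) • (1 : D) with hz
  have hsz : star z = -z := by
    rw [hz, star_smul, star_one, Complex.star_def, map_mul, Complex.conj_I, Complex.conj_ofReal,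
      neg_mul, neg_smul]
  have hzz : z * z = -((ε ^ 2 : ℝ) • (1 : D)) := by
    rw [hz, smul_mul_smul_comm, one_mul, real_smul_eq_complex, ← neg_smul]
    congr 1
    push_cast
    linear_combination ((ε : ℂ) ^ 2) * Complex.I_mul_I
  have hza : z * (a - star a) = -((2 * ε) • im a) := by
    rw [sub_star_eq, hz, smul_mul_smul_comm, one_mul, real_smul_eq_complex, ← neg_smul]
    congr 1
    push_cast
    linear_combination (2 * (ε : ℂ)) * Complex.I_mul_I
  have hcomm : ∀ b : D, b * z = z * b := fun b => by
    rw [hz, mul_smul_comm, smul_mul_assoc, one_mul, mul_one]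
  have hk : (2 * ε) • (ε • (1 : D)) ≤ (2 * ε) • im a :=
    smul_le_smul_of_nonneg_left h (by positivity)
  have hk2 : (ε ^ 2) • (1 : D) = (2 * ε) • (ε • (1 : D)) - (ε ^ 2) • 1 := by
    rw [smul_smul, ← sub_smul]; congr 1; ring
  have e1 : (a - z) * star (a - z) = a * star a - (2 * ε) • im a + (ε ^ 2) • 1 := by
    rw [star_sub, hsz, sub_mul, mul_sub, mul_sub, mul_neg, mul_neg, hcomm a, hzz]
    have : a * star a - -(z * a) - (z * star a - - -((ε ^ 2) • (1 : D)))
      = a * star a + z * (a - star a) + (ε ^ 2) • 1 := by rw [mul_sub]; abel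
    rw [this, hza]; abel
  have e2 : star (a - z) * (a - z) = star a * a - (2 * ε) • im a + (ε ^ 2) • 1 := by
    rw [star_sub, hsz, sub_mul, mul_sub, mul_sub, neg_mul, neg_mul, hcomm (star a), hzz]
    have : star a * a - z * star a - (-(z * a) - - -((ε ^ 2) • (1 : D)))
      = star a * a + z * (a - star a) + (ε ^ 2) • 1 := by rw [mul_sub]; abel
    rw [this, hza]; abel
  have p1 := mul_star_self_nonneg (a - z)
  have p2 := star_mul_self_nonneg (a - z)
  rw [e1] at p1
  rw [e2] at p2
  constructor
  · rw [hk2]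
    refine (sub_le_sub_right hk _).trans ?_
    rw [← sub_nonneg]
    convert p1 using 1
    abel
  · rw [hk2]
    refine (sub_le_sub_right hk _).trans ?_
    rw [← sub_nonneg]
    convert p2 using 1
    abel

theorem isStrictlyPositive_smul_one {ε : ℝ} (hε : 0 < ε) : IsStrictlyPositive (ε • (1 : D)) :=
  ⟨smul_nonneg hε.le zero_le_one, by
    rw [← Algebra.algebraMap_eq_smul_one]; exact (IsUnit.mk0 ε hε.ne').map (algebraMap ℝ D)⟩

/-- Both a a* and a* a are bounded below by ε², which provides a right and a left inverse of a. -/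
theorem isUnit_of_le_im {a : D} {ε : ℝ} (hε : 0 < ε) (h : ε • 1 ≤ im a) : IsUnit a := by
  obtain ⟨h1, h2⟩ := sq_le_mul_star_of_le_im hε h
  have u1 := CStarAlgebra.isUnit_of_le _ h1 (isStrictlyPositive_smul_one (by positivity))
  have u2 := CStarAlgebra.isUnit_of_le _ h2 (isStrictlyPositive_smul_one (by positivity))
  obtain ⟨v, hv⟩ := u1.exists_right_inv
  obtain ⟨w, hw⟩ := u2.exists_left_inv
  rw [mul_assoc] at hv
  rw [← mul_assoc] at hw
  exact isUnit_iff_exists.2 ⟨star a * v, hv, by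
    rw [← left_inv_eq_right_inv hw hv, hw]⟩

theorem norm_inverse_le_of_le_im {a : D} {ε : ℝ} (hε : 0 < ε) (h : ε • 1 ≤ im a) :
    ‖Ring.inverse a‖ ≤ ε⁻¹ := by
  have hu := isUnit_of_le_im hε h
  have h1 := (sq_le_mul_star_of_le_im hε h).1
  have hv := Ring.inverse_mul_cancel a hu
  set v := Ring.inverse a
  have h3 : star a * star v = 1 := by rw [← star_mul, hv, star_one]
  have h4 := star_right_conjugate_le_conjugate h1 v
  have e1 : v * (a * star a) * star v = 1 := by
    rw [← mul_assoc, hv, one_mul, h3]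
  rw [e1, mul_smul_comm, mul_one, smul_mul_assoc] at h4
  have h5 := CStarAlgebra.norm_le_norm_of_nonneg_of_le
    (smul_nonneg (sq_nonneg ε) (mul_star_self_nonneg v)) h4
  rw [norm_smul, CStarRing.norm_self_mul_star, Real.norm_of_nonneg (by positivity)] at h5
  have h6 := h5.trans (IsDistribution.norm_one_le_one D)
  have h7 : (ε * ‖v‖) ^ 2 ≤ 1 ^ 2 := by rw [mul_pow, pow_two ‖v‖]; linarith
  have h8 := le_of_sq_le_sq h7 zero_le_one
  rwa [← one_div, le_div_iff₀ hε, mul_comm]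

theorem im_inverse_nonpos {a : D} {ε : ℝ} (hε : 0 < ε) (h : ε • 1 ≤ im a) :
    im (Ring.inverse a) ≤ 0 := by
  rw [im_inv (Ring.inverse_mul_cancel a (isUnit_of_le_im hε h)), neg_nonpos]
  exact star_right_conjugate_nonneg ((smul_nonneg hε.le zero_le_one).trans h) _

theorem nonneg_of_isSelfAdjoint_add {a : D} {C : ℝ} (h : IsSelfAdjoint a) (hC : ‖a‖ ≤ C) :
    0 ≤ a + C • 1 := by
  have h1 := h.neg_algebraMap_norm_le_self
  rw [Algebra.algebraMap_eq_smul_one, neg_le_iff_add_nonneg] at h1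
  exact h1.trans (add_le_add_right (smul_le_smul_of_nonneg_right hC zero_le_one) a)

/-- `Im a ≥ ε`. -/
def ImGe (ε : ℝ) (a : D) : Prop := ε • (1 : D) ≤ im a

theorem ImGe.mono {ε δ : ℝ} {a : D} (h : ImGe ε a) (hδ : δ ≤ ε) : ImGe δ a :=
  (smul_le_smul_of_nonneg_right hδ zero_le_one).trans h

theorem ImGe.add {ε : ℝ} {a b : D} (h : ImGe ε a) (hb : 0 ≤ im b) : ImGe ε (a + b) := by
  rw [ImGe, im_add]
  exact h.trans (le_add_of_nonneg_right hb)

theorem ImGe.map {D' : Type*} [CStarAlgebra D'] [PartialOrder D'] [StarOrderedRing D']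
    (f : D →⋆ₐ[ℂ] D') {ε : ℝ} {a : D} (h : ImGe ε a) : ImGe ε (f a) := by
  have e : im (f a) = f (im a) := map_im (f.toAlgHom.toLinearMap) (fun a => StarHomClass.map_star f a) a
  have h1 : 0 ≤ im a - ε • 1 := sub_nonneg.2 h
  obtain ⟨d, hd⟩ := exists_eq_star_mul_self h1
  have h2 : f (im a) - ε • 1 = star (f d) * f d := by
    rw [← StarHomClass.map_star f, ← map_mul, ← hd, map_sub, real_smul_eq_complex, real_smul_eq_complex, map_smul,
      _root_.map_one]
  rw [ImGe, e, ← sub_nonneg, h2]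
  exact star_mul_self_nonneg _

theorem imGe_of_nonneg {ε : ℝ} {a : D} (h : 0 ≤ im a - algebraMap ℂ D (ε : ℂ)) : ImGe ε a := by
  rwa [Algebra.algebraMap_eq_smul_one, ← real_smul_eq_complex, sub_nonneg] at h

theorem ImGe.isStrictlyPositive {ε δ : ℝ} (hεδ : ε < δ) {a : D} (h : ImGe δ a) :
    IsStrictlyPositive (im a - algebraMap ℂ D (ε : ℂ)) := by
  rw [Algebra.algebraMap_eq_smul_one, ← real_smul_eq_complex]
  refine (isStrictlyPositive_smul_one (sub_pos.2 hεδ)).of_le ?_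
  rw [sub_smul]
  exact sub_le_sub_right h _

theorem convex_setOf_imGe : Convex ℝ {a : D | ∃ ε : ℝ, 0 < ε ∧ ImGe ε a} := by
  rintro b ⟨ε, hε, h⟩ c ⟨δ, hδ, h'⟩ s t hs ht hst
  refine ⟨min ε δ, lt_min hε hδ, ?_⟩
  have hsm : ∀ (r : ℝ) (a : D), im (r • a) = r • im a := fun r a => by
    rw [im_eq, im_eq, star_smul, star_trivial, ← smul_sub, smul_comm]
  rw [ImGe, im_add, hsm, hsm]
  calc min ε δ • (1 : D) = s • (min ε δ • (1 : D)) + t • (min ε δ • (1 : D)) := by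
        rw [← add_smul, hst, one_smul]
    _ ≤ _ := add_le_add (smul_le_smul_of_nonneg_left (h.mono (min_le_left _ _)) hs)
        (smul_le_smul_of_nonneg_left (h'.mono (min_le_right _ _)) ht)

theorem isOpen_setOf_imGe : IsOpen {a : D | ∃ ε : ℝ, 0 < ε ∧ ImGe ε a} := by
  rw [Metric.isOpen_iff]
  rintro b ⟨ε, hε, h⟩
  refine ⟨ε / 2, half_pos hε, fun c hc => ⟨ε / 2, half_pos hε, ?_⟩⟩
  have hn : ‖im (c - b)‖ ≤ ε / 2 := by
    rw [im_eq, norm_smul]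
    have h1 : ‖c - b - star (c - b)‖ ≤ ‖c - b‖ + ‖c - b‖ :=
      (norm_sub_le _ _).trans_eq (by rw [norm_star])
    have h2 : ‖-Complex.I / 2‖ = 1 / 2 := by simp
    have h3 : ‖c - b‖ < ε / 2 := by rwa [← dist_eq_norm]
    rw [h2]; linarith
  have h1 := nonneg_of_isSelfAdjoint_add (isSelfAdjoint_im _) hn
  have h2 := add_le_add h h1
  rw [im_sub, add_zero] at h2
  have h3 := sub_le_sub_right h2 ((ε / 2) • (1 : D))
  rw [← sub_smul, sub_half] at h3
  refine h3.trans (le_of_eq ?_)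
  abel

end Im

/-! ### The half plane in terms of `ImGe` -/

section HalfPlane

variable {B : Type*} [CStarAlgebra B] [PartialOrder B] [StarOrderedRing B] {n : ℕ}

theorem imGe_of_mem_halfPlane {ε : ℝ} {b : Mat B n} (h : b ∈ halfPlane B ε n) : ImGe ε b :=
  imGe_of_nonneg h.1

theorem upperHalfPlane_eq : upperHalfPlane B n = {b | ∃ ε : ℝ, 0 < ε ∧ ImGe ε b} := by
  ext b
  simp only [upperHalfPlane, Set.mem_iUnion, exists_prop, Set.mem_ofPred_eq]
  constructor
  · rintro ⟨ε, hε, h⟩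
    exact ⟨ε, hε, imGe_of_mem_halfPlane h⟩
  · rintro ⟨ε, hε, h⟩
    exact ⟨ε / 2, half_pos hε, h.isStrictlyPositive (half_lt_self hε)⟩

theorem mem_upperHalfPlane_iff {b : Mat B n} :
    b ∈ upperHalfPlane B n ↔ ∃ ε : ℝ, 0 < ε ∧ ImGe ε b := by
  rw [upperHalfPlane_eq]; rfl

theorem isOpen_upperHalfPlane : IsOpen (upperHalfPlane B n) := by
  rw [upperHalfPlane_eq]; exact isOpen_setOf_imGe

theorem isPreconnected_upperHalfPlane : IsPreconnected (upperHalfPlane B n) := by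
  rw [upperHalfPlane_eq]; exact (convex_setOf_imGe (D := Mat B n)).isPreconnected

end HalfPlane

/-! ### Entrywise maps between matrix algebras -/

section MatMap

variable {A A' : Type*} [CStarAlgebra A] [CStarAlgebra A']

/-- The entrywise application of a `*`-homomorphism to matrices. -/
def matMap (n : ℕ) (f : A →⋆ₐ[ℂ] A') : CStarMatrix (Fin n) (Fin n) A →⋆ₐ[ℂ] CStarMatrix (Fin n) (Fin n) A' where
  toFun a := CStarMatrix.ofMatrix (Matrix.map (CStarMatrix.ofMatrix.symm a) f)
  map_one' := by
    ext i j
    change f ((1 : Matrix (Fin n) (Fin n) A) i j) = (1 : Matrix (Fin n) (Fin n) A') i j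
    rw [Matrix.one_apply, Matrix.one_apply]
    split_ifs <;> simp
  map_mul' a b := by
    ext i j
    change f ((a * b) i j) = _
    rw [CStarMatrix.mul_apply, CStarMatrix.mul_apply, map_sum]
    simp only [map_mul]
    rfl
  map_zero' := by ext i j; exact map_zero f
  map_add' a b := by ext i j; exact map_add f _ _
  commutes' z := by
    ext i j
    change f (algebraMap ℂ (CStarMatrix (Fin n) (Fin n) A) z i j) = _
    rw [CStarMatrix.algebraMap_apply, CStarMatrix.algebraMap_apply]
    by_cases h : i = j <;> simp [h, AlgHomClass.commutes f]
  map_star' a := by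
    ext i j
    change f (star a i j) = _
    rw [CStarMatrix.star_apply, CStarMatrix.star_apply, StarHomClass.map_star f]; rfl

/-- Diagonal matrices with constant entry. -/
def diagHom (n : ℕ) (A : Type*) [CStarAlgebra A] : A →⋆ₐ[ℂ] CStarMatrix (Fin n) (Fin n) A where
  toFun a := CStarMatrix.ofMatrix (Matrix.diagonal fun _ => a)
  map_one' := by
    ext i j
    change Matrix.diagonal (fun _ => (1 : A)) i j = (1 : Matrix (Fin n) (Fin n) A) i j
    rw [Matrix.diagonal_one]
  map_mul' a b := by
    exact (Matrix.diagonal_mul_diagonal (fun _ : Fin n => a) fun _ => b).symm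
  map_zero' := by
    change (Matrix.diagonal fun _ => (0 : A)) = 0
    rw [Matrix.diagonal_zero]
  map_add' a b := by
    exact (Matrix.diagonal_add (fun _ : Fin n => a) fun _ => b).symm
  commutes' z := by
    ext i j
    rw [CStarMatrix.algebraMap_apply]
    change Matrix.diagonal (fun _ => algebraMap ℂ A z) i j = _
    by_cases h : i = j <;> simp [h]
  map_star' a := by
    ext i j
    rw [CStarMatrix.star_apply]
    change Matrix.diagonal (fun _ => star a) i j = star (Matrix.diagonal (fun _ => a) j i)
    by_cases h : i = j
    · simp [h]
    · simp [h, Ne.symm h]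

theorem diagHom_apply (n : ℕ) (a : A) :
    diagHom n A a = CStarMatrix.ofMatrix (Matrix.diagonal fun _ => a) := rfl

variable [PartialOrder A] [StarOrderedRing A] [PartialOrder A'] [StarOrderedRing A']

theorem norm_matMap_le (n : ℕ) (f : A →⋆ₐ[ℂ] A') (a : Mat A n) : ‖matMap n f a‖ ≤ ‖a‖ :=
  NonUnitalStarAlgHom.norm_apply_le (matMap n f) a

theorem norm_diagHom_le (n : ℕ) (a : A) : ‖diagHom n A a‖ ≤ ‖a‖ :=
  NonUnitalStarAlgHom.norm_apply_le (diagHom n A) a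

/-- The entrywise application of a continuous linear map to matrices. -/
def matCLM (n : ℕ) (φ : A →L[ℂ] A') : Mat A n →L[ℂ] Mat A' n where
  toFun a := CStarMatrix.ofMatrix (Matrix.map (CStarMatrix.ofMatrix.symm a) φ)
  map_add' a b := by ext i j; exact map_add φ _ _
  map_smul' z a := by ext i j; exact map_smul φ z _
  cont := (CStarMatrix.ofMatrixL (A := A')).continuous.comp
    (((CStarMatrix.ofMatrixL (A := A)).symm.continuous).matrix_map φ.continuous)

theorem matCLM_apply (n : ℕ) (φ : A →L[ℂ] A') (a : Mat A n) (i j : Fin n) :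
    matCLM n φ a i j = φ (a i j) := rfl

/-- Write the positive matrix as d* d and split it over the rows of d; each row contributes a matrix
to which complete positivity applies directly. -/
theorem matCLM_nonneg (n : ℕ) {φ : A →L[ℂ] A'} (hφ : IsCP (φ : A →ₗ[ℂ] A')) {a : Mat A n}
    (ha : 0 ≤ a) : 0 ≤ matCLM n φ a := by
  obtain ⟨d, rfl⟩ := exists_eq_star_mul_self ha
  have e : matCLM n φ (star d * d) = ∑ k, (CStarMatrix.ofMatrix
      (Matrix.of fun i j => φ (star (d k i) * star (star (d k j)))) : Mat A' n) := by
    ext i j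
    have hs : ∀ (s : Finset (Fin n)) (f : Fin n → Mat A' n), (∑ k ∈ s, f k) i j = ∑ k ∈ s, f k i j :=
      fun s f => Matrix.sum_apply i j s f
    rw [hs, matCLM_apply, CStarMatrix.mul_apply, map_sum]
    simp only [CStarMatrix.star_apply, star_star]
    rfl
  rw [e]
  exact Finset.sum_nonneg fun k _ => hφ n fun i => star (d k i)

theorem matCLM_mono (n : ℕ) {φ : A →L[ℂ] A'} (hφ : IsCP (φ : A →ₗ[ℂ] A')) {a b : Mat A n}
    (hab : a ≤ b) : matCLM n φ a ≤ matCLM n φ b := by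
  rw [← sub_nonneg, ← map_sub]
  exact matCLM_nonneg n hφ (sub_nonneg.2 hab)

theorem matCLM_star (n : ℕ) {φ : A →L[ℂ] A'} (hφ : IsCP (φ : A →ₗ[ℂ] A')) (a : Mat A n) :
    matCLM n φ (star a) = star (matCLM n φ a) := by
  ext i j
  rw [matCLM_apply, CStarMatrix.star_apply, CStarMatrix.star_apply, matCLM_apply]
  exact hφ.map_star _

theorem matCLM_one (n : ℕ) (φ : A →L[ℂ] A') : matCLM n φ 1 = diagHom n A' (φ 1) := by
  ext i j
  rw [matCLM_apply, diagHom_apply]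
  change φ ((1 : Matrix (Fin n) (Fin n) A) i j) = Matrix.diagonal (fun _ => φ 1) i j
  rw [Matrix.one_apply, Matrix.diagonal_apply]
  split_ifs <;> simp

/-- A uniform bound for a positive map on a `C*`-algebra. -/
theorem norm_map_le_of_pos {ρ : A →ₗ[ℂ] A'} (hρ : ∀ q : A, 0 ≤ ρ (q * star q)) (a : A) :
    ‖ρ a‖ ≤ 6 * ‖ρ 1‖ * ‖a‖ := by
  refine le_of_forall_pos_le_add fun ε hε => ?_
  have hpos : 0 < 6 * ‖ρ 1‖ + 1 := by positivity
  set δ := ε / (6 * ‖ρ 1‖ + 1) with hδ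
  have hδ0 : 0 < δ := by positivity
  have h0 : 0 ≤ algebraMap ℝ A (‖a‖ ^ 2) - a * star a :=
    sub_nonneg.2 CStarAlgebra.mul_star_le_algebraMap_norm_sq
  obtain ⟨d, hd⟩ := exists_eq_star_mul_self h0
  have h1 := hρ (star d)
  rw [star_star, ← hd, map_sub, Algebra.algebraMap_eq_smul_one, real_smul_eq_complex, map_smul,
    ← real_smul_eq_complex, sub_nonneg] at h1
  have h2 : ρ (a * star a) ≤ (‖a‖ + δ) ^ 2 • ρ 1 := h1.trans
    (smul_le_smul_of_nonneg_right (by gcongr; linarith) (by simpa using hρ 1))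
  have h3 := norm_map_le_of_map_mul_star_le hρ (by positivity) h2
  have h5 : 6 * ‖ρ 1‖ * δ ≤ ε := by
    rw [hδ, mul_div_assoc', div_le_iff₀ hpos]
    nlinarith [norm_nonneg (ρ 1)]
  linarith

/-- The amplification is itself positive, and its value at 1 is diagonal with entry φ(1). The bound
is therefore independent of n, which is the source of all uniformity in the matrix size. -/
theorem norm_matCLM_le (n : ℕ) {φ : A →L[ℂ] A'} (hφ : IsCP (φ : A →ₗ[ℂ] A')) (a : Mat A n) :
    ‖matCLM n φ a‖ ≤ 6 * ‖φ 1‖ * ‖a‖ := by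
  refine (norm_map_le_of_pos (ρ := (matCLM n φ : Mat A n →ₗ[ℂ] Mat A' n))
    (fun q => matCLM_nonneg n hφ (mul_star_self_nonneg q)) a).trans ?_
  have : ‖(matCLM n φ : Mat A n →ₗ[ℂ] Mat A' n) 1‖ ≤ ‖φ 1‖ := by
    change ‖matCLM n φ 1‖ ≤ _
    rw [matCLM_one]
    exact norm_diagHom_le n _
  gcongr

end MatMap

theorem ringInverse_eq {R : Type*} [Ring R] {a b : R} (h1 : a * b = 1) (h2 : b * a = 1) :
    Ring.inverse a = b :=
  Ring.inverse_unit ⟨a, b, h1, h2⟩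

theorem norm_inverse_one_sub_le {A : Type*} [CStarAlgebra A] {y : A} (h : ‖y‖ ≤ 1 / 2) :
    ‖Ring.inverse (1 - y)‖ ≤ 2 := by
  have hu := isUnit_one_sub_of_norm_lt_one (h.trans_lt (by norm_num))
  have e := Ring.mul_inverse_cancel _ hu
  set v := Ring.inverse (1 - y)
  have e2 : v = 1 + y * v := by rw [← e]; noncomm_ring
  have h3 : ‖v‖ ≤ 1 + 1 / 2 * ‖v‖ := by
    conv_lhs => rw [e2]
    refine (norm_add_le _ _).trans (add_le_add (IsDistribution.norm_one_le_one _) ?_)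
    exact (norm_mul_le _ _).trans (mul_le_mul_of_nonneg_right h (norm_nonneg _))
  linarith

theorem norm_pow_le_of_cstar {A : Type*} [CStarAlgebra A] (a : A) (p : ℕ) : ‖a ^ p‖ ≤ ‖a‖ ^ p := by
  cases p with
  | zero => rw [pow_zero, pow_zero]; exact IsDistribution.norm_one_le_one A
  | succ p => exact norm_pow_le' a p.succ_pos

theorem hasSum_inverse_one_sub {A : Type*} [CStarAlgebra A] {y : A} (h : ‖y‖ < 1) :
    HasSum (fun p : ℕ => y ^ p) (Ring.inverse (1 - y)) := by
  rw [ringInverse_eq (mul_neg_geom_series y h) (geom_series_mul_neg y h)]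
  exact (summable_geometric_of_norm_lt_one h).hasSum

/-! ### Cauchy transforms through a dilation -/

section DilationTransform

variable {B : Type*} [CStarAlgebra B] [PartialOrder B] [StarOrderedRing B]

/-- The inclusion `B → B⟨X⟩` as a `*`-homomorphism. -/
def NCPoly.starC : B →⋆ₐ[ℂ] NCPoly B :=
  { NCPoly.C with map_star' := fun b => (NCPoly.star_C b).symm }

namespace Dilation

variable {ρ : NCPoly B →ₗ[ℂ] B} (D : Dilation ρ) (n : ℕ)

instance : PartialOrder D.A := CStarAlgebra.spectralOrder D.A

instance : StarOrderedRing D.A := CStarAlgebra.spectralOrderedRing D.A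

/-- Matrices over `B` as matrices over the dilation algebra. -/
def ι : Mat B n →⋆ₐ[ℂ] Mat D.A n := matMap n (D.π.comp NCPoly.starC)

/-- The image of `X ⊗ 1_n` in matrices over the dilation algebra. -/
def x : Mat D.A n := diagHom n D.A (D.π NCPoly.X)

/-- The map `φ ⊗ 1_n`. -/
def Φ : Mat D.A n →L[ℂ] Mat B n := matCLM n D.φ

/-- Matrices of polynomials as matrices over the dilation algebra. -/
def polyMat : Matrix (Fin n) (Fin n) (NCPoly B) →+* Mat D.A n :=
  (CStarMatrix.ofMatrixRingEquiv (n := Fin n) (A := D.A)).toRingHom.comp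
    ((D.π : NCPoly B →+* D.A).mapMatrix)

/-- The Cauchy transform of `ρ` on the half plane. -/
def G (b : Mat B n) : Mat B n := D.Φ n (Ring.inverse (D.ι n b - D.x n))

/-- The Cauchy transform of `ρ` at `c⁻¹`, for small `c`. -/
def S (c : Mat B n) : Mat B n := D.Φ n (Ring.inverse (1 - D.ι n c * D.x n) * D.ι n c)

variable {n}

theorem Φ_polyMat (W : Matrix (Fin n) (Fin n) (NCPoly B)) :
    D.Φ n (D.polyMat n W) = CStarMatrix.ofMatrix (W.map ρ) := by
  ext i j
  exact D.φ_π (W i j)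

theorem polyMat_C (c : Mat B n) :
    D.polyMat n ((CStarMatrix.ofMatrix.symm c).map NCPoly.C) = D.ι n c := rfl

theorem polyMat_X : D.polyMat n (Matrix.diagonal fun _ => NCPoly.X) = D.x n := by
  ext i j
  change D.π (Matrix.diagonal (fun _ => NCPoly.X) i j) = Matrix.diagonal (fun _ => D.π NCPoly.X) i j
  rw [Matrix.diagonal_apply, Matrix.diagonal_apply]
  split_ifs <;> simp

theorem isSelfAdjoint_x : IsSelfAdjoint (D.x n) := by
  have h : IsSelfAdjoint (NCPoly.X : NCPoly B) := NCPoly.star_X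
  exact (h.map D.π).map (diagHom n D.A)

theorem norm_x_le : ‖D.x n‖ ≤ ‖D.π NCPoly.X‖ := norm_diagHom_le n _

theorem norm_ι_le (c : Mat B n) : ‖D.ι n c‖ ≤ ‖c‖ := norm_matMap_le n _ c

theorem φ_one : D.φ 1 = ρ 1 := by rw [← D.φ_π, map_one D.π]

theorem imGe_sub_x {ε : ℝ} {b : Mat B n} (h : ImGe ε b) : ImGe ε (D.ι n b - D.x n) := by
  rw [sub_eq_add_neg]
  exact (h.map (D.ι n)).add (by rw [im_neg, im_of_isSelfAdjoint D.isSelfAdjoint_x, neg_zero])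

theorem norm_Φ_le (a : Mat D.A n) : ‖D.Φ n a‖ ≤ 6 * ‖ρ 1‖ * ‖a‖ := by
  rw [← D.φ_one]
  exact norm_matCLM_le n D.isCP a

theorem norm_G_le {ε : ℝ} (hε : 0 < ε) {b : Mat B n} (h : ImGe ε b) :
    ‖D.G n b‖ ≤ 6 * ‖ρ 1‖ * ε⁻¹ :=
  (D.norm_Φ_le _).trans (mul_le_mul_of_nonneg_left
    (norm_inverse_le_of_le_im hε (D.imGe_sub_x h)) (by positivity))

theorem im_G {ε : ℝ} (hε : 0 < ε) {b : Mat B n} (h : ImGe ε b) :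
    im (D.G n b) = -D.Φ n (Ring.inverse (D.ι n b - D.x n) * D.ι n (im b) *
      star (Ring.inverse (D.ι n b - D.x n))) := by
  have e1 : im (D.G n b) = D.Φ n (im (Ring.inverse (D.ι n b - D.x n))) :=
    map_im (D.Φ n : Mat D.A n →ₗ[ℂ] Mat B n) (fun a => matCLM_star n D.isCP a) _
  have e2 : im (D.ι n b - D.x n) = D.ι n (im b) := by
    rw [im_sub, im_of_isSelfAdjoint D.isSelfAdjoint_x, sub_zero]
    exact map_im ((D.ι n).toAlgHom.toLinearMap) (fun a => StarHomClass.map_star (D.ι n) a) b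
  rw [e1, im_inv (Ring.inverse_mul_cancel _ (isUnit_of_le_im hε (D.imGe_sub_x h))), e2, map_neg]

theorem im_G_nonpos {ε : ℝ} (hε : 0 < ε) {b : Mat B n} (h : ImGe ε b) : im (D.G n b) ≤ 0 := by
  have e1 : im (D.G n b) = D.Φ n (im (Ring.inverse (D.ι n b - D.x n))) :=
    map_im (D.Φ n : Mat D.A n →ₗ[ℂ] Mat B n) (fun a => matCLM_star n D.isCP a) _
  rw [e1, ← map_zero (D.Φ n)]
  exact matCLM_mono n D.isCP (im_inverse_nonpos hε (D.imGe_sub_x h))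

theorem analyticAt_ι (b : Mat B n) : AnalyticAt ℂ (D.ι n) b := by
  let L : Mat B n →L[ℂ] Mat D.A n :=
    (D.ι n).toAlgHom.toLinearMap.mkContinuous 1 fun c => by rw [one_mul]; exact D.norm_ι_le c
  exact L.analyticAt b

theorem analyticAt_G {b : Mat B n} (hu : IsUnit (D.ι n b - D.x n)) : AnalyticAt ℂ (D.G n) b := by
  have h1 : AnalyticAt ℂ (fun b => D.ι n b - D.x n) b := (D.analyticAt_ι b).sub analyticAt_const
  obtain ⟨u, hu⟩ := hu
  have h2 : AnalyticAt ℂ Ring.inverse (D.ι n b - D.x n) := by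
    rw [← hu]; exact analyticAt_inverse u
  exact ((D.Φ n).analyticAt _).comp (h2.comp_of_eq h1 rfl)

theorem norm_ι_mul_x_le (c : Mat B n) : ‖D.ι n c * D.x n‖ ≤ ‖c‖ * ‖D.π NCPoly.X‖ :=
  (norm_mul_le _ _).trans (mul_le_mul (D.norm_ι_le c) D.norm_x_le (norm_nonneg _) (norm_nonneg _))

theorem isUnit_one_sub {c : Mat B n} (h : ‖c‖ * ‖D.π NCPoly.X‖ < 1) :
    IsUnit (1 - D.ι n c * D.x n) :=
  isUnit_one_sub_of_norm_lt_one ((D.norm_ι_mul_x_le c).trans_lt h)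

/-- Factor b - x = b (1 - c x). The right-hand side of the resulting formula also makes sense for
non-invertible c, and this is how functions of b⁻¹ extend to a full ball. -/
theorem inverse_sub_x {b c : Mat B n} (h1 : b * c = 1) (h2 : c * b = 1)
    (h : IsUnit (1 - D.ι n c * D.x n)) :
    Ring.inverse (D.ι n b - D.x n) = Ring.inverse (1 - D.ι n c * D.x n) * D.ι n c := by
  have e1 : D.ι n b * D.ι n c = 1 := by rw [← map_mul, h1, map_one]
  have e2 : D.ι n c * D.ι n b = 1 := by rw [← map_mul, h2, map_one]
  have e : D.ι n b - D.x n = D.ι n b * (1 - D.ι n c * D.x n) := by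
    rw [mul_sub, mul_one, ← mul_assoc, e1, one_mul]
  rw [e]
  refine ringInverse_eq ?_ ?_
  · rw [mul_assoc, ← mul_assoc (1 - D.ι n c * D.x n), Ring.mul_inverse_cancel _ h, one_mul, e1]
  · rw [mul_assoc, ← mul_assoc (D.ι n c), e2, one_mul, Ring.inverse_mul_cancel _ h]

theorem G_eq_S {b c : Mat B n} (h1 : b * c = 1) (h2 : c * b = 1)
    (h : ‖c‖ * ‖D.π NCPoly.X‖ < 1) : D.G n b = D.S n c := by
  rw [G, D.inverse_sub_x h1 h2 (D.isUnit_one_sub h), S]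

theorem norm_S_le {c : Mat B n} (h : ‖c‖ * ‖D.π NCPoly.X‖ ≤ 1 / 2) :
    ‖D.S n c‖ ≤ 12 * ‖ρ 1‖ * ‖c‖ := by
  have h1 : ‖D.ι n c * D.x n‖ ≤ 1 / 2 := (D.norm_ι_mul_x_le c).trans h
  have h2 : ‖Ring.inverse (1 - D.ι n c * D.x n)‖ ≤ 2 := norm_inverse_one_sub_le h1
  calc ‖D.S n c‖ ≤ 6 * ‖ρ 1‖ * ‖Ring.inverse (1 - D.ι n c * D.x n) * D.ι n c‖ := D.norm_Φ_le _
    _ ≤ 6 * ‖ρ 1‖ * (2 * ‖c‖) := by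
        refine mul_le_mul_of_nonneg_left ((norm_mul_le _ _).trans ?_) (by positivity)
        exact mul_le_mul h2 (D.norm_ι_le c) (norm_nonneg _) (by norm_num)
    _ = _ := by ring

/-- The Neumann series of the Cauchy transform. -/
theorem hasSum_S {c : Mat B n} (h : ‖c‖ * ‖D.π NCPoly.X‖ < 1) :
    HasSum (fun p => D.Φ n ((D.ι n c * D.x n) ^ p * D.ι n c)) (D.S n c) := by
  have h1 := (D.norm_ι_mul_x_le c).trans_lt h
  exact (((hasSum_inverse_one_sub h1).mul_right (D.ι n c)).mapL (D.Φ n))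

theorem summable_norm_Φ {a : Mat D.A n} (h : ‖a‖ < 1) (d : Mat D.A n) :
    Summable fun p : ℕ => ‖D.Φ n (a ^ p * d)‖ := by
  refine Summable.of_nonneg_of_le (fun p => norm_nonneg _) (fun p => ?_)
    ((summable_geometric_of_lt_one (norm_nonneg a) h).mul_left (6 * ‖ρ 1‖ * ‖d‖))
  refine (D.norm_Φ_le _).trans ?_
  rw [mul_assoc _ ‖d‖]
  refine mul_le_mul_of_nonneg_left ?_ (by positivity)
  rw [mul_comm ‖d‖]
  exact (norm_mul_le _ _).trans (mul_le_mul_of_nonneg_right (norm_pow_le_of_cstar a p)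
    (norm_nonneg d))

end Dilation

/-! ### The `F`-transform on the half plane -/

section Transform

variable {μ : NCPoly B →ₗ[ℂ] B} {n : ℕ}

/-- The function `b ↦ b - μ(X) - G_ρ(b)`. -/
def nevanlinna (D : Dilation (booleanMap μ)) (n : ℕ) (b : Mat B n) : Mat B n :=
  b - diagHom n B (μ NCPoly.X) - D.G n b

variable (hμ : IsDistribution μ) (D : Dilation (booleanMap μ))

include hμ in
theorem im_nevanlinna (b : Mat B n) : im (nevanlinna D n b) = im b - im (D.G n b) := by
  have h : IsSelfAdjoint (diagHom n B (μ NCPoly.X)) := hμ.isSelfAdjoint_mean.map (diagHom n B)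
  rw [nevanlinna, im_sub, im_sub, im_of_isSelfAdjoint h, sub_zero]

include hμ in
theorem imGe_nevanlinna {ε : ℝ} (hε : 0 < ε) {b : Mat B n} (h : ImGe ε b) :
    ImGe ε (nevanlinna D n b) := by
  rw [ImGe, im_nevanlinna hμ D]
  exact h.trans (by rw [le_sub_self_iff]; exact D.im_G_nonpos hε h)

theorem analyticAt_nevanlinna {ε : ℝ} (hε : 0 < ε) {b : Mat B n} (h : ImGe ε b) :
    AnalyticAt ℂ (nevanlinna D n) b :=
  (analyticAt_id.sub analyticAt_const).sub
    (D.analyticAt_G (isUnit_of_le_im hε (D.imGe_sub_x h)))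

include hμ in
-- Let c = b⁻¹ and T = Σ μ((Xc)^q). Summing `moment_recursion` as a Cauchy product gives T = 1 +
-- (μ(X) + G_ρ(b)) c T, that is, (b - μ(X) - G_ρ(b)) c T = 1. The moment series equals c T.
-- Dilations of μ and of ρ supply the absolute convergence of the two factors.
theorem hasSum_momentTerm (E : Dilation μ) {ε : ℝ} (hε : 0 < ε) {b : Mat B n} (h : ImGe ε b)
    (h1 : ‖Ring.inverse b‖ * ‖D.π NCPoly.X‖ < 1) (h2 : ‖Ring.inverse b‖ * ‖E.π NCPoly.X‖ < 1) :
    HasSum (fun p : ℕ => momentTerm μ p (Ring.inverse b)) (Ring.inverse (nevanlinna D n b)) := by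
  have hb := isUnit_of_le_im hε h
  have hbc := Ring.mul_inverse_cancel b hb
  have hcb := Ring.inverse_mul_cancel b hb
  set c := Ring.inverse b with hc
  set c₀ : Matrix (Fin n) (Fin n) B := CStarMatrix.ofMatrix.symm c with hc₀
  -- moments
  set U : ℕ → Mat B n := fun q => E.Φ n ((E.x n * E.ι n c) ^ q * 1) with hU
  have hUm : ∀ q, U q = CStarMatrix.ofMatrix
      (((Matrix.diagonal (fun _ => NCPoly.X) * c₀.map NCPoly.C) ^ q).map μ) := fun q => by
    rw [← E.Φ_polyMat, map_pow, map_mul, E.polyMat_C, E.polyMat_X]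
    exact congrArg (E.Φ n) (mul_one _)
  have hxc : ‖E.x n * E.ι n c‖ < 1 := by
    refine lt_of_le_of_lt ((norm_mul_le _ _).trans ?_) h2
    rw [mul_comm]
    exact mul_le_mul (E.norm_ι_le c) E.norm_x_le (norm_nonneg _) (norm_nonneg _)
  have hUs : Summable fun q => ‖U q‖ := E.summable_norm_Φ hxc 1
  -- boolean cumulants
  set W : ℕ → Mat B n := fun i => D.Φ n ((D.ι n c * D.x n) ^ i * D.ι n c) with hW
  have hWm : ∀ i, W i = CStarMatrix.ofMatrix
      (((c₀.map NCPoly.C * Matrix.diagonal (fun _ => NCPoly.X)) ^ i *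
        c₀.map NCPoly.C).map (booleanMap μ)) := fun i => by
    rw [← D.Φ_polyMat, map_mul (D.polyMat n), map_pow, map_mul (D.polyMat n), D.polyMat_C,
      D.polyMat_X]
  have hWs : Summable fun q => ‖W q‖ :=
    D.summable_norm_Φ ((D.norm_ι_mul_x_le c).trans_lt h1) _
  have hWsum : HasSum W (D.G n b) := by
    rw [D.G_eq_S hbc hcb h1]; exact D.hasSum_S h1
  -- The first boolean cumulant is the mean; the later ones are moments of ρ, with the index shifted
  -- by one.
  set V : ℕ → Mat B n := fun i => Nat.casesOn i (diagHom n B (μ NCPoly.X)) W with hV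
  have hVsum : HasSum V (diagHom n B (μ NCPoly.X) + D.G n b) :=
    (hasSum_nat_add_iff' 1).1 (by simpa [hV] using hWsum)
  have hVc : HasSum (fun i => V i * c) ((diagHom n B (μ NCPoly.X) + D.G n b) * c) :=
    hVsum.mul_right c
  have hVs : Summable fun i => ‖V i * c‖ := by
    have : Summable fun i => ‖V i‖ := (summable_nat_add_iff 1).1 hWs
    exact Summable.of_nonneg_of_le (fun _ => norm_nonneg _) (fun i => norm_mul_le _ _)
      (this.mul_right ‖c‖)
  have hrec : ∀ q, U (q + 1) = ∑ p ∈ Finset.HasAntidiagonal.antidiagonal q, V p.1 * c * U p.2 :=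
      fun q => by
    rw [hUm, hμ.moment_recursion]
    change (∑ p ∈ Finset.HasAntidiagonal.antidiagonal q, _ : Matrix (Fin n) (Fin n) B) = _
    refine Finset.sum_congr rfl fun p _ => ?_
    rw [hUm p.2]
    rcases p with ⟨_ | i, j⟩
    · rfl
    · change _ = W i * c * _
      rw [hWm]; rfl
  have hU0 : U 0 = 1 := by
    rw [hUm, pow_zero]
    ext i j
    change μ ((1 : Matrix (Fin n) (Fin n) (NCPoly B)) i j) = (1 : Matrix (Fin n) (Fin n) B) i j
    rw [Matrix.one_apply, Matrix.one_apply]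
    split_ifs
    · exact hμ.map_one
    · exact map_zero μ
  have hUsum := hUs.of_norm
  have key : ∑' q, U q = 1 + (diagHom n B (μ NCPoly.X) + D.G n b) * c * ∑' q, U q := by
    conv_lhs => rw [hUsum.tsum_eq_zero_add, hU0]
    congr 1
    rw [← hVc.tsum_eq, tsum_mul_tsum_eq_tsum_sum_antidiagonal_of_summable_norm hVs hUs]
    exact tsum_congr hrec
  have hmt : ∀ p, momentTerm μ p c = c * U p := fun p => by
    rw [hUm]
    have e2 : ∀ i : ℕ, (c₀.map NCPoly.C * Matrix.diagonal (fun _ => NCPoly.X)) ^ i * c₀.map NCPoly.C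
        = c₀.map NCPoly.C * ((Matrix.diagonal (fun _ => NCPoly.X) : Matrix (Fin n) (Fin n) (NCPoly B)) *
          c₀.map NCPoly.C) ^ i := fun i => by
      induction i with
      | zero => simp
      | succ i ih => rw [pow_succ', mul_assoc, ih, pow_succ']; simp only [mul_assoc]
    change CStarMatrix.ofMatrix (((c₀.map NCPoly.C * Matrix.diagonal (fun _ => NCPoly.X)) ^ p *
      c₀.map NCPoly.C).map μ) = _
    rw [e2, hμ.map_C_mul_matrix]
    rfl
  have hT : nevanlinna D n b * (c * ∑' q, U q) = 1 := by
    have e : nevanlinna D n b = b - (diagHom n B (μ NCPoly.X) + D.G n b) := by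
      rw [nevanlinna, sub_sub]
    rw [e, sub_mul, ← mul_assoc, hbc, one_mul, ← mul_assoc]
    nth_rw 1 [key]
    rw [add_sub_cancel_right]
  have hF := isUnit_of_le_im hε (imGe_nevanlinna hμ D hε h)
  have hinv : Ring.inverse (nevanlinna D n b) = c * ∑' q, U q := by
    have := Ring.inverse_mul_cancel _ hF
    exact left_inv_eq_right_inv this hT
  rw [hinv]
  simp only [hmt]
  exact hUsum.hasSum.mul_left c

include hμ in
theorem isCauchyTransform_inverse_nevanlinna (E : Dilation μ) (n : ℕ) :
    IsCauchyTransform μ n fun b => Ring.inverse (nevanlinna D n b) := by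
  constructor
  · intro b hb
    obtain ⟨ε, hε, h⟩ := mem_upperHalfPlane_iff.1 hb
    obtain ⟨u, hu⟩ := isUnit_of_le_im hε (imGe_nevanlinna hμ D hε h)
    have h2 : AnalyticAt ℂ Ring.inverse (nevanlinna D n b) := by
      rw [← hu]; exact analyticAt_inverse u
    exact h2.comp_of_eq (analyticAt_nevanlinna D hε h) rfl
  · refine ⟨(‖D.π NCPoly.X‖ + ‖E.π NCPoly.X‖ + 1)⁻¹, by positivity, fun b hb hR => ?_⟩
    obtain ⟨ε, hε, h⟩ := mem_upperHalfPlane_iff.1 hb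
    have hpos : 0 < ‖D.π NCPoly.X‖ + ‖E.π NCPoly.X‖ + 1 := by positivity
    rw [← one_div, lt_div_iff₀ hpos] at hR
    have h0 := norm_nonneg (Ring.inverse b)
    refine hasSum_momentTerm hμ D E hε h (lt_of_le_of_lt ?_ hR) (lt_of_le_of_lt ?_ hR)
    · exact mul_le_mul_of_nonneg_left (by linarith [norm_nonneg (E.π NCPoly.X)]) h0
    · exact mul_le_mul_of_nonneg_left (by linarith [norm_nonneg (D.π NCPoly.X)]) h0

theorem imGe_I_smul {A : Type*} [CStarAlgebra A] [PartialOrder A] [StarOrderedRing A] (y : ℝ) :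
    ImGe y (Complex.I • ((y : ℂ) • (1 : A))) := by
  have h : IsSelfAdjoint ((y : ℂ) • (1 : A)) := by
    rw [IsSelfAdjoint, star_smul, star_one, Complex.star_def, Complex.conj_ofReal]
  rw [ImGe, im_I_smul h, real_smul_eq_complex]

/-- Identity theorem on the convex half plane: around i/r, with r half the smaller of the two radii,
both functions are the sum of the same series. -/
theorem IsCauchyTransform.eqOn {g g' : Mat B n → Mat B n} (h : IsCauchyTransform μ n g)
    (h' : IsCauchyTransform μ n g') : Set.EqOn g g' (upperHalfPlane B n) := by
  obtain ⟨ha, R, hR, hs⟩ := h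
  obtain ⟨ha', R', hR', hs'⟩ := h'
  set r := min R R' / 2 with hr
  have hr0 : 0 < r := half_pos (lt_min hR hR')
  have hlt : r < min R R' := half_lt_self (lt_min hR hR')
  set z₀ : Mat B n := Complex.I • (((r⁻¹ : ℝ) : ℂ) • (1 : Mat B n)) with hz₀
  have hz : ImGe r⁻¹ z₀ := imGe_I_smul _
  have hz₀m : z₀ ∈ upperHalfPlane B n := mem_upperHalfPlane_iff.2 ⟨_, inv_pos.2 hr0, hz⟩
  refine ha.eqOn_of_preconnected_of_eventuallyEq ha' isPreconnected_upperHalfPlane hz₀m ?_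
  have hc : ContinuousAt (fun b : Mat B n => ‖Ring.inverse b‖) z₀ := by
    obtain ⟨u, hu⟩ := isUnit_of_le_im (inv_pos.2 hr0) hz
    rw [← hu]
    exact (NormedRing.inverse_continuousAt u).norm
  have hn : ‖Ring.inverse z₀‖ < min R R' :=
    (norm_inverse_le_of_le_im (inv_pos.2 hr0) hz).trans_lt (by rwa [inv_inv])
  filter_upwards [isOpen_upperHalfPlane.mem_nhds hz₀m, hc.eventually_lt_const hn] with b hb hbn
  exact (hs b hb (hbn.trans_le (min_le_left _ _))).unique
    (hs' b hb (hbn.trans_le (min_le_right _ _)))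

include hμ in
theorem cauchyTransform_eq (E : Dilation μ) {b : Mat B n} (hb : b ∈ upperHalfPlane B n) :
    cauchyTransform μ n b = Ring.inverse (nevanlinna D n b) := by
  have h : ∃ g, IsCauchyTransform μ n g := ⟨_, isCauchyTransform_inverse_nevanlinna hμ D E n⟩
  rw [cauchyTransform, dif_pos h]
  exact h.choose_spec.eqOn (isCauchyTransform_inverse_nevanlinna hμ D E n) hb

include hμ in
theorem fTransform_eq (E : Dilation μ) {b : Mat B n} (hb : b ∈ upperHalfPlane B n) :
    fTransform μ n b = nevanlinna D n b := by
  obtain ⟨ε, hε, h⟩ := mem_upperHalfPlane_iff.1 hb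
  obtain ⟨u, hu⟩ := isUnit_of_le_im hε (imGe_nevanlinna hμ D hε h)
  rw [fTransform, cauchyTransform_eq hμ D E hb, ← hu, Ring.inverse_unit, Ring.inverse_unit,
    inv_inv]

end Transform

end DilationTransform

/-! ### From comparison of imaginary parts to comparison of moments -/

section Comparison

/-- The inverse of an element of the lower half plane is in the upper half plane. -/
theorem exists_imGe_inverse {A : Type*} [CStarAlgebra A] [PartialOrder A] [StarOrderedRing A]
    {c : A} {ε : ℝ} (hε : 0 < ε) (h : ImGe ε (-c)) :
    IsUnit c ∧ (∃ δ : ℝ, 0 < δ ∧ ImGe δ (Ring.inverse c)) ∧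
      c * im (Ring.inverse c) * star c = im (-c) := by
  have hu : IsUnit c := by simpa using (isUnit_of_le_im hε h).neg
  have h1 := Ring.mul_inverse_cancel c hu
  have h2 := Ring.inverse_mul_cancel c hu
  set b := Ring.inverse c with hb
  have hstar : star b * star c = 1 := by rw [← star_mul, h1, star_one]
  have himc : im c = -(c * im b * star c) := im_inv h1
  have himb : im b = -(b * im c * star b) := im_inv h2
  refine ⟨hu, ⟨ε / (‖c‖ ^ 2 + 1), by positivity, ?_⟩, by rw [im_neg, himc, neg_neg]⟩
  have e1 : ε • (b * star b) ≤ im b := by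
    have := star_right_conjugate_le_conjugate h b
    rw [im_neg, mul_neg, neg_mul, ← himb, mul_smul_comm, mul_one, smul_mul_assoc] at this
    exact this
  have e2 : (1 : A) ≤ (‖c‖ ^ 2 + 1) • (b * star b) := by
    have h3 : c * star c ≤ (‖c‖ ^ 2 + 1) • 1 := by
      refine CStarAlgebra.mul_star_le_algebraMap_norm_sq.trans ?_
      rw [Algebra.algebraMap_eq_smul_one]
      exact smul_le_smul_of_nonneg_right (by linarith) zero_le_one
    have := star_right_conjugate_le_conjugate h3 b
    have e : b * (c * star c) * star b = 1 := by
      have h4 : star c * star b = 1 := by rw [← star_mul, h2, star_one]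
      rw [← mul_assoc, h2, one_mul, h4]
    rwa [e, mul_smul_comm, mul_one, smul_mul_assoc] at this
  refine le_trans ?_ e1
  have := smul_le_smul_of_nonneg_left e2 (show 0 ≤ ε / (‖c‖ ^ 2 + 1) by positivity)
  refine this.trans (le_of_eq ?_)
  rw [smul_smul]
  congr 1
  field_simp

theorem ofReal_smul_le_ofReal_smul {A : Type*} [CStarAlgebra A] [PartialOrder A]
    [StarOrderedRing A] {a b : A} {r : ℝ} (hr : 0 < r) : (r : ℂ) • a ≤ (r : ℂ) • b ↔ a ≤ b := by
  rw [← real_smul_eq_complex, ← real_smul_eq_complex]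
  exact smul_le_smul_iff_of_pos_left hr

theorem imGe_mul_of_nonneg {A : Type*} [CStarAlgebra A] [PartialOrder A] [StarOrderedRing A]
    {a e : A} {r : ℝ} (hr : 0 ≤ r) (he : 0 ≤ e) (h : im a = (r : ℂ) • (e + (r : ℂ) • (1 : A))) :
    ImGe (r * r) a := by
  rw [ImGe, h, ← real_smul_eq_complex, ← real_smul_eq_complex, smul_add, smul_smul]
  exact le_add_of_nonneg_left (smul_nonneg hr he)

variable {B : Type*} [CStarAlgebra B] [PartialOrder B] [StarOrderedRing B]

namespace Dilation

variable {ρ : NCPoly B →ₗ[ℂ] B} (D : Dilation ρ) {n : ℕ}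

/-- The quadratic form `d ↦ φ((1 - c X)⁻¹ d (1 - X c^*)⁻¹)`. -/
def Ψ (n : ℕ) (c d : Mat B n) : Mat B n :=
  D.Φ n (Ring.inverse (1 - D.ι n c * D.x n) * D.ι n d *
    star (Ring.inverse (1 - D.ι n c * D.x n)))

/-- In the variable c = b⁻¹, the factor c in (1 - cx)⁻¹ c absorbs Im b into c Im b c* = Im(-c). The
resulting form stays continuous up to self-adjoint c, where b itself may not exist. -/
theorem im_G_inverse {c : Mat B n} {ε : ℝ} (hε : 0 < ε) (h : ImGe ε (-c))
    (hc : IsUnit (1 - D.ι n c * D.x n)) :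
    im (D.G n (Ring.inverse c)) = -D.Ψ n c (im (-c)) := by
  obtain ⟨hu, ⟨δ, hδ, hb⟩, e⟩ := exists_imGe_inverse hε h
  rw [D.im_G hδ hb, D.inverse_sub_x (Ring.inverse_mul_cancel c hu) (Ring.mul_inverse_cancel c hu)
    hc, Ψ, ← e, map_mul (D.ι n), map_mul (D.ι n), StarHomClass.map_star (D.ι n), star_mul]
  simp only [mul_assoc]

theorem tendsto_Ψ {α : Type*} {l : Filter α} {c d : α → Mat B n} {c₀ d₀ : Mat B n}
    (hc : Tendsto c l (𝓝 c₀)) (hd : Tendsto d l (𝓝 d₀)) (hu : IsUnit (1 - D.ι n c₀ * D.x n)) :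
    Tendsto (fun a => D.Ψ n (c a) (d a)) l (𝓝 (D.Ψ n c₀ d₀)) := by
  have hι : ∀ b : Mat B n, Tendsto (D.ι n) (𝓝 b) (𝓝 (D.ι n b)) := fun b =>
    (D.analyticAt_ι b).continuousAt
  have h1 : Tendsto (fun a => 1 - D.ι n (c a) * D.x n) l (𝓝 (1 - D.ι n c₀ * D.x n)) :=
    tendsto_const_nhds.sub (((hι c₀).comp hc).mul tendsto_const_nhds)
  have h2 : Tendsto (fun a => Ring.inverse (1 - D.ι n (c a) * D.x n)) l
      (𝓝 (Ring.inverse (1 - D.ι n c₀ * D.x n))) := by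
    obtain ⟨u, hu⟩ := hu
    have := NormedRing.inverse_continuousAt u
    rw [ContinuousAt, hu] at this
    exact this.comp h1
  exact ((D.Φ n).continuous.tendsto _).comp ((h2.mul ((hι d₀).comp hd)).mul h2.star)

end Dilation

variable {μ ν : NCPoly B →ₗ[ℂ] B} (D : Dilation (booleanMap μ)) (D' : Dilation (booleanMap ν))

/-- Comparison of the quadratic forms of two Cauchy transforms with comparable imaginary parts. -/
theorem Ψ_le {n : ℕ}
    (hG : ∀ b : Mat B n, b ∈ upperHalfPlane B n → im (D.G n b) ≤ im (D'.G n b))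
    {s e : Mat B n} (hs : IsSelfAdjoint s) (he : 0 ≤ e)
    (h1 : ‖s‖ * ‖D.π NCPoly.X‖ < 1) (h2 : ‖s‖ * ‖D'.π NCPoly.X‖ < 1) :
    D'.Ψ n s e ≤ D.Ψ n s e := by
  set d : ℝ → Mat B n := fun ε => e + (ε : ℂ) • (1 : Mat B n) with hd
  -- The point s is approached from the lower half plane in direction e, perturbed by ε 1 so that
  -- Im(-c) = ε (e + ε) is strictly positive. Dividing by ε and letting ε → 0 leaves the forms at
  -- (s, e).
  set c : ℝ → Mat B n := fun ε => s - Complex.I • ((ε : ℂ) • d ε) with hc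
  have hdt : Tendsto d (𝓝[>] 0) (𝓝 e) := by
    have : Continuous d := by fun_prop
    have h0 : d 0 = e := by simp only [hd, Complex.ofReal_zero, zero_smul, add_zero]
    exact h0 ▸ (this.tendsto 0).mono_left nhdsWithin_le_nhds
  have hct : Tendsto c (𝓝[>] 0) (𝓝 s) := by
    have : Continuous c := by fun_prop
    have h0 : c 0 = s := by simp only [hc, Complex.ofReal_zero, zero_smul, smul_zero, sub_zero]
    exact h0 ▸ (this.tendsto 0).mono_left nhdsWithin_le_nhds
  have hb1 : ∀ᶠ ε in 𝓝[>] (0 : ℝ), ‖c ε‖ * ‖D.π NCPoly.X‖ < 1 :=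
    (hct.norm.mul_const _).eventually_lt_const h1
  have hb2 : ∀ᶠ ε in 𝓝[>] (0 : ℝ), ‖c ε‖ * ‖D'.π NCPoly.X‖ < 1 :=
    (hct.norm.mul_const _).eventually_lt_const h2
  refine le_of_tendsto_of_tendsto (D'.tendsto_Ψ hct hdt (D'.isUnit_one_sub h2))
    (D.tendsto_Ψ hct hdt (D.isUnit_one_sub h1)) ?_
  filter_upwards [hb1, hb2, self_mem_nhdsWithin] with ε hε1 hε2 hε
  have hε0 : (0 : ℝ) < ε := hε
  have hsa : ∀ r : ℝ, IsSelfAdjoint ((r : ℂ) • (1 : Mat B n)) := fun r => by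
    rw [IsSelfAdjoint, star_smul, star_one, Complex.star_def, Complex.conj_ofReal]
  have hdsa : IsSelfAdjoint ((ε : ℂ) • d ε) := by
    have h3 : IsSelfAdjoint (d ε) := (IsSelfAdjoint.of_nonneg he).add (hsa ε)
    rw [IsSelfAdjoint, star_smul, h3.star_eq, Complex.star_def, Complex.conj_ofReal]
  have him : im (-c ε) = (ε : ℂ) • d ε := by
    rw [im_neg, hc, im_sub, im_of_isSelfAdjoint hs, zero_sub, neg_neg, im_I_smul hdsa]
  have hge : ImGe (ε * ε) (-c ε) := imGe_mul_of_nonneg hε0.le he him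
  have hpos : 0 < ε * ε := by positivity
  have key := hG _ (mem_upperHalfPlane_iff.2 (exists_imGe_inverse hpos hge).2.1)
  rw [D.im_G_inverse hpos hge (D.isUnit_one_sub hε1), D'.im_G_inverse hpos hge
    (D'.isUnit_one_sub hε2), him, neg_le_neg_iff] at key
  have hlin : ∀ {ρ : NCPoly B →ₗ[ℂ] B} (E : Dilation ρ),
      E.Ψ n (c ε) ((ε : ℂ) • d ε) = (ε : ℂ) • E.Ψ n (c ε) (d ε) := fun E => by
    rw [Dilation.Ψ, Dilation.Ψ, map_smul (E.ι n), mul_smul_comm, smul_mul_assoc, map_smul]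
  rwa [hlin, hlin, ofReal_smul_le_ofReal_smul hε0] at key

/-- Powers of a matrix with vanishing entries above the first superdiagonal. -/
theorem hessenberg_pow {R : Type*} [Ring R] {N : ℕ} (m : Matrix (Fin (N + 1)) (Fin (N + 1)) R)
    (a : ℕ → R) (h0 : ∀ i j : Fin (N + 1), (i : ℕ) + 1 < j → m i j = 0)
    (h1 : ∀ i j : Fin (N + 1), (i : ℕ) + 1 = j → m i j = a i) (p : ℕ) :
    (∀ j : Fin (N + 1), p < j → (m ^ p) 0 j = 0) ∧
      ∀ j : Fin (N + 1), p = j → (m ^ p) 0 j = ((List.range p).map a).prod := by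
  induction p with
  | zero =>
    refine ⟨fun j hj => ?_, fun j hj => ?_⟩
    · rw [pow_zero, Matrix.one_apply_ne]
      rintro rfl
      exact absurd hj (by simp)
    · have : j = 0 := Fin.ext (by simpa using hj.symm)
      simp [this]
  | succ p ih =>
    refine ⟨fun j hj => ?_, fun j hj => ?_⟩
    · rw [pow_succ, Matrix.mul_apply]
      refine Finset.sum_eq_zero fun l _ => ?_
      by_cases hl : p < l
      · rw [ih.1 l hl, zero_mul]
      · rw [h0 l j (by omega), mul_zero]
    · have hp : p < N + 1 := by omega
      rw [pow_succ, Matrix.mul_apply, Finset.sum_eq_single ⟨p, hp⟩]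
      · rw [ih.2 ⟨p, hp⟩ rfl, h1 ⟨p, hp⟩ j hj, List.range_succ, List.map_append, List.prod_append]
        simp
      · intro l _ hl
        rcases lt_trichotomy (l : ℕ) p with h | h | h
        · rw [h0 l j (by omega), mul_zero]
        · exact absurd (Fin.ext h) hl
        · rw [ih.1 l h, zero_mul]
      · simp

/-- The self-adjoint matrix with `b i` on the superdiagonal. -/
def pathMat (b : ℕ → B) (N : ℕ) : Mat B (N + 1) :=
  CStarMatrix.ofMatrix (Matrix.of fun i j =>
    if (i : ℕ) + 1 = j then b i else if (j : ℕ) + 1 = i then star (b j) else 0)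

theorem isSelfAdjoint_pathMat (b : ℕ → B) (N : ℕ) : IsSelfAdjoint (pathMat b N) := by
  ext i j
  rw [CStarMatrix.star_apply]
  simp only [pathMat, CStarMatrix.ofMatrix_apply, Matrix.of_apply]
  split_ifs <;> first | omega | simp

/-- The projection onto the last coordinate. -/
def lastProj (A : Type*) [CStarAlgebra A] (N : ℕ) : Mat A (N + 1) :=
  CStarMatrix.ofMatrix (Matrix.of fun i j => if i = Fin.last N ∧ j = Fin.last N then 1 else 0)

theorem lastProj_apply (A : Type*) [CStarAlgebra A] (N : ℕ) (i j : Fin (N + 1)) :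
    lastProj A N i j = if i = Fin.last N ∧ j = Fin.last N then 1 else 0 := rfl

theorem mul_lastProj_mul_star {A : Type*} [CStarAlgebra A] {N : ℕ} (w : Mat A (N + 1))
    (i j : Fin (N + 1)) :
    (w * lastProj A N * star w) i j = w i (Fin.last N) * star (w j (Fin.last N)) := by
  rw [CStarMatrix.mul_apply, Finset.sum_eq_single (Fin.last N)]
  · rw [CStarMatrix.star_apply, CStarMatrix.mul_apply, Finset.sum_eq_single (Fin.last N)]
    · simp [lastProj_apply]
    · intro l _ hl
      simp [lastProj_apply, hl]
    · simp
  · intro l _ hl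
    rw [CStarMatrix.mul_apply, Finset.sum_eq_zero, zero_mul]
    intro p _
    simp [lastProj_apply, hl]
  · simp

theorem lastProj_nonneg (N : ℕ) : 0 ≤ lastProj B N := by
  have h : lastProj B N = lastProj B N * star (lastProj B N) := by
    ext i j
    rw [CStarMatrix.mul_apply, Finset.sum_eq_single (Fin.last N)]
    · rw [CStarMatrix.star_apply]
      simp only [lastProj_apply]
      by_cases h1 : i = Fin.last N <;> by_cases h2 : j = Fin.last N <;> simp [h1, h2]
    · intro l _ hl
      simp [lastProj_apply, hl]
    · simp
  rw [h]
  exact mul_star_self_nonneg _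

/-- The last projection isolates the (0, N) entry of the resolvent, where a path from 0 to N spells
a word. -/
theorem Dilation.Ψ_lastProj {ρ : NCPoly B →ₗ[ℂ] B} (D : Dilation ρ) {N : ℕ} (c : Mat B (N + 1)) :
    D.Ψ (N + 1) c (lastProj B N) 0 0 =
      D.φ ((Ring.inverse (1 - D.ι (N + 1) c * D.x (N + 1)) : Mat D.A (N + 1)) 0 (Fin.last N) *
        star ((Ring.inverse (1 - D.ι (N + 1) c * D.x (N + 1)) : Mat D.A (N + 1))
          0 (Fin.last N))) := by
  have e : D.ι (N + 1) (lastProj B N) = lastProj D.A N := by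
    ext i j
    change D.π (NCPoly.C (lastProj B N i j)) = lastProj D.A N i j
    rw [lastProj_apply, lastProj_apply]
    split_ifs
    · rw [map_one, map_one]
    · rw [map_zero, map_zero]
  rw [Dilation.Ψ, e, Dilation.Φ, matCLM_apply, mul_lastProj_mul_star]

theorem Dilation.ι_pathMat_mul_x {ρ : NCPoly B →ₗ[ℂ] B} (D : Dilation ρ) {N : ℕ} (b : ℕ → B)
    (i j : Fin (N + 1)) : (D.ι (N + 1) (pathMat b N) * D.x (N + 1)) i j =
      D.π (NCPoly.C (pathMat b N i j)) * D.π NCPoly.X := by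
  exact Matrix.mul_diagonal (fun _ => D.π NCPoly.X)
    (CStarMatrix.ofMatrix.symm (D.ι (N + 1) (pathMat b N))) i j

theorem Dilation.pow_ι_pathMat_mul_x {ρ : NCPoly B →ₗ[ℂ] B} (D : Dilation ρ) {N : ℕ} (b : ℕ → B)
    (p : ℕ) :
    (∀ j : Fin (N + 1), p < j → ((D.ι (N + 1) (pathMat b N) * D.x (N + 1)) ^ p) 0 j = 0) ∧
      ∀ j : Fin (N + 1), p = j → ((D.ι (N + 1) (pathMat b N) * D.x (N + 1)) ^ p) 0 j =
        ((List.range p).map fun i => D.π (NCPoly.C (b i)) * D.π NCPoly.X).prod := by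
  refine hessenberg_pow (R := D.A) (N := N) (D.ι (N + 1) (pathMat b N) * D.x (N + 1))
    (fun i => D.π (NCPoly.C (b i)) * D.π NCPoly.X) (fun i j hij => ?_) (fun i j hij => ?_) p
  · refine (D.ι_pathMat_mul_x b i j).trans ?_
    have : pathMat b N i j = 0 := by
      simp only [pathMat, CStarMatrix.ofMatrix_apply, Matrix.of_apply]
      rw [if_neg (by omega), if_neg (by omega)]
    rw [this, map_zero, map_zero, zero_mul]
  · refine (D.ι_pathMat_mul_x b i j).trans ?_
    have : pathMat b N i j = b i := by
      simp only [pathMat, CStarMatrix.ofMatrix_apply, Matrix.of_apply]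
      rw [if_pos hij]
    rw [this]

/-- Expansion of the corner of the resolvent at a path matrix. -/
theorem Dilation.inverse_pathMat {ρ : NCPoly B →ₗ[ℂ] B} (D : Dilation ρ) {N : ℕ} (b : ℕ → B)
    (t : ℝ) (ht : IsUnit (1 - D.ι (N + 1) ((t : ℂ) • pathMat b N) * D.x (N + 1))) :
    (Ring.inverse (1 - D.ι (N + 1) ((t : ℂ) • pathMat b N) * D.x (N + 1)) : Mat D.A (N + 1))
        0 (Fin.last N) =
      ((t ^ N : ℝ) : ℂ) • ((D.ι (N + 1) (pathMat b N) * D.x (N + 1)) ^ N *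
        Ring.inverse (1 - D.ι (N + 1) ((t : ℂ) • pathMat b N) * D.x (N + 1)) : Mat D.A (N + 1))
        0 (Fin.last N) := by
  have hz := fun i => (D.pow_ι_pathMat_mul_x (N := N) b i).1 (Fin.last N)
  set m := D.ι (N + 1) (pathMat b N) * D.x (N + 1) with hm
  have e1 : D.ι (N + 1) ((t : ℂ) • pathMat b N) * D.x (N + 1) = (t : ℂ) • m := by
    rw [map_smul (D.ι (N + 1)), smul_mul_assoc]
  rw [e1] at ht ⊢
  set w := Ring.inverse (1 - (t : ℂ) • m) with hw
  have h1 : (1 - (t : ℂ) • m) * w = 1 := Ring.mul_inverse_cancel _ ht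
  -- Finite Neumann expansion with remainder: N steps are needed to travel from 0 to N, so the
  -- powers below N have zero corner entry and only the remainder t^N m^N w survives.
  have hgeom : ∀ p : ℕ, w = ∑ i ∈ Finset.range p, ((t : ℂ) • m) ^ i + ((t : ℂ) • m) ^ p * w :=
      fun p => by
    induction p with
    | zero => simp
    | succ p ih =>
      rw [Finset.sum_range_succ, pow_succ, mul_assoc]
      have h2 : w = 1 + ((t : ℂ) • m) * w := by
        rw [sub_mul, one_mul] at h1
        rw [← h1, sub_add_cancel]
      nth_rw 1 [ih]
      nth_rw 1 [h2]
      rw [mul_add, mul_one, add_assoc]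
  have hsum : ∀ p ≤ N, (∑ i ∈ Finset.range p, ((t : ℂ) • m) ^ i) 0 (Fin.last N) = 0 := fun p hp => by
    induction p with
    | zero => rfl
    | succ p ih =>
      rw [Finset.sum_range_succ, CStarMatrix.add_apply, ih (by omega), zero_add, smul_pow,
        CStarMatrix.smul_apply, hz p (by simpa using hp), smul_zero]
  have key := congrFun (congrFun (hgeom N) 0) (Fin.last N)
  rw [CStarMatrix.add_apply, hsum N le_rfl, zero_add, smul_pow, smul_mul_assoc,
    CStarMatrix.smul_apply] at key
  rw [key, Complex.ofReal_pow]

theorem continuous_entry {A : Type*} [CStarAlgebra A] {n : ℕ} (i j : Fin n) :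
    Continuous fun a : Mat A n => a i j :=
  (continuous_id.matrix_elem i j).comp
    (CStarMatrix.ofMatrixL (A := A) (m := Fin n) (n := Fin n)).symm.continuous

/-- The corner of the quadratic form at a scaled path matrix, and its limit. -/
theorem Dilation.exists_corner {ρ : NCPoly B →ₗ[ℂ] B} (D : Dilation ρ) (b : ℕ → B) (N : ℕ) :
    ∃ f : ℝ → B, (∀ᶠ t : ℝ in 𝓝[>] 0,
        ‖(t : ℂ) • pathMat b N‖ * ‖D.π NCPoly.X‖ < 1 ∧
        D.Ψ (N + 1) ((t : ℂ) • pathMat b N) (lastProj B N) 0 0 =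
          ((t ^ N * t ^ N : ℝ) : ℂ) • f t) ∧
      Tendsto f (𝓝[>] 0) (𝓝 (ρ (((List.range N).map fun i => NCPoly.C (b i) * NCPoly.X).prod *
        star ((List.range N).map fun i => NCPoly.C (b i) * NCPoly.X).prod))) := by
  set c : ℝ → Mat B (N + 1) := fun t => (t : ℂ) • pathMat b N with hc
  set m := D.ι (N + 1) (pathMat b N) * D.x (N + 1) with hm
  set w : ℝ → Mat D.A (N + 1) := fun t =>
    Ring.inverse (1 - D.ι (N + 1) (c t) * D.x (N + 1)) with hw
  have hc0 : c 0 = 0 := by simp only [hc, Complex.ofReal_zero, zero_smul]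
  have hct : Tendsto c (𝓝[>] 0) (𝓝 0) := by
    have : Continuous c := by fun_prop
    exact hc0 ▸ (this.tendsto 0).mono_left nhdsWithin_le_nhds
  have hsmall : ∀ᶠ t : ℝ in 𝓝[>] 0, ‖c t‖ * ‖D.π NCPoly.X‖ < 1 :=
    (hct.norm.mul_const _).eventually_lt_const (by rw [norm_zero, zero_mul]; exact one_pos)
  have hwt : Tendsto w (𝓝[>] 0) (𝓝 1) := by
    have hι : Tendsto (D.ι (N + 1)) (𝓝 0) (𝓝 (D.ι (N + 1) 0)) :=
      (D.analyticAt_ι 0).continuousAt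
    have h1 : Tendsto (fun t => 1 - D.ι (N + 1) (c t) * D.x (N + 1)) (𝓝[>] 0)
        (𝓝 (1 - D.ι (N + 1) 0 * D.x (N + 1))) :=
      tendsto_const_nhds.sub ((hι.comp hct).mul tendsto_const_nhds)
    rw [map_zero, zero_mul, sub_zero] at h1
    have h2 := NormedRing.inverse_continuousAt (1 : (Mat D.A (N + 1))ˣ)
    rw [ContinuousAt, Units.val_one, Ring.inverse_one] at h2
    exact h2.comp h1
  have hvt : Tendsto (fun t => (m ^ N * w t : Mat D.A (N + 1)) 0 (Fin.last N)) (𝓝[>] 0)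
      (𝓝 (D.π ((List.range N).map fun i => NCPoly.C (b i) * NCPoly.X).prod)) := by
    have h1 : Tendsto (fun t => m ^ N * w t) (𝓝[>] 0) (𝓝 (m ^ N * 1)) :=
      tendsto_const_nhds.mul hwt
    have h2 := ((continuous_entry 0 (Fin.last N)).tendsto _).comp h1
    rw [mul_one, (D.pow_ι_pathMat_mul_x b N).2 (Fin.last N) (Fin.val_last N).symm] at h2
    rw [map_list_prod, List.map_map]
    simpa [Function.comp_def] using h2
  -- The resolvent w t tends to 1, so the rescaled corner tends to that of m ^ N, which is the word
  -- itself.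
  refine ⟨fun t => D.φ ((m ^ N * w t : Mat D.A (N + 1)) 0 (Fin.last N) *
    star ((m ^ N * w t : Mat D.A (N + 1)) 0 (Fin.last N))), ?_, ?_⟩
  · filter_upwards [hsmall] with t ht
    refine ⟨ht, ?_⟩
    rw [D.Ψ_lastProj, D.inverse_pathMat b t (D.isUnit_one_sub ht), star_smul, Complex.star_def,
      Complex.conj_ofReal, smul_mul_smul_comm, map_smul, Complex.ofReal_mul]
  · have := (D.φ.continuous.tendsto _).comp (hvt.mul hvt.star)
    rwa [← StarHomClass.map_star D.π, ← map_mul D.π, D.φ_π] at this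

/-- Comparison of squares of words. -/
theorem map_prod_mul_star_le
    (hG : ∀ (n : ℕ) (b : Mat B n), b ∈ upperHalfPlane B n → im (D.G n b) ≤ im (D'.G n b))
    (b : ℕ → B) (N : ℕ) :
    booleanMap ν (((List.range N).map fun i => NCPoly.C (b i) * NCPoly.X).prod *
        star ((List.range N).map fun i => NCPoly.C (b i) * NCPoly.X).prod) ≤
      booleanMap μ (((List.range N).map fun i => NCPoly.C (b i) * NCPoly.X).prod *
        star ((List.range N).map fun i => NCPoly.C (b i) * NCPoly.X).prod) := by
  obtain ⟨f, hf, hft⟩ := D.exists_corner b N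
  obtain ⟨f', hf', hft'⟩ := D'.exists_corner b N
  refine le_of_tendsto_of_tendsto hft' hft ?_
  filter_upwards [hf, hf', self_mem_nhdsWithin] with t ht ht' ht0
  have hsa : IsSelfAdjoint ((t : ℂ) • pathMat b N) := by
    rw [IsSelfAdjoint, star_smul, (isSelfAdjoint_pathMat b N).star_eq, Complex.star_def,
      Complex.conj_ofReal]
  have hle := Ψ_le D D' (hG (N + 1)) hsa (lastProj_nonneg N) ht.1 ht'.1
  have h00 := diag_nonneg (sub_nonneg.2 hle) 0
  rw [CStarMatrix.sub_apply, sub_nonneg, ht.2, ht'.2] at h00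
  have ht1 : (0 : ℝ) < t := ht0
  -- The common factor t^{2N} > 0 cancels.
  exact (ofReal_smul_le_ofReal_smul (by positivity)).1 h00

end Comparison

/-! ### Compositional roots: mean, variance and norm of X -/

section Iteration

variable {B : Type*} [CStarAlgebra B] [PartialOrder B] [StarOrderedRing B]

/-- Quantitative form of iy G(w) → ρ(1) for w within K of iy: with v = (w - x)⁻¹ one has iy v - 1 =
(x - (w - iy)) v and ‖v‖ ≤ 1/y. -/
theorem Dilation.norm_smul_G_sub_le {ρ : NCPoly B →ₗ[ℂ] B} (D : Dilation ρ) {n : ℕ} {y K : ℝ}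
    (hy : 0 < y) {w : Mat B n} (hw : ImGe y w)
    (hK : ‖w - Complex.I • ((y : ℂ) • (1 : Mat B n))‖ ≤ K) :
    ‖(Complex.I * (y : ℂ)) • D.G n w - diagHom n B (ρ 1)‖ ≤
      6 * ‖ρ 1‖ * ((K + ‖D.π NCPoly.X‖) * y⁻¹) := by
  have hu := isUnit_of_le_im hy (D.imGe_sub_x hw)
  have hinv := norm_inverse_le_of_le_im hy (D.imGe_sub_x hw)
  have h1 := Ring.mul_inverse_cancel _ hu
  rw [Dilation.G]
  set v := Ring.inverse (D.ι n w - D.x n) with hv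
  have e : (Complex.I * (y : ℂ)) • D.Φ n v - diagHom n B (ρ 1) =
      D.Φ n ((D.x n - D.ι n (w - Complex.I • ((y : ℂ) • (1 : Mat B n)))) * v) := by
    have e1 : diagHom n B (ρ 1) = D.Φ n 1 := by rw [Dilation.Φ, matCLM_one, D.φ_one]
    rw [e1, ← map_smul, ← map_sub, ← h1]
    congr 1
    rw [map_sub (D.ι n), map_smul (D.ι n), map_smul (D.ι n), _root_.map_one (D.ι n), smul_smul]
    rw [sub_mul, sub_mul, sub_mul, smul_mul_assoc, one_mul]
    abel
  rw [e]
  refine (D.norm_Φ_le _).trans (mul_le_mul_of_nonneg_left ?_ (by positivity))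
  refine (norm_mul_le _ _).trans (mul_le_mul ?_ hinv (norm_nonneg _) ?_)
  · refine (norm_sub_le _ _).trans ?_
    rw [add_comm]
    exact add_le_add ((D.norm_ι_le _).trans hK) D.norm_x_le
  · linarith [norm_nonneg (D.π NCPoly.X),
      (norm_nonneg (w - Complex.I • ((y : ℂ) • (1 : Mat B n)))).trans hK]

variable {μ ν : NCPoly B →ₗ[ℂ] B} {n : ℕ}

section Single

variable (hν : IsDistribution ν) (D' : Dilation (booleanMap ν))

include hν in
theorem imGe_iterate_nevanlinna {ε : ℝ} (hε : 0 < ε) {b : Mat B n} (h : ImGe ε b) (j : ℕ) :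
    ImGe ε ((nevanlinna D' n)^[j] b) := by
  induction j with
  | zero => exact h
  | succ j ih =>
    rw [Function.iterate_succ_apply']
    exact imGe_nevanlinna hν D' hε ih

theorem iterate_nevanlinna (b : Mat B n) (j : ℕ) :
    (nevanlinna D' n)^[j] b = b - (j : ℂ) • diagHom n B (ν NCPoly.X) -
      ∑ i ∈ Finset.range j, D'.G n ((nevanlinna D' n)^[i] b) := by
  induction j with
  | zero => simp
  | succ j ih =>
    rw [Function.iterate_succ_apply', Finset.sum_range_succ]
    conv_lhs => rw [nevanlinna]
    rw [Nat.cast_succ, add_smul, one_smul]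
    generalize D'.G n ((nevanlinna D' n)^[j] b) = g at *
    rw [ih]
    abel

include hν in
theorem norm_sum_G_iterate_le {ε : ℝ} (hε : 0 < ε) {b : Mat B n} (h : ImGe ε b) (j : ℕ) :
    ‖∑ i ∈ Finset.range j, D'.G n ((nevanlinna D' n)^[i] b)‖ ≤
      j * (6 * ‖booleanMap ν 1‖ * ε⁻¹) := by
  refine (norm_sum_le_of_le (Finset.range j) fun i _ =>
    D'.norm_G_le hε (imGe_iterate_nevanlinna hν D' hε h i)).trans (le_of_eq ?_)
  rw [Finset.sum_const, Finset.card_range, nsmul_eq_mul]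

include hν in
-- Each application of F_ν adds -Im G ≥ 0 to the imaginary part.
theorem im_iterate_nevanlinna_ge {ε : ℝ} (hε : 0 < ε) {b : Mat B n} (h : ImGe ε b) (j : ℕ) :
    im (nevanlinna D' n b) ≤ im ((nevanlinna D' n)^[j + 1] b) := by
  induction j with
  | zero => exact le_rfl
  | succ j ih =>
    refine ih.trans ?_
    rw [Function.iterate_succ_apply' _ (j + 1), im_nevanlinna hν D', le_sub_self_iff]
    exact D'.im_G_nonpos hε (imGe_iterate_nevanlinna hν D' hε h (j + 1))

end Single

variable (hμ : IsDistribution μ) (hν : IsDistribution ν)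
  (D : Dilation (booleanMap μ)) (D' : Dilation (booleanMap ν)) {k : ℕ}

include hμ hν in
theorem IsMonotonePower.nevanlinna_eq (h : IsMonotonePower ν k μ) (E : Dilation μ)
    (E' : Dilation ν) {ε : ℝ} (hε : 0 < ε) {b : Mat B n} (hb : ImGe ε b) :
    nevanlinna D n b = (nevanlinna D' n)^[k] b := by
  have hm := mem_upperHalfPlane_iff.2 ⟨ε, hε, hb⟩
  rw [← fTransform_eq hμ D E hm, h n b hm]
  suffices ∀ j, (fTransform ν n)^[j] b = (nevanlinna D' n)^[j] b from this k
  intro j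
  induction j with
  | zero => rfl
  | succ j ih =>
    rw [Function.iterate_succ_apply', Function.iterate_succ_apply', ih]
    exact fTransform_eq hν D' E' (mem_upperHalfPlane_iff.2
      ⟨ε, hε, imGe_iterate_nevanlinna hν D' hε hb j⟩)

/-- The `F`-transform of `μ` is the `k`-th iterate of that of `ν`, on matrices over `B`. -/
def IsIterate (k : ℕ) : Prop :=
  ∀ (n : ℕ) (ε : ℝ), 0 < ε → ∀ b : Mat B n, ImGe ε b →
    nevanlinna D n b = (nevanlinna D' n)^[k] b

variable {D D'} (h : IsIterate D D' k)

include h in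
theorem IsIterate.sub_eq {ε : ℝ} (hε : 0 < ε) {b : Mat B n} (hb : ImGe ε b) :
    diagHom n B (μ NCPoly.X) - (k : ℂ) • diagHom n B (ν NCPoly.X) =
      ∑ i ∈ Finset.range k, D'.G n ((nevanlinna D' n)^[i] b) - D.G n b := by
  have e := h n ε hε b hb
  rw [iterate_nevanlinna, nevanlinna] at e
  have e2 := congrArg (fun z => b - z) e
  simp only [sub_sub, sub_sub_cancel] at e2
  rw [sub_eq_sub_iff_add_eq_add, e2, add_comm]

theorem eq_of_norm_sub_le_div {E : Type*} [NormedAddCommGroup E] {a b : E} {C : ℝ}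
    (h : ∀ y : ℝ, 1 ≤ y → ‖a - b‖ ≤ C * y⁻¹) : a = b := by
  rw [← sub_eq_zero, ← norm_le_zero_iff]
  have h1 : Tendsto (fun y : ℝ => C * y⁻¹) atTop (𝓝 0) := by
    simpa using tendsto_inv_atTop_zero.const_mul C
  refine ge_of_tendsto h1 ?_
  filter_upwards [eventually_ge_atTop 1] with y hy using h y hy

include hμ hν h in
-- At b = iy every Cauchy transform in `IsIterate.sub_eq` is O(1/y), whereas the left side is
-- constant.
theorem IsIterate.mean_eq : μ NCPoly.X = (k : ℂ) • ν NCPoly.X := by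
  have key : diagHom 1 B (μ NCPoly.X) = (k : ℂ) • diagHom 1 B (ν NCPoly.X) := by
    refine eq_of_norm_sub_le_div
      (C := k * (6 * ‖booleanMap ν 1‖) + 6 * ‖booleanMap μ 1‖) fun y hy => ?_
    have hy0 : 0 < y := one_pos.trans_le hy
    rw [h.sub_eq hy0 (imGe_I_smul (A := Mat B 1) y)]
    refine (norm_sub_le _ _).trans ((add_le_add
      (norm_sum_G_iterate_le hν D' hy0 (imGe_I_smul y) k)
      (D.norm_G_le hy0 (imGe_I_smul y))).trans (le_of_eq ?_))
    ring
  exact congrFun (congrFun key 0) 0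

include hμ hν h in
-- Once the means cancel, G_{ρ_μ}(iy) is the sum of the G_{ρ_ν} along the orbit of iy. Multiply by
-- iy and let y → ∞.
theorem IsIterate.variance_eq : booleanMap μ 1 = (k : ℂ) • booleanMap ν 1 := by
  have key : diagHom 1 B (booleanMap μ 1) = (k : ℂ) • diagHom 1 B (booleanMap ν 1) := by
    -- A bound, uniform in y ≥ 1, for the drift of the first k orbit points away from iy.
    set K : ℝ := k * ‖diagHom 1 B (ν NCPoly.X)‖ + k * (6 * ‖booleanMap ν 1‖) with hK
    have hK0 : 0 ≤ K := by positivity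
    refine eq_of_norm_sub_le_div (C := 6 * ‖booleanMap μ 1‖ * (K + ‖D.π NCPoly.X‖) +
      k * (6 * ‖booleanMap ν 1‖ * (K + ‖D'.π NCPoly.X‖))) fun y hy => ?_
    have hy0 : 0 < y := one_pos.trans_le hy
    set b : Mat B 1 := Complex.I • ((y : ℂ) • (1 : Mat B 1)) with hb
    have hbge : ImGe y b := imGe_I_smul y
    have hw : ∀ j ∈ Finset.range k, ‖(nevanlinna D' 1)^[j] b - b‖ ≤ K := fun j hj => by
      have hjk : (j : ℝ) ≤ k := by exact_mod_cast (Finset.mem_range.1 hj).le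
      have e : (nevanlinna D' 1)^[j] b - b = -((j : ℂ) • diagHom 1 B (ν NCPoly.X) +
          ∑ i ∈ Finset.range j, D'.G 1 ((nevanlinna D' 1)^[i] b)) := by
        rw [iterate_nevanlinna]; abel
      rw [e, norm_neg]
      refine (norm_add_le _ _).trans (add_le_add ?_ ?_)
      · rw [norm_smul, Complex.norm_natCast]
        exact mul_le_mul_of_nonneg_right hjk (norm_nonneg _)
      · refine (norm_sum_G_iterate_le hν D' hy0 hbge j).trans
          (mul_le_mul hjk ?_ (by positivity) (by positivity))
        exact mul_le_of_le_one_right (by positivity) (inv_le_one_of_one_le₀ hy)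
    have hG : D.G 1 b = ∑ i ∈ Finset.range k, D'.G 1 ((nevanlinna D' 1)^[i] b) := by
      have e1 : diagHom 1 B (μ NCPoly.X) - (k : ℂ) • diagHom 1 B (ν NCPoly.X) = 0 := by
        rw [h.mean_eq hμ hν, map_smul (diagHom 1 B), sub_self]
      exact (sub_eq_zero.1 ((h.sub_eq hy0 hbge).symm.trans e1)).symm
    have e2 : diagHom 1 B (booleanMap μ 1) - (k : ℂ) • diagHom 1 B (booleanMap ν 1) =
        -((Complex.I * (y : ℂ)) • D.G 1 b - diagHom 1 B (booleanMap μ 1)) +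
        ∑ i ∈ Finset.range k, ((Complex.I * (y : ℂ)) • D'.G 1 ((nevanlinna D' 1)^[i] b) -
          diagHom 1 B (booleanMap ν 1)) := by
      rw [Finset.sum_sub_distrib, ← Finset.smul_sum, ← hG, Finset.sum_const, Finset.card_range,
        ← Nat.cast_smul_eq_nsmul ℂ]
      abel
    rw [e2, add_mul, mul_assoc (6 * ‖booleanMap μ 1‖), mul_assoc (k : ℝ),
      mul_assoc (6 * ‖booleanMap ν 1‖)]
    refine (norm_add_le _ _).trans (add_le_add ?_ ?_)
    · rw [norm_neg]
      exact D.norm_smul_G_sub_le hy0 hbge (by rw [← hb, sub_self, norm_zero]; exact hK0)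
    · refine (norm_sum_le_of_le _ fun j hj => D'.norm_smul_G_sub_le hy0
        (imGe_iterate_nevanlinna hν D' hy0 hbge j) (hw j hj)).trans (le_of_eq ?_)
      rw [Finset.sum_const, Finset.card_range, nsmul_eq_mul]
  exact congrFun (congrFun key 0) 0

include hμ hν h in
theorem IsIterate.im_G_le (hk : 1 ≤ k) {b : Mat B n} (hb : b ∈ upperHalfPlane B n) :
    im (D.G n b) ≤ im (D'.G n b) := by
  obtain ⟨ε, hε, hb⟩ := mem_upperHalfPlane_iff.1 hb
  obtain ⟨j, rfl⟩ : ∃ j, k = j + 1 := ⟨k - 1, by omega⟩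
  have := im_iterate_nevanlinna_ge hν D' hε hb j
  rwa [← h n ε hε b hb, im_nevanlinna hμ D, im_nevanlinna hν D', sub_le_sub_iff_left] at this

/-- The path-matrix comparison only reaches products of factors `C c * X`. A monomial takes that
form once it is followed by an X, which is why the growth condition starts at p = 1. -/
theorem NCPoly.word_mul_X_pow_succ (b : B) (l : List B) (p : ℕ) :
    NCPoly.word b l * NCPoly.X ^ (p + 1) =
      ((b :: l ++ List.replicate p 1).map fun c => NCPoly.C c * NCPoly.X).prod := by
  have h : NCPoly.word b l * NCPoly.X =
      ((b :: l).map fun c => NCPoly.C c * NCPoly.X).prod := by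
    rw [NCPoly.word]
    induction l generalizing b with
    | nil => simp
    | cons c l ih =>
      rw [List.map_cons, List.prod_cons, List.map_cons, List.prod_cons, ← ih c]
      simp only [mul_assoc]
  rw [List.map_append, List.prod_append, ← h, List.map_replicate, List.prod_replicate,
    _root_.map_one, one_mul, pow_succ', mul_assoc]

theorem list_map_prod_eq_range {R : Type*} [Monoid R] {α : Type*} (f : α → R) (d : α) (L : List α) :
    (L.map f).prod = ((List.range L.length).map fun i => f (L.getD i d)).prod := by
  congr 1
  refine List.ext_getElem (by simp) fun i h1 h2 => ?_
  have h3 : i < L.length := by simpa using h1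
  simp [h3]

include hμ hν h in
-- For a monomial w and p ≥ 1, ρ_ν(w X^{2p} w*) ≤ ρ_μ(w X^{2p} w*) ≤ M^{2p} ρ_μ(w w*). The
-- word-dependent constant is harmless in `isOpBound_X_of_growth`, so ρ_ν inherits the bound M
-- whatever k is.
theorem IsIterate.isOpBound_booleanMap (hk : 1 ≤ k) {M : ℝ} (hM : 0 < M)
    (hX : IsOpBound μ NCPoly.X M) : IsOpBound (booleanMap ν) NCPoly.X M := by
  have hX := hμ.isOpBound_booleanMap hX
  have hXp : ∀ p, IsOpBound (booleanMap μ) (NCPoly.X ^ p) (M ^ p) := fun p => by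
    induction p with
    | zero => rw [pow_zero, pow_zero]; exact IsOpBound.one
    | succ p ih => rw [pow_succ, pow_succ]; exact ih.mul hX
  refine isOpBound_X_of_growth hν.isCP_booleanMap.pos hM fun b l => ?_
  refine ⟨‖booleanMap μ (NCPoly.word b l * star (NCPoly.word b l))‖, fun p hp => ?_⟩
  obtain ⟨j, rfl⟩ : ∃ j, p = j + 1 := ⟨p - 1, by omega⟩
  have hle : booleanMap ν (NCPoly.word b l * NCPoly.X ^ (j + 1) *
        star (NCPoly.word b l * NCPoly.X ^ (j + 1))) ≤
      booleanMap μ (NCPoly.word b l * NCPoly.X ^ (j + 1) *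
        star (NCPoly.word b l * NCPoly.X ^ (j + 1))) := by
    rw [NCPoly.word_mul_X_pow_succ, list_map_prod_eq_range _ 0]
    exact map_prod_mul_star_le D D' (fun _ _ hb => h.im_G_le hμ hν hk hb) _ _
  have hle2 := (hXp (j + 1)).2 (NCPoly.word b l)
  have e : NCPoly.word b l * (NCPoly.X ^ (j + 1) * star (NCPoly.X ^ (j + 1))) *
      star (NCPoly.word b l) = NCPoly.word b l * NCPoly.X ^ (j + 1) *
        star (NCPoly.word b l * NCPoly.X ^ (j + 1)) := by
    rw [star_mul]; simp only [mul_assoc]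
  rw [e] at hle2
  refine (CStarAlgebra.norm_le_norm_of_nonneg_of_le (hν.isCP_booleanMap.pos _)
    (hle.trans hle2)).trans (le_of_eq ?_)
  rw [norm_smul, Real.norm_of_nonneg (by positivity), mul_comm, ← pow_mul, ← pow_mul,
    mul_comm 2]

end Iteration

/-! ### Stability properties of analytic noncommutative functions -/

section NCFunctions

variable {B : Type*} [CStarAlgebra B] [PartialOrder B] [StarOrderedRing B]
variable {A : Type*} [CStarAlgebra A] [PartialOrder A] [StarOrderedRing A]

theorem directSum_apply {n p : ℕ} (a : Mat A n) (b : Mat A p) (i j : Fin n ⊕ Fin p) :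
    directSum a b (finSumFinEquiv i) (finSumFinEquiv j) =
      Matrix.fromBlocks (CStarMatrix.ofMatrix.symm a) 0 0 (CStarMatrix.ofMatrix.symm b) i j := by
  change Matrix.fromBlocks (CStarMatrix.ofMatrix.symm a) 0 0 (CStarMatrix.ofMatrix.symm b)
    (finSumFinEquiv.symm (finSumFinEquiv i)) (finSumFinEquiv.symm (finSumFinEquiv j)) = _
  rw [Equiv.symm_apply_apply, Equiv.symm_apply_apply]

theorem Mat.ext_sum {n p : ℕ} {a b : Mat A (n + p)}
    (h : ∀ i j : Fin n ⊕ Fin p, a (finSumFinEquiv i) (finSumFinEquiv j) =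
      b (finSumFinEquiv i) (finSumFinEquiv j)) : a = b := by
  ext i j
  obtain ⟨i, rfl⟩ := finSumFinEquiv.surjective i
  obtain ⟨j, rfl⟩ := finSumFinEquiv.surjective j
  exact h i j

theorem directSum_sub {n p : ℕ} (a a' : Mat A n) (b b' : Mat A p) :
    directSum a b - directSum a' b' = directSum (a - a') (b - b') := by
  refine Mat.ext_sum fun i j => ?_
  rw [CStarMatrix.sub_apply]
  simp only [directSum_apply]
  rcases i with i | i <;> rcases j with j | j
  · rfl
  · exact sub_zero _
  · exact sub_zero _
  · rfl

theorem directSum_mul {n p : ℕ} (a a' : Mat A n) (b b' : Mat A p) :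
    directSum a b * directSum a' b' = directSum (a * a') (b * b') := by
  refine Mat.ext_sum fun i j => ?_
  rw [CStarMatrix.mul_apply, ← finSumFinEquiv.sum_comp]
  simp only [directSum_apply]
  have := congrFun (congrFun (Matrix.fromBlocks_multiply (CStarMatrix.ofMatrix.symm a) 0 0
    (CStarMatrix.ofMatrix.symm b) (CStarMatrix.ofMatrix.symm a') 0 0
    (CStarMatrix.ofMatrix.symm b')) i) j
  simp only [Matrix.mul_zero, Matrix.zero_mul, add_zero, zero_add] at this
  exact this

theorem diagHom_directSum (n p : ℕ) (a : A) :
    diagHom (n + p) A a = directSum (diagHom n A a) (diagHom p A a) := by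
  refine Mat.ext_sum fun i j => ?_
  rw [directSum_apply]
  change Matrix.diagonal (fun _ => a) (finSumFinEquiv i) (finSumFinEquiv j) = Matrix.fromBlocks
    (Matrix.diagonal fun _ => a) 0 0 (Matrix.diagonal fun _ => a) i j
  rw [Matrix.fromBlocks_diagonal, Matrix.diagonal_apply, Matrix.diagonal_apply]
  simp only [EmbeddingLike.apply_eq_iff_eq]
  congr 1
  rcases i with i | i <;> rfl

theorem directSum_map {n p : ℕ} (a : Mat B n) (b : Mat B p) (f : B → A) (hf : f 0 = 0)
    (i j : Fin (n + p)) :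
    f (directSum a b i j) = directSum (CStarMatrix.ofMatrix ((CStarMatrix.ofMatrix.symm a).map f))
      (CStarMatrix.ofMatrix ((CStarMatrix.ofMatrix.symm b).map f)) i j := by
  obtain ⟨i, rfl⟩ := finSumFinEquiv.surjective i
  obtain ⟨j, rfl⟩ := finSumFinEquiv.surjective j
  rw [directSum_apply, directSum_apply]
  rcases i with i | i <;> rcases j with j | j
  · rfl
  · exact hf
  · exact hf
  · rfl

theorem matMap_directSum {n p : ℕ} (f : B →⋆ₐ[ℂ] A) (a : Mat B n) (b : Mat B p) :
    matMap (n + p) f (directSum a b) = directSum (matMap n f a) (matMap p f b) := by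
  ext i j
  exact directSum_map a b f (map_zero f) i j

theorem matCLM_directSum {n p : ℕ} (φ : A →L[ℂ] B) (a : Mat A n) (b : Mat A p) :
    matCLM (n + p) φ (directSum a b) = directSum (matCLM n φ a) (matCLM p φ b) := by
  ext i j
  exact directSum_map a b φ (map_zero φ) i j

theorem directSum_one (n p : ℕ) : directSum (1 : Mat A n) (1 : Mat A p) = 1 := by
  rw [← _root_.map_one (diagHom n A), ← _root_.map_one (diagHom p A), ← diagHom_directSum,
    _root_.map_one]

theorem inverse_directSum {n p : ℕ} {a : Mat A n} {b : Mat A p} (ha : IsUnit a) (hb : IsUnit b) :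
    Ring.inverse (directSum a b) = directSum (Ring.inverse a) (Ring.inverse b) := by
  refine ringInverse_eq ?_ ?_
  · rw [directSum_mul, Ring.mul_inverse_cancel _ ha, Ring.mul_inverse_cancel _ hb, directSum_one]
  · rw [directSum_mul, Ring.inverse_mul_cancel _ ha, Ring.inverse_mul_cancel _ hb, directSum_one]

theorem scalarMat_mul {n : ℕ} (S T : Matrix (Fin n) (Fin n) ℂ) :
    scalarMat A S * scalarMat A T = scalarMat A (S * T) :=
  (Matrix.map_mul (f := algebraMap ℂ A) (L := S) (M := T)).symm

theorem scalarMat_one (n : ℕ) : scalarMat A (1 : Matrix (Fin n) (Fin n) ℂ) = 1 :=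
  Matrix.map_one (algebraMap ℂ A) (map_zero _) (_root_.map_one _)

theorem matMap_scalarMat {n : ℕ} (f : B →⋆ₐ[ℂ] A) (S : Matrix (Fin n) (Fin n) ℂ) :
    matMap n f (scalarMat B S) = scalarMat A S := by
  ext i j
  exact AlgHomClass.commutes f (S i j)

theorem diagHom_mul_scalarMat {n : ℕ} (a : A) (S : Matrix (Fin n) (Fin n) ℂ) :
    scalarMat A S * diagHom n A a = diagHom n A a * scalarMat A S := by
  ext i j
  refine (Matrix.mul_diagonal (fun _ => a) (S.map (algebraMap ℂ A)) i j).trans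
    (Eq.trans ?_ (Matrix.diagonal_mul (fun _ => a) (S.map (algebraMap ℂ A)) i j).symm)
  exact Algebra.commutes (S i j) a

/-- Entrywise maps commute with similarities because these have complex entries; ℂ-linearity
suffices. -/
theorem matCLM_scalarMat {n : ℕ} (φ : A →L[ℂ] B) (S T : Matrix (Fin n) (Fin n) ℂ) (a : Mat A n) :
    matCLM n φ (scalarMat A S * a * scalarMat A T) =
      scalarMat B S * matCLM n φ a * scalarMat B T := by
  ext i j
  have hr : ∀ (z : ℂ) (x : A), φ (x * algebraMap ℂ A z) = φ x * algebraMap ℂ B z := fun z x => by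
    rw [← Algebra.commutes, ← Algebra.commutes, ← Algebra.smul_def, ← Algebra.smul_def, map_smul]
  have hl : ∀ (z : ℂ) (x : A), φ (algebraMap ℂ A z * x) = algebraMap ℂ B z * φ x := fun z x => by
    rw [← Algebra.smul_def, ← Algebra.smul_def, map_smul]
  rw [matCLM_apply, CStarMatrix.mul_apply, CStarMatrix.mul_apply, map_sum]
  refine Finset.sum_congr rfl fun l _ => ?_
  rw [CStarMatrix.mul_apply, CStarMatrix.mul_apply]
  refine (hr (T l j) _).trans (congrArg (· * algebraMap ℂ B (T l j)) ?_)
  rw [map_sum]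
  exact Finset.sum_congr rfl fun p _ => hl (S i p) _

/-- Analytic noncommutative functions on matrices over `B` with values in matrices over `A`. -/
structure IsNCMap (Ω : ∀ n, Set (Mat B n)) (f : ∀ n, Mat B n → Mat A n) : Prop where
  analytic : ∀ n, AnalyticOnNhd ℂ (f n) (Ω n)
  map_directSum : ∀ (n p : ℕ), ∀ a ∈ Ω n, ∀ b ∈ Ω p,
    f (n + p) (directSum a b) = directSum (f n a) (f p b)
  map_similar : ∀ (n : ℕ) (S T : Matrix (Fin n) (Fin n) ℂ), S * T = 1 → T * S = 1 → ∀ a ∈ Ω n,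
    f n (scalarMat B S * a * scalarMat B T) = scalarMat A S * f n a * scalarMat A T

namespace IsNCMap

variable {Ω : ∀ n, Set (Mat B n)} {f g : ∀ n, Mat B n → Mat A n}

theorem isAnalyticNC {f : ∀ n, Mat B n → Mat B n} (hf : IsNCMap Ω f) : IsAnalyticNC Ω f :=
  ⟨hf.analytic, hf.map_directSum, fun n S T h1 h2 a ha _ => hf.map_similar n S T h1 h2 a ha⟩

theorem id : IsNCMap Ω fun n (b : Mat B n) => b :=
  ⟨fun _ _ _ => analyticAt_id, fun _ _ _ _ _ _ => rfl, fun _ _ _ _ _ _ _ => rfl⟩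

theorem const (a : A) : IsNCMap Ω fun n _ => diagHom n A a := by
  refine ⟨fun _ _ _ => analyticAt_const, fun n p _ _ _ _ => diagHom_directSum n p a,
    fun n S T h _ _ _ => ?_⟩
  rw [diagHom_mul_scalarMat, mul_assoc, scalarMat_mul, h, scalarMat_one, mul_one]

theorem one : IsNCMap Ω fun n (_ : Mat B n) => (1 : Mat A n) := by
  simpa only [_root_.map_one] using const (Ω := Ω) (1 : A)

theorem sub (hf : IsNCMap Ω f) (hg : IsNCMap Ω g) : IsNCMap Ω fun n b => f n b - g n b := by
  refine ⟨fun n b hb => (hf.analytic n b hb).sub (hg.analytic n b hb), fun n p a ha b hb => ?_,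
    fun n S T h1 h2 a ha => ?_⟩
  · rw [hf.map_directSum n p a ha b hb, hg.map_directSum n p a ha b hb, directSum_sub]
  · rw [hf.map_similar n S T h1 h2 a ha, hg.map_similar n S T h1 h2 a ha, mul_sub, sub_mul]

theorem mul (hf : IsNCMap Ω f) (hg : IsNCMap Ω g) : IsNCMap Ω fun n b => f n b * g n b := by
  refine ⟨fun n b hb => (hf.analytic n b hb).mul (hg.analytic n b hb), fun n p a ha b hb => ?_,
    fun n S T h1 h2 a ha => ?_⟩
  · rw [hf.map_directSum n p a ha b hb, hg.map_directSum n p a ha b hb, directSum_mul]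
  · rw [hf.map_similar n S T h1 h2 a ha, hg.map_similar n S T h1 h2 a ha]
    have h : scalarMat A T * scalarMat A S = 1 := by rw [scalarMat_mul, h2, scalarMat_one]
    calc _ = scalarMat A S * f n a * (scalarMat A T * scalarMat A S) * g n a * scalarMat A T := by
          simp only [mul_assoc]
      _ = _ := by rw [h, mul_one]; simp only [mul_assoc]

/-- Conjugation preserves invertibility, so the similar point need not lie in Ω. -/
theorem inverse (hf : IsNCMap Ω f) (hu : ∀ n, ∀ b ∈ Ω n, IsUnit (f n b)) :
    IsNCMap Ω fun n b => Ring.inverse (f n b) := by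
  refine ⟨fun n b hb => ?_, fun n p a ha b hb => ?_, fun n S T h1 h2 a ha => ?_⟩
  · obtain ⟨u, hu⟩ := hu n b hb
    have h2 : AnalyticAt ℂ Ring.inverse (f n b) := by
      rw [← hu]; exact analyticAt_inverse u
    exact h2.comp_of_eq (hf.analytic n b hb) rfl
  · rw [hf.map_directSum n p a ha b hb, inverse_directSum (hu n a ha) (hu p b hb)]
  · have hs : scalarMat A S * scalarMat A T = 1 := by rw [scalarMat_mul, h1, scalarMat_one]
    have ht : scalarMat A T * scalarMat A S = 1 := by rw [scalarMat_mul, h2, scalarMat_one]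
    have e : ∀ u v : Mat A n, u * v = 1 →
        scalarMat A S * u * scalarMat A T * (scalarMat A S * v * scalarMat A T) = 1 :=
      fun u v h => by
        calc _ = scalarMat A S * u * (scalarMat A T * scalarMat A S) * v * scalarMat A T := by
              simp only [mul_assoc]
          _ = 1 := by rw [ht, mul_one, mul_assoc (scalarMat A S), h, mul_one, hs]
    rw [hf.map_similar n S T h1 h2 a ha]
    exact ringInverse_eq (e _ _ (Ring.mul_inverse_cancel _ (hu n a ha)))
      (e _ _ (Ring.inverse_mul_cancel _ (hu n a ha)))

theorem matCLM {φ : A →L[ℂ] B} (hf : IsNCMap Ω f) : IsNCMap Ω fun n b => matCLM n φ (f n b) := by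
  refine ⟨fun n b hb => ((OpVal.matCLM n φ).analyticAt _).comp (hf.analytic n b hb),
    fun n p a ha b hb => ?_, fun n S T h1 h2 a ha => ?_⟩
  · rw [hf.map_directSum n p a ha b hb, matCLM_directSum]
  · rw [hf.map_similar n S T h1 h2 a ha, matCLM_scalarMat]

theorem ι {ρ : NCPoly B →ₗ[ℂ] B} (D : Dilation ρ) : IsNCMap Ω fun n b => D.ι n b := by
  refine ⟨fun n b _ => D.analyticAt_ι b, fun n p a _ b _ => matMap_directSum _ a b,
    fun n S T _ _ a _ => ?_⟩
  have h := matMap_scalarMat (n := n) (D.π.comp NCPoly.starC)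
  rw [map_mul (D.ι n), map_mul (D.ι n), Dilation.ι, h, h]

theorem S {ρ : NCPoly B →ₗ[ℂ] B} (D : Dilation ρ)
    (h : ∀ n, ∀ b ∈ Ω n, ‖b‖ * ‖D.π NCPoly.X‖ < 1) : IsNCMap Ω fun n b => D.S n b :=
  (((one.sub ((ι D).mul (const (D.π NCPoly.X)))).inverse
    fun n b hb => D.isUnit_one_sub (h n b hb)).mul (ι D)).matCLM

end IsNCMap

end NCFunctions

/-! ### Extensions to the ball and quantitative bounds -/

section Extension

variable {B : Type*} [CStarAlgebra B] [PartialOrder B] [StarOrderedRing B]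
variable {μ ν : NCPoly B →ₗ[ℂ] B} {k : ℕ} {R : ℝ}

theorem IsExpBounded.mono {M : ℝ} (h : IsExpBounded μ M) (hR : |M| ≤ R) : IsExpBounded μ R := by
  refine fun n b => (h n b).trans (mul_le_mul_of_nonneg_right ?_
    (Finset.prod_nonneg fun i _ => norm_nonneg _))
  exact (le_abs_self _).trans ((abs_pow M n).trans_le (pow_le_pow_left₀ (abs_nonneg M) hR n))

/-- A monotone root has a dilation with the bound of `μ`, and small mean and variance. -/
theorem IsMonotonePower.exists_dilation (hμ : IsDistribution μ) (hν : IsDistribution ν)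
    (h : IsMonotonePower ν k μ) (hk : 1 ≤ k) (hR : 0 < R) (hμR : IsExpBounded μ R) :
    ∃ D : Dilation (booleanMap ν), ‖D.π NCPoly.X‖ ≤ R ∧ ‖ν NCPoly.X‖ ≤ R / k ∧
      ‖booleanMap ν 1‖ ≤ R ^ 2 / k ∧
      ∀ n, ∀ b ∈ upperHalfPlane B n, fTransform ν n b = nevanlinna D n b ∧
        cauchyTransform ν n b = Ring.inverse (nevanlinna D n b) := by
  have hX := hμR.isOpBound_X hR hμ.isCP.pos
  obtain ⟨E, -⟩ := exists_dilation_of_isOpBound hμ.isCP hX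
  obtain ⟨D, -⟩ := exists_dilation_of_isOpBound hμ.isCP_booleanMap (hμ.isOpBound_booleanMap hX)
  obtain ⟨C, hC⟩ := hν.expBounded
  have hνX := (hC.mono (lt_add_one |C|).le).isOpBound_X (by positivity) hν.isCP.pos
  obtain ⟨E', -⟩ := exists_dilation_of_isOpBound hν.isCP hνX
  -- Bootstrapping: `D₀` exists only through the exponential bound of ν, which is not uniform in k.
  -- It serves to set up the iteration, from which `D'` with the bound R is obtained.
  obtain ⟨D₀, -⟩ := exists_dilation_of_isOpBound hν.isCP_booleanMap (hν.isOpBound_booleanMap hνX)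
  have hit : IsIterate D D₀ k := fun n ε hε b hb => h.nevanlinna_eq hμ hν D D₀ E E' hε hb
  obtain ⟨D', hD'⟩ := exists_dilation_of_isOpBound hν.isCP_booleanMap
    (hit.isOpBound_booleanMap hμ hν hk hR hX)
  have hk0 : (0 : ℝ) < k := by exact_mod_cast hk
  refine ⟨D', hD', ?_, ?_, fun n b hb => ⟨fTransform_eq hν D' E' hb, cauchyTransform_eq hν D' E' hb⟩⟩
  · rw [le_div_iff₀ hk0, mul_comm, ← Complex.norm_natCast, ← norm_smul, ← hit.mean_eq hμ hν]
    exact hμ.norm_mean_le hX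
  · rw [le_div_iff₀ hk0, mul_comm, ← Complex.norm_natCast, ← norm_smul, ← hit.variance_eq hμ hν]
    exact hμ.norm_booleanMap_one_le hX

theorem norm_nevanlinna_sub_le (D : Dilation (booleanMap ν)) {n : ℕ} {ε : ℝ} (hε : 0 < ε)
    {b : Mat B n} (hb : ImGe ε b) :
    ‖nevanlinna D n b - b‖ ≤ ‖ν NCPoly.X‖ + 6 * ‖booleanMap ν 1‖ * ε⁻¹ := by
  have e : nevanlinna D n b - b = -(diagHom n B (ν NCPoly.X) + D.G n b) := by
    rw [nevanlinna]; abel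
  rw [e, norm_neg]
  exact (norm_add_le _ _).trans (add_le_add (norm_diagHom_le n _) (D.norm_G_le hε hb))

/-- The extension of `b ↦ F(b⁻¹) - b⁻¹` to a ball. -/
def fExtension (D : Dilation (booleanMap ν)) (n : ℕ) (b : Mat B n) : Mat B n :=
  diagHom n B (-ν NCPoly.X) - D.S n b

/-- The extension of `b ↦ F(b⁻¹)⁻¹` to a ball. -/
def hExtension (D : Dilation (booleanMap ν)) (n : ℕ) (b : Mat B n) : Mat B n :=
  Ring.inverse (1 - b * -fExtension D n b) * b

section Bounds

variable (D : Dilation (booleanMap ν)) (hD : ‖D.π NCPoly.X‖ ≤ R) (hR : 0 < R)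
  (h1 : ‖ν NCPoly.X‖ ≤ R / k) (h2 : ‖booleanMap ν 1‖ ≤ R ^ 2 / k) (hk : 1 ≤ k)

include hD hR in
theorem norm_mul_le_of_mem_ncBall {n : ℕ} {b : Mat B n} (hb : b ∈ ncBall B (16 * R)⁻¹ n) :
    ‖b‖ * ‖D.π NCPoly.X‖ ≤ 1 / 16 := by
  have hb' : ‖b‖ ≤ (16 * R)⁻¹ := (mem_ball_zero_iff.1 hb).le
  calc ‖b‖ * ‖D.π NCPoly.X‖ ≤ (16 * R)⁻¹ * R :=
        mul_le_mul hb' hD (norm_nonneg _) (by positivity)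
    _ = 1 / 16 := by field_simp

include hD hR h1 h2 in
-- The mean contributes R/k, and the Neumann sum 12 (R²/k) / (16R) = (3/4) R/k.
theorem norm_fExtension_le {n : ℕ} {b : Mat B n} (hb : b ∈ ncBall B (16 * R)⁻¹ n) :
    ‖fExtension D n b‖ ≤ 2 * R / k := by
  have hb' : ‖b‖ ≤ (16 * R)⁻¹ := (mem_ball_zero_iff.1 hb).le
  have h3 := D.norm_S_le ((norm_mul_le_of_mem_ncBall D hD hR hb).trans (by norm_num))
  have h4 : 12 * ‖booleanMap ν 1‖ * ‖b‖ ≤ 12 * (R ^ 2 / k) * (16 * R)⁻¹ :=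
    mul_le_mul (by linarith) hb' (norm_nonneg _) (by positivity)
  have h5 : ‖diagHom n B (-ν NCPoly.X)‖ ≤ R / k :=
    (norm_diagHom_le n _).trans (by rwa [norm_neg])
  have h6 : 12 * (R ^ 2 / k) * (16 * R)⁻¹ = 3 / 4 * (R / k) := by
    field_simp; norm_num
  have h7 : 0 ≤ R / k := by positivity
  refine (norm_sub_le _ _).trans ?_
  rw [mul_div_assoc]
  linarith

include hD hR h1 h2 hk in
theorem norm_mul_fExtension_le {n : ℕ} {b : Mat B n} (hb : b ∈ ncBall B (16 * R)⁻¹ n) :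
    ‖b * -fExtension D n b‖ ≤ 1 / (8 * k) ∧ ‖b * -fExtension D n b‖ ≤ 1 / 2 := by
  have hb' : ‖b‖ ≤ (16 * R)⁻¹ := (mem_ball_zero_iff.1 hb).le
  have hk1 : (1 : ℝ) ≤ k := by exact_mod_cast hk
  have h : ‖b * -fExtension D n b‖ ≤ 1 / (8 * k) := by
    refine (norm_mul_le _ _).trans ?_
    rw [norm_neg]
    refine (mul_le_mul hb' (norm_fExtension_le D hD hR h1 h2 hb) (norm_nonneg _)
      (by positivity)).trans (le_of_eq ?_)
    field_simp
    norm_num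
  refine ⟨h, h.trans ?_⟩
  rw [div_le_div_iff₀ (by positivity) (by norm_num)]
  linarith

include hD hR h1 h2 hk in
theorem isUnit_one_sub_mul_fExtension {n : ℕ} {b : Mat B n} (hb : b ∈ ncBall B (16 * R)⁻¹ n) :
    IsUnit (1 - b * -fExtension D n b) :=
  isUnit_one_sub_of_norm_lt_one
    ((norm_mul_fExtension_le D hD hR h1 h2 hk hb).2.trans_lt (by norm_num))

include hD hR h1 h2 hk in
theorem norm_hExtension_sub_le {n : ℕ} {b : Mat B n} (hb : b ∈ ncBall B (16 * R)⁻¹ n) :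
    ‖hExtension D n b - b‖ ≤ R⁻¹ / k := by
  have hb' : ‖b‖ ≤ (16 * R)⁻¹ := (mem_ball_zero_iff.1 hb).le
  have hy := norm_mul_fExtension_le D hD hR h1 h2 hk hb
  have hu := isUnit_one_sub_mul_fExtension D hD hR h1 h2 hk hb
  rw [hExtension]
  set y := b * -fExtension D n b
  have e : Ring.inverse (1 - y) * b - b = Ring.inverse (1 - y) * y * b := by
    have h := Ring.inverse_mul_cancel _ hu
    rw [mul_sub, mul_one, sub_eq_iff_eq_add'] at h
    nth_rw 1 [h]
    rw [add_mul, one_mul, add_sub_cancel_right]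
  rw [e]
  have hk0 : (0 : ℝ) < k := by exact_mod_cast hk
  calc ‖Ring.inverse (1 - y) * y * b‖ ≤ 2 * (1 / (8 * k)) * (16 * R)⁻¹ := by
        refine (norm_mul_le _ _).trans (mul_le_mul ((norm_mul_le _ _).trans ?_) hb'
          (norm_nonneg _) (by positivity))
        exact mul_le_mul (norm_inverse_one_sub_le hy.2) hy.1 (norm_nonneg _) (by norm_num)
    _ = 1 / 64 * (R⁻¹ / k) := by field_simp; norm_num
    _ ≤ R⁻¹ / k := mul_le_of_le_one_left (by positivity) (by norm_num)

include hD hR in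
theorem isNCMap_fExtension : IsNCMap (ncBall B (16 * R)⁻¹) (fExtension D) :=
  (IsNCMap.const (-ν NCPoly.X)).sub (IsNCMap.S D fun _ _ hb =>
    (norm_mul_le_of_mem_ncBall D hD hR hb).trans_lt (by norm_num))

include hD hR h1 h2 hk in
theorem isNCMap_hExtension : IsNCMap (ncBall B (16 * R)⁻¹) (hExtension D) := by
  have h0 : IsNCMap (ncBall B (16 * R)⁻¹) fun n (_ : Mat B n) => diagHom n B (0 : B) :=
    IsNCMap.const 0
  have h : IsNCMap (ncBall B (16 * R)⁻¹) fun n b => -fExtension D n b := by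
    simpa only [map_zero, zero_sub] using h0.sub (isNCMap_fExtension D hD hR)
  exact ((IsNCMap.one.sub (IsNCMap.id.mul h)).inverse fun n b hb =>
    isUnit_one_sub_mul_fExtension D hD hR h1 h2 hk hb).mul IsNCMap.id

include hD hR in
theorem nevanlinna_inverse {n : ℕ} {b : Mat B n} (hb : b ∈ ncBall B (16 * R)⁻¹ n)
    (hu : IsUnit b) : nevanlinna D n (Ring.inverse b) = Ring.inverse b + fExtension D n b := by
  rw [nevanlinna, fExtension, D.G_eq_S (Ring.inverse_mul_cancel b hu) (Ring.mul_inverse_cancel b hu)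
    ((norm_mul_le_of_mem_ncBall D hD hR hb).trans_lt (by norm_num)), map_neg]
  abel

include hD hR h1 h2 hk in
-- Factor F(b⁻¹) = b⁻¹ (1 + b f(b)) with f = `fExtension`; inverting removes every occurrence of
-- b⁻¹.
theorem inverse_nevanlinna_inverse {n : ℕ} {b : Mat B n} (hb : b ∈ ncBall B (16 * R)⁻¹ n)
    (hu : IsUnit b) : Ring.inverse (nevanlinna D n (Ring.inverse b)) = hExtension D n b := by
  have hw := isUnit_one_sub_mul_fExtension D hD hR h1 h2 hk hb
  have hcb := Ring.inverse_mul_cancel b hu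
  have hbc := Ring.mul_inverse_cancel b hu
  have e : nevanlinna D n (Ring.inverse b) =
      Ring.inverse b * (1 - b * -fExtension D n b) := by
    rw [nevanlinna_inverse D hD hR hb hu, mul_sub, mul_one, ← mul_assoc, hcb, one_mul,
      sub_neg_eq_add]
  rw [e, hExtension]
  refine ringInverse_eq ?_ ?_
  · rw [mul_assoc, ← mul_assoc _ (Ring.inverse (1 - _)), Ring.mul_inverse_cancel _ hw, one_mul, hcb]
  · rw [mul_assoc, ← mul_assoc b, hbc, one_mul, Ring.inverse_mul_cancel _ hw]

end Bounds

theorem IsMonotonePower.exists_extension (hμ : IsDistribution μ) (hν : IsDistribution ν)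
    (h : IsMonotonePower ν k μ) (hk : 1 ≤ k) (hR : 0 < R) (hμR : IsExpBounded μ R) :
    (∀ ε : ℝ, 0 < ε → ∀ n, ∀ b ∈ halfPlane B ε n,
      ‖fTransform ν n b - b‖ ≤ (R + 6 * R ^ 2 * ε⁻¹) / k) ∧
    ∃ A H : ∀ n, Mat B n → Mat B n,
      IsAnalyticNC (ncBall B (16 * R)⁻¹) A ∧ IsAnalyticNC (ncBall B (16 * R)⁻¹) H ∧
      (∀ n, ∀ b ∈ ncBall B (16 * R)⁻¹ n, IsUnit b → Ring.inverse b ∈ upperHalfPlane B n →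
        A n b = fTransform ν n (Ring.inverse b) - Ring.inverse b ∧
        H n b = Ring.inverse (fTransform ν n (Ring.inverse b)) ∧
        H n b = cauchyTransform ν n (Ring.inverse b)) ∧
      ∀ n, ∀ b ∈ ncBall B (16 * R)⁻¹ n, ‖A n b‖ ≤ 2 * R / k ∧ ‖H n b - b‖ ≤ R⁻¹ / k := by
  obtain ⟨D, hD, h1, h2, hF⟩ := h.exists_dilation hμ hν hk hR hμR
  refine ⟨fun ε hε n b hb => ?_, fExtension D, hExtension D,
    (isNCMap_fExtension D hD hR).isAnalyticNC,
    (isNCMap_hExtension D hD hR h1 h2 hk).isAnalyticNC, fun n b hb hu hm => ?_, fun n b hb =>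
    ⟨norm_fExtension_le D hD hR h1 h2 hb, norm_hExtension_sub_le D hD hR h1 h2 hk hb⟩⟩
  · have hb' := imGe_of_mem_halfPlane hb
    rw [(hF n b (mem_upperHalfPlane_iff.2 ⟨ε, hε, hb'⟩)).1]
    refine (norm_nevanlinna_sub_le D hε hb').trans ?_
    have h3 : 6 * ‖booleanMap ν 1‖ * ε⁻¹ ≤ 6 * (R ^ 2 / k) * ε⁻¹ :=
      mul_le_mul_of_nonneg_right (by linarith) (by positivity)
    refine (add_le_add h1 h3).trans (le_of_eq ?_)
    ring
  · rw [(hF n _ hm).1, (hF n _ hm).2, inverse_nevanlinna_inverse D hD hR h1 h2 hk hb hu,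
      nevanlinna_inverse D hD hR hb hu, add_sub_cancel_left]
    exact ⟨rfl, rfl, rfl⟩

theorem exists_forall_div_lt (C : ℝ) {δ : ℝ} (hδ : 0 < δ) :
    ∃ K : ℕ, ∀ k, K ≤ k → 1 ≤ k ∧ C / k < δ := by
  have h := (tendsto_const_div_atTop_nhds_zero_nat C).eventually_lt_const hδ
  obtain ⟨K, hK⟩ := eventually_atTop.1 h
  exact ⟨max K 1, fun k hk => ⟨(le_max_right _ _).trans hk, hK k ((le_max_left _ _).trans hk)⟩⟩

end Extension

end OpVal

end

theorem mainTheorem9 (M : ℝ) :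
    ∃ r : ℝ, 0 < r ∧
      ∀ (B : Type*) [CStarAlgebra B] [PartialOrder B] [StarOrderedRing B]
        (μ : OpVal.NCPoly B →ₗ[ℂ] B) (μs : ℕ → (OpVal.NCPoly B →ₗ[ℂ] B)),
        OpVal.IsDistribution μ → OpVal.IsExpBounded μ M →
        (∀ k, 1 ≤ k → OpVal.IsDistribution (μs k) ∧ OpVal.IsMonotonePower (μs k) k μ) →
        -- uniform convergence of the `F`-transforms on `M_n^{+,ε}(B)`, uniformly in `n`
        (∀ ε : ℝ, 0 < ε → ∀ δ : ℝ, 0 < δ → ∃ K : ℕ, ∀ k, K ≤ k → ∀ n,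
          ∀ b ∈ OpVal.halfPlane B ε n, ‖OpVal.fTransform (μs k) n b - b‖ < δ) ∧
        -- the analytic extensions `A k` and `H k` to `B_r^{nc}(0)`
        ∃ A H : ℕ → ∀ n, OpVal.Mat B n → OpVal.Mat B n,
          (∀ k, 1 ≤ k →
            OpVal.IsAnalyticNC (OpVal.ncBall B r) (A k) ∧
            OpVal.IsAnalyticNC (OpVal.ncBall B r) (H k) ∧
            ∀ n, ∀ b ∈ OpVal.ncBall B r n, IsUnit b →
              Ring.inverse b ∈ OpVal.upperHalfPlane B n →
                A k n b = OpVal.fTransform (μs k) n (Ring.inverse b) - Ring.inverse b ∧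
                H k n b = Ring.inverse (OpVal.fTransform (μs k) n (Ring.inverse b)) ∧
                H k n b = OpVal.cauchyTransform (μs k) n (Ring.inverse b)) ∧
          (∀ δ : ℝ, 0 < δ → ∃ K : ℕ, ∀ k, K ≤ k → ∀ n,
            ∀ b ∈ OpVal.ncBall B r n, ‖A k n b‖ < δ) ∧
          (∀ δ : ℝ, 0 < δ → ∃ K : ℕ, ∀ k, K ≤ k → ∀ n,
            ∀ b ∈ OpVal.ncBall B r n, ‖H k n b - b‖ < δ) := by
  have hR : 0 < |M| + 1 := by positivity
  -- M may be zero or negative, so it is replaced by the positive exponential bound |M| + 1.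
  refine ⟨(16 * (|M| + 1))⁻¹, by positivity, fun B _ _ _ μ μs hμ hM hμs => ?_⟩
  have hMR : OpVal.IsExpBounded μ (|M| + 1) := hM.mono (lt_add_one |M|).le
  have key := fun k (hk : 1 ≤ k) =>
    (hμs k hk).2.exists_extension hμ (hμs k hk).1 hk hR hMR
  refine ⟨fun ε hε δ hδ => ?_, ?_⟩
  · obtain ⟨K, hK⟩ := OpVal.exists_forall_div_lt
      (|M| + 1 + 6 * (|M| + 1) ^ 2 * ε⁻¹) hδ
    exact ⟨K, fun k hk n b hb =>
      ((key k (hK k hk).1).1 ε hε n b hb).trans_lt (hK k hk).2⟩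
  · choose A H hA hH hAH hbd using fun k hk => (key k hk).2
    -- The value at k = 0 is arbitrary: the thresholds K from `exists_forall_div_lt` force k ≥ 1.
    refine ⟨fun k n b => if hk : 1 ≤ k then A k hk n b else 0,
      fun k n b => if hk : 1 ≤ k then H k hk n b else 0, fun k hk => ?_, fun δ hδ => ?_,
      fun δ hδ => ?_⟩
    · simp only [dif_pos hk]
      exact ⟨hA k hk, hH k hk, hAH k hk⟩
    · obtain ⟨K, hK⟩ := OpVal.exists_forall_div_lt (2 * (|M| + 1)) hδ
      refine ⟨K, fun k hk n b hb => ?_⟩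
      simp only [dif_pos (hK k hk).1]
      exact ((hbd k _ n b hb).1).trans_lt (hK k hk).2
    · obtain ⟨K, hK⟩ := OpVal.exists_forall_div_lt (|M| + 1)⁻¹ hδ
      refine ⟨K, fun k hk n b hb => ?_⟩
      simp only [dif_pos (hK k hk).1]
      exact ((hbd k _ n b hb).2).trans_lt (hK k hk).2
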